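/- **Notation.** Fix $k\in\mathbb N$. Let $\mathcal P^{(k)}$ be the set of partitions of $\mathbb N$ with at most $k$ blocks, with the $\sigma$-field generated by the restrictions $B\mapsto B_{|[n]}$, $n\ge 1$, and let $\mathcal P^{(k)}_{[n]}$ be the set of partitions of $[n]=\{1,\dots,n\}$ with at most $k$ blocks. Let $\Delta_k=\{s\in\mathbb R^k: s_1\ge\dots\ge s_k\ge 0,\ \sum_i s_i=1\}$. Let $\nu$ be a probability measure on $\Delta_k$ and let $\lambda>0$. For $s\in\Delta_k$ let $\varrho_s$ be the law of the partition of $\mathbb N$ with $i\sim j\iff \xi_i=\xi_j$, where $\xi_1,\xi_2,\dots$ are i.i.d. with $\mathbb P(\xi_i=j)=s_j$, and let $\varrho_\nu=\int\varrho_s\,\nu(ds)$. Write $\#B$ for the number of blocks of $B$ and, for $b\subset[n]$ and a partition $B'$ of $[n]$, $\varrho_\nu(B'_{|b})$ for the $\varrho_\nu$-probability that a partition of $\mathbb N$ restricts to $B'_{|b}$ on $b$. A *$\varrho_\nu$-Markov process* is a càdlàg process $B=(B(t),t\ge 0)$ on $\mathcal P^{(k)}$ such that, for every $n$, $B_{|[n]}$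 is a Markov process on $\mathcal P^{(k)}_{[n]}$ with $Q$-matrix $$Q_n(B,B')=\lambda\,p_n(B,B')\ (B\ne B'),\qquad Q_n(B,B)=\lambda\,(p_n(B,B)-1),$$ $$p_n(B,B')=\frac{k!}{(k-\#B')!}\prod_{b\in B}\frac{(k-\#B'_{|b})!}{k!}\,\varrho_\nu(B'_{|b}).$$ The asymptotic frequency of $A\subset\mathbb N$ is $\|A\|=\lim_n \#(A\cap[n])/n$, if this limit exists. If all blocks of $B\in\mathcal P^{(k)}$ have asymptotic frequencies, $\Lambda(B)\in\mathbb R^k$ denotes their decreasing arrangement, padded with zeros. Write $v^\downarrow$ for the decreasing arrangement of a vector $v$. **Construction of $X$.** Let $p_0$ be a random element of $\Delta_k$, and let $P'$ be a Poisson point process on $\mathbb R^+\times\Delta_k^{\,k}$ with intensity $dt\otimes\lambda\nu^{(k)}$, where $\nu^{(k)}=\nu\otimes\dots\otimes\nu$, independent of $p_0$. To each atom of $P'$ (in order of time) attach $k$ permutations $\sigma_1,\dots,\sigma_k$ of $[k]$; all these permutations are i.i.d. uniform and independent of $(p_0,P')$. Put $X(0)=p_0$. Let $X$ be constant between atom times,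 and at an atom $(t,P'_1,\dots,P'_k)$, where $P'_i=(P^i_1,\dots,P^i_k)$, $X(t-)=(x_1,\dots,x_k)$ and $\sigma_1,\dots,\sigma_k$ are the attached permutations, put $$X(t)=\Bigl(\sum_{i=1}^k x_i\,P^i_{\sigma_i(j)},\ 1\le j\le k\Bigr)^{\downarrow}.$$ **Theorem.** Let $B$ be a $\varrho_\nu$-Markov process whose initial state $B(0)$ is an exchangeable random partition. Then: 1. Almost surely, for all $t\ge0$ simultaneously, every block of $B(t)$ has an asymptotic frequency. 2. Let $X$ be constructed as above with $X(0)=p_0$ distributed as $\Lambda(B(0))$. Then the processes $(X(t),t\ge0)$ and $(\Lambda(B(t)),t\ge0)$ have the same law (on path space with the product $\sigma$-field, i.e. the same finite-dimensional distributions). -/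

import Mathlib

open MeasureTheory ProbabilityTheory Filter Topology
open scoped NNReal ENNReal

/-! ### Partitions with at most `k` blocks -/

/-- Partitions of `α` with at most `k` blocks, as equivalence relations. For `α = ℕ` this is
`𝒫^(k)` and for `α = Fin n` it is `𝒫^(k)_[n]` (the ground set is indexed from `0`). -/
def BoundedPartition (α : Type*) (k : ℕ) : Type _ :=
  {π : Setoid α // π.classes.encard ≤ k}

namespace BoundedPartition

variable {α β : Type*} {k : ℕ}

/-- The set of (non-empty) blocks. -/
def blocks (π : BoundedPartition α k) : Set (Set α) := π.1.classes

theorem encard_classes_comap_le (f : β → α) (π : Setoid α) :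
    (π.comap f).classes.encard ≤ π.classes.encard := by
  have h : (π.comap f).classes ⊆ (fun A : Set α => f ⁻¹' A) '' π.classes := by
    rintro _ ⟨y, rfl⟩
    exact ⟨{x | π x (f y)}, π.mem_classes (f y), rfl⟩
  exact (Set.encard_le_encard h).trans (Set.encard_image_le _ _)

/-- The partition pulled back along `f`: `i ∼ j` iff `f i ∼ f j`. -/
def comap (f : β → α) (π : BoundedPartition α k) : BoundedPartition β k :=
  ⟨π.1.comap f, (encard_classes_comap_le f π.1).trans π.2⟩

/-- The restriction `B_{|[n]}` of a partition of `ℕ` to its first `n` elements. -/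
def restrict (n : ℕ) (π : BoundedPartition ℕ k) : BoundedPartition (Fin n) k :=
  π.comap (Fin.val : Fin n → ℕ)

/-- The restriction `B_{|b}` of a partition to a subset `b`. -/
def restrictTo (π : BoundedPartition α k) (b : Set α) : BoundedPartition b k :=
  π.comap (Subtype.val : b → α)

/-- The σ-field generated by the events `i ∼ j`. It is the discrete one for finite `α`, and the one
generated by all restrictions to `[n]` for `α = ℕ`. -/
instance : MeasurableSpace (BoundedPartition α k) :=
  MeasurableSpace.generateFrom {S | ∃ i j : α, S = {π | π.1 i j}}

instance [Finite α] : Finite (BoundedPartition α k) :=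
  Finite.of_injective (fun π : BoundedPartition α k => fun i j : α => π.1 i j) fun _ _ h =>
    Subtype.ext (Setoid.ext fun i j => iff_of_eq (congrFun (congrFun h i) j))

noncomputable instance [Finite α] : Fintype (BoundedPartition α k) := Fintype.ofFinite _

noncomputable instance : DecidableEq (BoundedPartition α k) := Classical.decEq _

end BoundedPartition

/-! ### The ranked simplex -/

/-- The ranked `k`-simplex: `s₁ ≥ … ≥ s_k ≥ 0` with `∑ s_i = 1`. -/
def RankedSimplex (k : ℕ) : Type :=
  {s : Fin k → ℝ // Antitone s ∧ (∀ i, 0 ≤ s i) ∧ ∑ i, s i = 1}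

instance (k : ℕ) : MeasurableSpace (RankedSimplex k) :=
  inferInstanceAs (MeasurableSpace {s : Fin k → ℝ // Antitone s ∧ (∀ i, 0 ≤ s i) ∧ ∑ i, s i = 1})

/-- The decreasing arrangement `v↓` of a vector. -/
noncomputable def decreasing {k : ℕ} (v : Fin k → ℝ) : Fin k → ℝ :=
  v ∘ Tuple.sort (fun i => OrderDual.toDual (v i))

theorem decreasing_antitone {k : ℕ} (v : Fin k → ℝ) : Antitone (decreasing v) :=
  fun _ _ h => OrderDual.toDual_le_toDual.1
    (Tuple.monotone_sort (fun i => OrderDual.toDual (v i)) h)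

/-! ### The paintbox -/

/-- The law `P_s(X = j) = s_j` of one colour. -/
noncomputable def colourLaw {k : ℕ} (s : RankedSimplex k) : Measure (Fin k) :=
  ∑ j, ENNReal.ofReal (s.1 j) • Measure.dirac j

/-- The partition `Π(x)` generated by a colouring: `i ∼ j` iff `x i = x j`. -/
def colourPartition {k : ℕ} (x : ℕ → Fin k) : BoundedPartition ℕ k :=
  ⟨Setoid.ker x, by
    have h : (Setoid.ker x).classes ⊆ Set.range fun c : Fin k => {y | x y = c} := by
      rintro _ ⟨y, rfl⟩
      exact ⟨x y, rfl⟩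
    refine (Set.encard_le_encard h).trans ?_
    rw [← Set.image_univ]
    exact (Set.encard_image_le _ _).trans (by simp)⟩

/-- The paintbox `ϱ_s`: the law of `Π(X)` for i.i.d. colours `X₁, X₂, …` of law `P_s`. -/
noncomputable def paintbox {k : ℕ} (s : RankedSimplex k) : Measure (BoundedPartition ℕ k) :=
  (Measure.infinitePi fun _ : ℕ => colourLaw s).map colourPartition

/-- The paintbox based on `ν`: `ϱ_ν(·) = ∫ ϱ_s(·) ν(ds)`. -/
noncomputable def mixedPaintbox {k : ℕ} (ν : Measure (RankedSimplex k)) :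
    Measure (BoundedPartition ℕ k) :=
  ν.bind paintbox

/-! ### The `ϱ_ν`-Markov process -/

section MarkovProcess

variable {k : ℕ}

/-- For a block `b ⊆ [n]` and a partition `B'` of `[n]`, the probability `ϱ_ν(B'_{|b})` that a
paintbox partition agrees with `B'` on `b`. -/
noncomputable def paintboxProb (ν : Measure (RankedSimplex k)) {n : ℕ}
    (B' : BoundedPartition (Fin n) k) (b : Set (Fin n)) : ℝ :=
  (mixedPaintbox ν).real {π | (π.restrict n).restrictTo b = B'.restrictTo b}

/-- The transition probability
`p_n(B, B'; ν) = k! / (k - #B')! * ∏_{b ∈ B} (k - #B'_{|b})! / k! * ϱ_ν(B'_{|b})`. -/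
noncomputable def transProb (ν : Measure (RankedSimplex k)) {n : ℕ}
    (B B' : BoundedPartition (Fin n) k) : ℝ :=
  (k.factorial : ℝ) / ((k - B'.blocks.ncard).factorial : ℝ) *
    ∏ b ∈ (Set.toFinite B.blocks).toFinset,
      ((k - (B'.restrictTo b).blocks.ncard).factorial : ℝ) / (k.factorial : ℝ) *
        paintboxProb ν B' b

/-- The generator `Q_n^ν`: `λ p_n(B, B')` off the diagonal and `λ (p_n(B, B) - 1)` on it. -/
noncomputable def generatorMatrix (lam : ℝ≥0) (ν : Measure (RankedSimplex k)) (n : ℕ) :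
    Matrix (BoundedPartition (Fin n) k) (BoundedPartition (Fin n) k) ℝ :=
  Matrix.of fun B B' =>
    (lam : ℝ) * (if B = B' then transProb ν B B - 1 else transProb ν B B')

/-- `Y` is a continuous-time Markov process on the finite set `S` with `Q`-matrix `Q`: its
transition probabilities over a time span `u` are the entries of `exp (u Q)`. -/
def IsMarkovWithQMatrix {Ω S : Type*} [MeasurableSpace Ω] [Fintype S] [DecidableEq S]
    (P : Measure Ω) (Q : Matrix S S ℝ) (Y : ℝ≥0 → Ω → S) : Prop :=
  ∀ (m : ℕ) (t : Fin (m + 1) → ℝ≥0), Monotone t → ∀ y : Fin (m + 1) → S,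
    P.real {ω | ∀ i, Y (t i) ω = y i} =
      P.real {ω | Y (t 0) ω = y 0} *
        ∏ i : Fin m, (NormedSpace.exp (((t i.succ : ℝ) - (t i.castSucc : ℝ)) • Q))
          (y i.castSucc) (y i.succ)

/-- A path in a discrete space is càdlàg: right-continuous with left limits. -/
def IsDiscreteCadlag {S : Type*} (y : ℝ≥0 → S) : Prop :=
  ∀ t : ℝ≥0, (∀ᶠ u in 𝓝[>] t, y u = y t) ∧ ∃ z : S, ∀ᶠ u in 𝓝[<] t, y u = z

/-- A `ϱ_ν`-Markov process with rate `λ`: a càdlàg process on `𝒫^(k)` all of whose restrictions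
to `[n]` are Markov with `Q`-matrix `Q_n^ν`. -/
structure IsPaintboxMarkovProcess {Ω : Type*} [MeasurableSpace Ω] (P : Measure Ω)
    (lam : ℝ≥0) (ν : Measure (RankedSimplex k)) (B : ℝ≥0 → Ω → BoundedPartition ℕ k) : Prop where
  measurable : ∀ t, Measurable (B t)
  markov : ∀ n : ℕ,
    IsMarkovWithQMatrix P (generatorMatrix lam ν n) (fun t ω => (B t ω).restrict n)
  cadlag : ∀ᵐ ω ∂P, ∀ n : ℕ, IsDiscreteCadlag fun t => (B t ω).restrict n

/-- A random partition `R` of `ℕ` is exchangeable: `σ(R_{|[n]}) ∼ R_{|[n]}` for all `n` and all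
permutations `σ` of `[n]`. -/
def IsExchangeablePartition {Ω : Type*} [MeasurableSpace Ω] (P : Measure Ω)
    (R : Ω → BoundedPartition ℕ k) : Prop :=
  ∀ (n : ℕ) (τ : Equiv.Perm (Fin n)),
    IdentDistrib (fun ω => ((R ω).restrict n).comap τ) (fun ω => (R ω).restrict n) P P

end MarkovProcess

/-! ### Asymptotic frequencies -/

/-- `A ⊆ ℕ` has asymptotic frequency `x`. -/
def HasAsymptoticFreq (A : Set ℕ) (x : ℝ) : Prop :=
  Tendsto (fun n : ℕ => ({i | i < n ∧ i ∈ A}.ncard : ℝ) / n) atTop (𝓝 x)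

open Classical in
/-- The asymptotic frequency `‖A‖` of `A` (`0` if it does not exist). -/
noncomputable def asymptoticFreq (A : Set ℕ) : ℝ :=
  if h : ∃ x, HasAsymptoticFreq A x then h.choose else 0

namespace BoundedPartition

variable {k : ℕ}

/-- Every block of `π` has an asymptotic frequency. -/
def HasFrequencies (π : BoundedPartition ℕ k) : Prop :=
  ∀ A ∈ π.blocks, ∃ x, HasAsymptoticFreq A x

/-- The least element of the block of `j`. -/
noncomputable def leader (π : BoundedPartition ℕ k) (j : ℕ) : ℕ := sInf {l | π.1 l j}

/-- The `i`-th block (from `0`) in the order of least elements, empty if `i ≥ #π`: it consists of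
those `j` for which exactly `i` blocks have a smaller least element than the block of `j`. -/
def orderedBlock (π : BoundedPartition ℕ k) (i : ℕ) : Set ℕ :=
  {j | {l | π.leader l = l ∧ l < π.leader j}.ncard = i}

/-- `Λ(π) = (‖π₁‖, …, ‖π_k‖)↓`, with `π_i = ∅` for `i > #π`. -/
noncomputable def rankedFreq (π : BoundedPartition ℕ k) : Fin k → ℝ :=
  decreasing fun i => asymptoticFreq (π.orderedBlock i)

end BoundedPartition

/-! ### Poisson point processes -/

/-- The random set `N ⊆ E` is a Poisson point process with (σ-finite) intensity measure `μ`: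
the number of points in a set `A` with `μ A < ∞` is Poisson with mean `μ A`, and the numbers of
points in disjoint sets are independent. -/
structure IsPoissonPointProcess {Ω E : Type*} [MeasurableSpace Ω] [MeasurableSpace E]
    (P : Measure Ω) (N : Ω → Set E) (μ : Measure E) : Prop where
  measurable : ∀ A, MeasurableSet A → Measurable fun ω => (N ω ∩ A).encard
  poisson : ∀ A, MeasurableSet A → μ A ≠ ∞ → ∀ j : ℕ,
    P {ω | (N ω ∩ A).encard = j} = poissonMeasure (μ A).toNNReal {j}
  indep : ∀ (m : ℕ) (A : Fin m → Set E), (∀ i, MeasurableSet (A i)) →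
    Pairwise (fun i j => Disjoint (A i) (A j)) →
      iIndepFun (fun i ω => (N ω ∩ A i).encard) P

/-- Lebesgue measure `dt` on `ℝ⁺ = [0, ∞)`. -/
noncomputable def lebesgueNonneg : Measure ℝ≥0 :=
  (volume : Measure ℝ).comap ((↑) : ℝ≥0 → ℝ)

/-! ### The process on the ranked simplex -/

instance (k : ℕ) : MeasurableSpace (Equiv.Perm (Fin k)) := ⊤

section RankedMassProcess

variable {k : ℕ}

/-- The ranked column totals `(∑ i, x_i P^i_{σ_i(j)}, 1 ≤ j ≤ k)↓`. -/
noncomputable def rankedStep (x : RankedSimplex k) (p : Fin k → RankedSimplex k)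
    (σ : Fin k → Equiv.Perm (Fin k)) : RankedSimplex k :=
  ⟨decreasing fun j => ∑ i, x.1 i * (p i).1 (σ i j), decreasing_antitone _,
    fun j => by
      simp only [decreasing, Function.comp_apply]
      exact Finset.sum_nonneg fun i _ => mul_nonneg (x.2.2.1 i) ((p i).2.2.1 _), by
      unfold decreasing
      simp only [Function.comp_apply]
      rw [Equiv.sum_comp (Tuple.sort _) (fun j => ∑ i, x.1 i * (p i).1 (σ i j)),
        Finset.sum_comm]
      simp_rw [← Finset.mul_sum]
      have h : ∀ i, ∑ j, (p i).1 (σ i j) = 1 := fun i => by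
        rw [Equiv.sum_comp (σ i) (p i).1]; exact (p i).2.2.2
      simp [h, x.2.2.2]⟩

/-- The states visited: start in `x`, and use the marks `p m` and the permutations `σ m` at the
`m`-th atom. -/
noncomputable def rankedStates (x : RankedSimplex k) (p : ℕ → Fin k → RankedSimplex k)
    (σ : ℕ → Fin k → Equiv.Perm (Fin k)) : ℕ → RankedSimplex k
  | 0 => x
  | m + 1 => rankedStep (rankedStates x p σ m) (p m) (σ m)

/-- The path which starts in `x`, jumps by `rankedStep` at each of the atom times
`T 0 < T 1 < ⋯`, and is constant in between: at time `t` the number of jumps made is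
`#{m | T m ≤ t}`. -/
noncomputable def rankedPath (x : RankedSimplex k) (T : ℕ → ℝ≥0)
    (p : ℕ → Fin k → RankedSimplex k) (σ : ℕ → Fin k → Equiv.Perm (Fin k)) (t : ℝ≥0) :
    RankedSimplex k :=
  rankedStates x p σ {m | T m ≤ t}.ncard

/-- The random input of the construction of `X`: an initial state `p₀`; the atoms
`(T m, M m)`, listed in increasing order of time, of a Poisson point process on
`ℝ⁺ × ∏_{i ≤ k} Δ_k` with intensity `dt ⊗ λ ν^(k)`, independent of `p₀`; and, independently of all
this, i.i.d. uniform permutations `σ m 1, …, σ m k` of `[k]` for each `m`. -/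
structure IsRankedMassInput {Ω : Type*} [MeasurableSpace Ω] (P : Measure Ω)
    (lam : ℝ≥0) (ν : Measure (RankedSimplex k)) (p₀ : Ω → RankedSimplex k)
    (T : ℕ → Ω → ℝ≥0) (M : ℕ → Ω → Fin k → RankedSimplex k)
    (σ : ℕ → Ω → Fin k → Equiv.Perm (Fin k)) : Prop where
  measurable_init : Measurable p₀
  measurable_time : ∀ m, Measurable (T m)
  measurable_mark : ∀ m, Measurable (M m)
  measurable_perm : ∀ m, Measurable (σ m)
  strictMono : ∀ᵐ ω ∂P, StrictMono fun m => T m ω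
  poisson : IsPoissonPointProcess P (fun ω => Set.range fun m => (T m ω, M m ω))
    (lebesgueNonneg.prod (lam • Measure.pi fun _ : Fin k => ν))
  indep_init : IndepFun p₀ (fun ω (m : ℕ) => (T m ω, M m ω)) P
  perm_uniform : ∀ m i τ, P {ω | σ m ω i = τ} = (k.factorial : ℝ≥0∞)⁻¹
  perm_indep : iIndepFun (fun (q : ℕ × Fin k) ω => σ q.1 ω q.2) P
  indep_perm : IndepFun (fun ω => (p₀ ω, fun m : ℕ => (T m ω, M m ω)))
    (fun ω (m : ℕ) => σ m ω) P

end RankedMassProcess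

/-! Both processes are discrete chains run on a Poisson clock of rate `lam`, and the ranked
frequency map carries one chain to the other.

On the partition side, `partitionKernel` gives every old block its own random mass partition, i.i.d.
colours drawn from it and a uniform permutation of the colours; the new blocks are the classes of
equal colour. Counting colourings shows that the restriction of this chain to [n] has transition
matrix p_n (`partitionKernel_real_restrict`). Since Q_n = lam (p_n - 1), its exponential is a
Poisson mixture of powers of p_n. Finite restrictions determine laws, so the whole partition process
has the transition kernels `poissonizedKernel (partitionKernel ν) (lam * u)`.

If a partition has frequencies x_i, the law of large numbers inside each block shows that the class
of colour j has frequency ∑ x_i P^i_{σ_i(j)} after one step. Hence frequencies persist, and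
`rankedFreq` intertwines `partitionKernel` with `massKernel` (`partitionKernel_map_rankedFreq`).
Dynkin's criterion (`HasTransition.map`) then makes the ranked frequencies Markov with the Poisson
mixtures of `massKernel`.

On the mass side, the atoms of the Poisson process have i.i.d. marks independent of their times, and
the counts of atoms in disjoint time intervals are independent Poisson variables. So the constructed
process is the `massKernel` chain on an independent Poisson clock, with the same transition kernels
(`IsRankedMassInput.hasTransition`). Equal initial laws give equal finite-dimensional distributions.

Simultaneous existence of frequencies needs more than the statement at fixed times. Exchangeability
gives frequencies at time 0 by a second moment argument, and the kernels give them almost surely at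
all dyadic times. The expected number of changes of the entire partition along a dyadic grid of [0,
N] is at most N lam, whatever the mesh. By Fatou's lemma the partition is therefore constant along
the dyadic times just after any given t, and right-continuity of each restriction identifies its
value at t with one taken at a dyadic time. -/

/-! ### Averages and asymptotic frequencies -/

/-- The average of the first `n` terms of a sequence. -/
noncomputable def seqAverage (Y : ℕ → ℝ) (n : ℕ) : ℝ := (∑ i ∈ Finset.range n, Y i) / n

theorem hasAsymptoticFreq_iff (A : Set ℕ) (x : ℝ) :
    HasAsymptoticFreq A x ↔ Tendsto (seqAverage (A.indicator 1)) atTop (𝓝 x) := by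
  classical
  have h : ∀ n : ℕ, (({i | i < n ∧ i ∈ A}.ncard : ℝ)) = ∑ i ∈ Finset.range n, A.indicator 1 i := by
    intro n
    have : {i | i < n ∧ i ∈ A} = ((Finset.range n).filter (· ∈ A) : Finset ℕ) := by
      ext i; simp
    rw [this, Set.ncard_coe_finset, Finset.card_filter]
    push_cast
    refine Finset.sum_congr rfl fun i _ => ?_
    by_cases hi : i ∈ A <;> simp [hi]
  unfold HasAsymptoticFreq
  have h2 : (fun n : ℕ => (({i | i < n ∧ i ∈ A}.ncard : ℝ)) / n) = seqAverage (A.indicator 1) := by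
    funext n; rw [seqAverage, h]
  rw [h2]

theorem HasAsymptoticFreq.asymptoticFreq_eq {A : Set ℕ} {x : ℝ} (h : HasAsymptoticFreq A x) :
    asymptoticFreq A = x := by
  have hx : ∃ x, HasAsymptoticFreq A x := ⟨x, h⟩
  unfold asymptoticFreq
  rw [dif_pos hx]
  exact tendsto_nhds_unique hx.choose_spec h

theorem hasAsymptoticFreq_asymptoticFreq {A : Set ℕ} (h : ∃ x, HasAsymptoticFreq A x) :
    HasAsymptoticFreq A (asymptoticFreq A) := by
  obtain ⟨x, hx⟩ := h
  rwa [hx.asymptoticFreq_eq]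

theorem hasAsymptoticFreq_empty : HasAsymptoticFreq ∅ 0 := by
  simp [HasAsymptoticFreq]

/-! ### Measurability of frequencies of a random set -/

section RandomSet

variable {Ω : Type*} [MeasurableSpace Ω] {S : Ω → Set ℕ}

theorem measurable_seqAverage_indicator (hS : ∀ x, MeasurableSet {ω | x ∈ S ω}) (n : ℕ) :
    Measurable fun ω => seqAverage ((S ω).indicator 1) n := by
  classical
  unfold seqAverage
  refine Measurable.div_const (Finset.measurable_sum _ fun i _ => ?_) _
  have : (fun ω => (S ω).indicator (1 : ℕ → ℝ) i) = {ω | i ∈ S ω}.indicator 1 := by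
    funext ω
    by_cases h : i ∈ S ω <;> simp [h, Set.indicator]
  rw [this]
  exact measurable_one.indicator (hS i)

theorem measurableSet_exists_hasAsymptoticFreq (hS : ∀ x, MeasurableSet {ω | x ∈ S ω}) :
    MeasurableSet {ω | ∃ x, HasAsymptoticFreq (S ω) x} := by
  simp_rw [hasAsymptoticFreq_iff]
  exact measurableSet_exists_tendsto (measurable_seqAverage_indicator hS)

theorem measurable_asymptoticFreq (hS : ∀ x, MeasurableSet {ω | x ∈ S ω}) :
    Measurable fun ω => asymptoticFreq (S ω) := by
  set E := {ω | ∃ x, HasAsymptoticFreq (S ω) x} with hE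
  have hEm : MeasurableSet E := measurableSet_exists_hasAsymptoticFreq hS
  -- Cutting the averages off outside the convergence set makes them converge everywhere, with limit
  -- 0 exactly where `asymptoticFreq` takes its default value.
  refine measurable_of_tendsto_metrizable
    (f := fun n ω => E.indicator (fun ω => seqAverage ((S ω).indicator 1) n) ω)
    (fun n => (measurable_seqAverage_indicator hS n).indicator hEm) ?_
  rw [tendsto_pi_nhds]
  intro ω
  by_cases h : ω ∈ E
  · simp only [Set.indicator_of_mem h]
    exact (hasAsymptoticFreq_iff _ _).1 (hasAsymptoticFreq_asymptoticFreq h)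
  · simp only [Set.indicator_of_notMem h]
    have : asymptoticFreq (S ω) = 0 := by
      unfold asymptoticFreq
      exact dif_neg h
    rw [this]
    exact tendsto_const_nhds

end RandomSet

/-! ### Decreasing arrangements -/

theorem decreasing_comp_perm {k : ℕ} (v : Fin k → ℝ) (τ : Equiv.Perm (Fin k)) :
    decreasing (v ∘ τ) = decreasing v := by
  have h := Tuple.comp_perm_comp_sort_eq_comp_sort (f := fun i => OrderDual.toDual (v i)) (σ := τ)
  funext i
  exact congrArg OrderDual.ofDual (congrFun h i)

theorem measurable_decreasing {k : ℕ} : Measurable (decreasing : (Fin k → ℝ) → Fin k → ℝ) := by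
  have hs : Measurable fun v : Fin k → ℝ => Tuple.sort fun i => OrderDual.toDual (v i) := by
    refine measurable_to_countable' fun τ => ?_
    have : (fun v : Fin k → ℝ => Tuple.sort fun i => OrderDual.toDual (v i)) ⁻¹' {τ} =
        (⋂ i, ⋂ j, {v : Fin k → ℝ | i ≤ j → v (τ j) ≤ v (τ i)}) ∩
          ⋂ i, ⋂ j, {v | i < j → v (τ i) = v (τ j) → τ i < τ j} := by
      ext v
      simp only [Set.mem_preimage, Set.mem_singleton_iff, Set.mem_inter_iff, Set.mem_iInter,
        Set.mem_ofPred_eq]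
      rw [eq_comm, Tuple.eq_sort_iff]
      rfl
    rw [this]
    refine MeasurableSet.inter (MeasurableSet.iInter fun i => MeasurableSet.iInter fun j => ?_)
      (MeasurableSet.iInter fun i => MeasurableSet.iInter fun j => ?_)
    · by_cases h : i ≤ j
      · simp only [h, true_imp_iff]
        exact measurableSet_le (measurable_pi_apply _) (measurable_pi_apply _)
      · simp [h]
    · by_cases h : i < j
      · by_cases h' : τ i < τ j
        · simp [h']
        · simp only [h, h', true_imp_iff, imp_false]
          exact (measurableSet_eq_fun (measurable_pi_apply (τ i)) (measurable_pi_apply (τ j))).compl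
      · simp [h]
  refine measurable_pi_lambda _ fun i => ?_
  have h2 : Measurable fun q : (Fin k → ℝ) × Equiv.Perm (Fin k) => q.1 (q.2 i) :=
    measurable_from_prod_countable_left fun τ => measurable_pi_apply (τ i)
  exact h2.comp (measurable_id.prodMk hs)

/-- Two colourings with the same colour classes differ by a permutation of the colours. -/
theorem exists_perm_of_ker_eq {α : Type*} {k : ℕ} (f g : α → Fin k)
    (h : ∀ x y, f x = f y ↔ g x = g y) : ∃ τ : Equiv.Perm (Fin k), ∀ x, g x = τ (f x) := by
  classical
  -- The colours in use correspond bijectively; as `Fin k` is finite, this bijection of ranges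
  -- extends to the unused colours.
  let e : Set.range f ≃ Set.range g := Equiv.ofBijective
    (fun c => ⟨g c.2.choose, c.2.choose, rfl⟩) (by
      constructor
      · rintro ⟨_, hc⟩ ⟨_, hd⟩ hcd
        have h1 := (h _ _).2 (congrArg Subtype.val hcd)
        rw [hc.choose_spec, hd.choose_spec] at h1
        exact Subtype.ext h1
      · rintro ⟨_, x, rfl⟩
        refine ⟨⟨f x, x, rfl⟩, Subtype.ext ?_⟩
        exact (h _ _).1 (Exists.choose_spec (⟨x, rfl⟩ : ∃ y, f y = f x)))
  have he : ∀ x, (e ⟨f x, x, rfl⟩ : Fin k) = g x := fun x =>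
    (h _ _).1 (Exists.choose_spec (⟨x, rfl⟩ : ∃ y, f y = f x))
  refine ⟨e.extendSubtype, fun x => ?_⟩
  rw [Equiv.extendSubtype_apply_of_mem e (f x) ⟨x, rfl⟩, he]

/-! ### Labelling the blocks -/

namespace BoundedPartition

variable {α β : Type*} {k : ℕ}

theorem measurableSet_rel (i j : α) : MeasurableSet {π : BoundedPartition α k | π.1 i j} :=
  MeasurableSpace.measurableSet_generateFrom ⟨i, j, rfl⟩

theorem measurable_comap (f : β → α) :
    Measurable (comap f : BoundedPartition α k → BoundedPartition β k) := by
  refine measurable_generateFrom ?_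
  rintro _ ⟨i, j, rfl⟩
  exact measurableSet_rel (f i) (f j)

theorem measurable_restrict (n : ℕ) :
    Measurable (restrict n : BoundedPartition ℕ k → BoundedPartition (Fin n) k) :=
  measurable_comap _

@[ext] theorem ext_rel {π π' : BoundedPartition α k} (h : ∀ i j, π.1 i j ↔ π'.1 i j) : π = π' :=
  Subtype.ext (Setoid.ext h)

instance [Countable α] : MeasurableSingletonClass (BoundedPartition α k) where
  measurableSet_singleton π := by
    have : ({π} : Set (BoundedPartition α k)) = ⋂ i, ⋂ j, {π' | π'.1 i j ↔ π.1 i j} := by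
      ext π'
      simp only [Set.mem_singleton_iff, Set.mem_iInter, Set.mem_ofPred_eq]
      exact ⟨fun h i j => h ▸ Iff.rfl, fun h => ext_rel h⟩
    rw [this]
    refine MeasurableSet.iInter fun i => MeasurableSet.iInter fun j => ?_
    by_cases h : π.1 i j
    · simpa [h] using measurableSet_rel i j
    · simp only [h, iff_false]
      exact (measurableSet_rel i j).compl

theorem restrict_rel (n : ℕ) (π : BoundedPartition ℕ k) (i j : Fin n) :
    (π.restrict n).1 i j ↔ π.1 i j := Iff.rfl

theorem restrict_eq_iff {n : ℕ} {π π' : BoundedPartition ℕ k} :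
    π.restrict n = π'.restrict n ↔ ∀ i < n, ∀ j < n, (π.1 i j ↔ π'.1 i j) := by
  constructor
  · intro h i hi j hj
    rw [← restrict_rel n π ⟨i, hi⟩ ⟨j, hj⟩, ← restrict_rel n π' ⟨i, hi⟩ ⟨j, hj⟩, h]
  · intro h
    exact ext_rel fun i j => h i i.2 j j.2

theorem eq_of_forall_restrict_eq {π π' : BoundedPartition ℕ k}
    (h : ∀ n, π.restrict n = π'.restrict n) : π = π' :=
  ext_rel fun i j => restrict_eq_iff.1 (h (max i j + 1)) i (by omega) j (by omega)

theorem leader_rel (π : BoundedPartition ℕ k) (j : ℕ) : π.1 (π.leader j) j :=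
  Nat.sInf_mem (s := {l | π.1 l j}) ⟨j, π.1.refl j⟩

theorem leader_le_of_rel {π : BoundedPartition ℕ k} {l j : ℕ} (h : π.1 l j) : π.leader j ≤ l :=
  Nat.sInf_le h

theorem leader_le (π : BoundedPartition ℕ k) (j : ℕ) : π.leader j ≤ j :=
  leader_le_of_rel (π.1.refl j)

theorem leader_eq_iff {π : BoundedPartition ℕ k} {i j : ℕ} :
    π.leader i = π.leader j ↔ π.1 i j := by
  constructor
  · intro h
    exact π.1.trans (π.1.symm (π.leader_rel i)) (h ▸ π.leader_rel j)
  · intro h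
    exact le_antisymm (leader_le_of_rel (π.1.trans (π.leader_rel j) (π.1.symm h)))
      (leader_le_of_rel (π.1.trans (π.leader_rel i) h))

theorem leader_leader (π : BoundedPartition ℕ k) (j : ℕ) : π.leader (π.leader j) = π.leader j :=
  leader_eq_iff.2 (π.leader_rel j)

theorem encard_leaders_le (π : BoundedPartition ℕ k) : {l | π.leader l = l}.encard ≤ k := by
  have hinj : Set.InjOn (fun l => {x | π.1 x l}) {l | π.leader l = l} := by
    intro l hl m hm h
    have h1 : l ∈ {x | π.1 x m} := by
      rw [← show {x | π.1 x l} = {x | π.1 x m} from h]; exact π.1.refl l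
    rw [← show π.leader l = l from hl, ← show π.leader m = m from hm]
    exact leader_eq_iff.2 h1
  rw [← hinj.encard_image]
  refine (Set.encard_le_encard ?_).trans π.2
  rintro _ ⟨l, _, rfl⟩
  exact π.1.mem_classes l

theorem finite_leaders (π : BoundedPartition ℕ k) : {l | π.leader l = l}.Finite :=
  Set.finite_of_encard_le_coe π.encard_leaders_le

theorem ncard_leaders_le (π : BoundedPartition ℕ k) : {l | π.leader l = l}.ncard ≤ k :=
  ENat.natCast_le_natCast.1 (π.finite_leaders.cast_ncard_eq.trans_le π.encard_leaders_le)

theorem ncard_lt_of_leader_lt {π : BoundedPartition ℕ k} {i j : ℕ} (h : π.leader i < π.leader j) :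
    {l | π.leader l = l ∧ l < π.leader i}.ncard < {l | π.leader l = l ∧ l < π.leader j}.ncard := by
  refine Set.ncard_lt_ncard ⟨fun l hl => ⟨hl.1, hl.2.trans h⟩, fun hs => ?_⟩
    (π.finite_leaders.subset fun l hl => hl.1)
  exact lt_irrefl _ (hs (show π.leader i ∈ _ from ⟨π.leader_leader i, h⟩)).2

/-- The index of the block of `j` in the order of least elements. -/
noncomputable def label (π : BoundedPartition ℕ k) (j : ℕ) : Fin k :=
  ⟨{l | π.leader l = l ∧ l < π.leader j}.ncard, by
    refine lt_of_lt_of_le (Set.ncard_lt_ncard ⟨fun l hl => hl.1, fun hs => ?_⟩ π.finite_leaders)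
      π.ncard_leaders_le
    exact lt_irrefl _ (hs (show π.leader j ∈ _ from π.leader_leader j)).2⟩

theorem label_eq_iff {π : BoundedPartition ℕ k} {i j : ℕ} : π.label i = π.label j ↔ π.1 i j := by
  rw [← leader_eq_iff]
  constructor
  · intro h
    have h' := congrArg Fin.val h
    rcases lt_trichotomy (π.leader i) (π.leader j) with hlt | heq | hlt
    · exact absurd h' (ncard_lt_of_leader_lt hlt).ne
    · exact heq
    · exact absurd h' (ncard_lt_of_leader_lt hlt).ne'
  · intro h
    simp only [label, h]

theorem orderedBlock_eq (π : BoundedPartition ℕ k) (i : Fin k) :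
    π.orderedBlock i = {j | π.label j = i} := by
  ext j
  simp [orderedBlock, label, Fin.ext_iff]

/-- The leaders that decide the label of `j` are all at most `j`, so they are visible in the
restriction to the first `j + 1` elements. -/
theorem label_congr {π π' : BoundedPartition ℕ k} {j : ℕ}
    (h : π.restrict (j + 1) = π'.restrict (j + 1)) : π.label j = π'.label j := by
  rw [restrict_eq_iff] at h
  have key : ∀ l ≤ j, π.leader l = π'.leader l := by
    intro l hl
    refine le_antisymm (leader_le_of_rel ?_) (leader_le_of_rel ?_)
    · exact (h _ (by have := π'.leader_le l; omega) _ (by omega)).2 (π'.leader_rel l)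
    · exact (h _ (by have := π.leader_le l; omega) _ (by omega)).1 (π.leader_rel l)
  have : {l | π.leader l = l ∧ l < π.leader j} = {l | π'.leader l = l ∧ l < π'.leader j} := by
    ext l
    simp only [Set.mem_ofPred_eq]
    rw [key j le_rfl]
    refine and_congr_left fun hl => ?_
    rw [key l (by have := π'.leader_le j; omega)]
  simp only [label, this]

/-- Such a function factors through the finite discrete space of partitions of [n], so the σ-field
on the target is irrelevant. -/
theorem measurable_of_restrict {E : Type*} [MeasurableSpace E] (n : ℕ)
    {f : BoundedPartition ℕ k → E}
    (h : ∀ π π' : BoundedPartition ℕ k, π.restrict n = π'.restrict n → f π = f π') :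
    Measurable f := by
  intro s _
  have : f ⁻¹' s = restrict n ⁻¹' (restrict n '' (f ⁻¹' s)) := by
    refine Set.Subset.antisymm (Set.subset_preimage_image _ _) ?_
    rintro π ⟨π', hπ', he⟩
    rw [Set.mem_preimage, ← h _ _ he]
    exact hπ'
  rw [this]
  exact measurable_restrict n (Set.toFinite _).measurableSet

theorem measurable_label (j : ℕ) : Measurable fun π : BoundedPartition ℕ k => π.label j :=
  measurable_of_restrict (j + 1) fun _ _ => label_congr

@[simp] theorem colourPartition_rel (c : ℕ → Fin k) (i j : ℕ) :
    (colourPartition c).1 i j ↔ c i = c j := Iff.rfl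

theorem measurable_colourPartition :
    Measurable (colourPartition : (ℕ → Fin k) → BoundedPartition ℕ k) := by
  refine measurable_generateFrom ?_
  rintro _ ⟨i, j, rfl⟩
  exact measurableSet_eq_fun (measurable_pi_apply i) (measurable_pi_apply j)

theorem hasFrequencies_colourPartition_iff (c : ℕ → Fin k) :
    (colourPartition c).HasFrequencies ↔ ∀ j, ∃ x, HasAsymptoticFreq {i | c i = j} x := by
  constructor
  · intro h j
    by_cases hj : ∃ i, c i = j
    · obtain ⟨i, rfl⟩ := hj
      exact h _ ⟨i, rfl⟩
    · refine ⟨0, ?_⟩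
      convert hasAsymptoticFreq_empty
      ext i
      simpa using fun hi => hj ⟨i, hi⟩
  · rintro h _ ⟨i, rfl⟩
    exact h (c i)

theorem colourPartition_label (π : BoundedPartition ℕ k) : colourPartition π.label = π :=
  ext_rel fun _ _ => label_eq_iff

theorem hasFrequencies_iff (π : BoundedPartition ℕ k) :
    π.HasFrequencies ↔ ∀ j, ∃ x, HasAsymptoticFreq {i | π.label i = j} x := by
  conv_lhs => rw [← π.colourPartition_label]
  exact hasFrequencies_colourPartition_iff _

/-- Numbering blocks by least elements and by colours differs only by a permutation, which the
decreasing arrangement forgets. Unused colours match the empty blocks, of frequency 0. Frequencies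
may thus be computed from any colouring. -/
theorem rankedFreq_colourPartition (c : ℕ → Fin k) :
    (colourPartition c).rankedFreq = decreasing fun j => asymptoticFreq {i | c i = j} := by
  obtain ⟨τ, hτ⟩ := exists_perm_of_ker_eq (colourPartition c).label c
    fun x y => label_eq_iff.trans (colourPartition_rel c x y)
  rw [← decreasing_comp_perm _ τ]
  unfold rankedFreq
  congr 1
  funext i
  rw [orderedBlock_eq, Function.comp_apply]
  congr 1
  ext x
  simp [hτ x]

theorem measurableSet_label_eq (x : ℕ) (j : Fin k) :
    MeasurableSet {π : BoundedPartition ℕ k | π.label x = j} :=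
  measurable_label x (measurableSet_singleton j)

theorem measurableSet_hasFrequencies :
    MeasurableSet {π : BoundedPartition ℕ k | π.HasFrequencies} := by
  simp_rw [hasFrequencies_iff, Set.ofPred_forall]
  exact MeasurableSet.iInter fun j =>
    measurableSet_exists_hasAsymptoticFreq (S := fun π : BoundedPartition ℕ k => {i | π.label i = j})
      fun x => measurableSet_label_eq x j

theorem measurable_rankedFreq :
    Measurable (rankedFreq : BoundedPartition ℕ k → Fin k → ℝ) := by
  refine measurable_decreasing.comp (measurable_pi_lambda _ fun j => ?_)
  simp_rw [orderedBlock_eq]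
  exact measurable_asymptoticFreq (S := fun π : BoundedPartition ℕ k => {i | π.label i = j})
    fun x => measurableSet_label_eq x j

end BoundedPartition

/-! ### Laws of large numbers for bounded sequences -/

/-- The sums of `Y i + 1` are monotone, and consecutive indices (j + 1)^4 have ratio tending to 1,
so the averages in between are squeezed. The fourth power is chosen so that a root-mean-square bound
of order n^(-1/2) becomes the summable (j + 1)^(-2). -/
theorem tendsto_seqAverage_of_subseq {Y : ℕ → ℝ} (hY : ∀ i, |Y i| ≤ 1) {x : ℝ}
    (h : Tendsto (fun j : ℕ => seqAverage Y ((j + 1) ^ 4)) atTop (𝓝 x)) :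
    Tendsto (seqAverage Y) atTop (𝓝 x) := by
  have hmono : Monotone fun n : ℕ => ∑ i ∈ Finset.range n, (Y i + 1) :=
    monotone_nat_of_le_succ fun n => by
      rw [Finset.sum_range_succ]
      linarith [(abs_le.1 (hY n)).1]
  have hsum : ∀ n : ℕ, n ≠ 0 → (∑ i ∈ Finset.range n, (Y i + 1)) / (n : ℝ) = seqAverage Y n + 1 := by
    intro n hn
    have : (n : ℝ) ≠ 0 := by exact_mod_cast hn
    rw [Finset.sum_add_distrib, seqAverage]
    simp only [Finset.sum_const, Finset.card_range, nsmul_eq_mul, mul_one]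
    field_simp
  have key := tendsto_div_of_monotone_of_exists_subseq_tendsto_div
    (fun n : ℕ => ∑ i ∈ Finset.range n, (Y i + 1)) (x + 1) hmono (fun a ha => by
      refine ⟨fun j => (j + 1) ^ 4, ?_, ?_, ?_⟩
      · have h1 : Tendsto (fun n : ℕ => (1 + 1 / ((n : ℝ) + 1)) ^ 4) atTop (𝓝 ((1 + 0) ^ 4)) :=
          (tendsto_const_nhds.add tendsto_one_div_add_atTop_nhds_zero_nat).pow 4
        have h1a : ((1 : ℝ) + 0) ^ 4 < a := by simpa using ha
        filter_upwards [h1.eventually_lt_const h1a] with n hn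
        have hp : (0 : ℝ) < (n : ℝ) + 1 := by positivity
        have h2 : (((n + 1 + 1 : ℕ) : ℝ)) = (1 + 1 / ((n : ℝ) + 1)) * ((n : ℝ) + 1) := by
          push_cast
          field_simp
        rw [Nat.cast_pow, h2, mul_pow, Nat.cast_pow]
        push_cast
        exact mul_le_mul_of_nonneg_right hn.le (by positivity)
      · exact (tendsto_pow_atTop (by norm_num)).comp (tendsto_add_atTop_nat 1)
      · refine (h.add_const 1).congr fun j => ?_
        rw [hsum _ (by positivity)])
  have h3 := key.sub_const 1
  rw [add_sub_cancel_right] at h3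
  refine h3.congr' ?_
  filter_upwards [eventually_ne_atTop 0] with n hn
  rw [hsum n hn, add_sub_cancel_right]

/-! ### Almost sure convergence of averages from second moments -/

section Probability

variable {Ω : Type*} [MeasurableSpace Ω] {P : Measure Ω}

theorem ae_summable_of_integral_le {f : ℕ → Ω → ℝ} (hf : ∀ j, Integrable (f j) P)
    (h0 : ∀ j ω, 0 ≤ f j ω) {c : ℕ → ℝ} (hc : Summable c) (h : ∀ j, ∫ ω, f j ω ∂P ≤ c j) :
    ∀ᵐ ω ∂P, Summable fun j => f j ω := by
  have hc0 : ∀ j, 0 ≤ c j := fun j => (integral_nonneg (h0 j)).trans (h j)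
  have h1 : ∫⁻ ω, ∑' j, ENNReal.ofReal (f j ω) ∂P ≠ ∞ := by
    rw [lintegral_tsum fun j => (hf j).aemeasurable.ennreal_ofReal]
    refine ne_top_of_le_ne_top hc.tsum_ofReal_ne_top (ENNReal.tsum_le_tsum fun j => ?_)
    rw [← ofReal_integral_eq_lintegral_ofReal (hf j) (ae_of_all _ (h0 j))]
    exact ENNReal.ofReal_le_ofReal (h j)
  have hm : AEMeasurable (fun ω => ∑' j, ENNReal.ofReal (f j ω)) P :=
    AEMeasurable.tsum fun j => (hf j).aemeasurable.ennreal_ofReal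
  filter_upwards [ae_lt_top' hm h1] with ω hω
  have := ENNReal.summable_toReal hω.ne
  refine this.congr fun j => ?_
  rw [ENNReal.toReal_ofReal (h0 j ω)]

variable [IsProbabilityMeasure P] {Y : ℕ → Ω → ℝ}

theorem abs_seqAverage_le {y : ℕ → ℝ} (hy : ∀ i, |y i| ≤ 1) (n : ℕ) : |seqAverage y n| ≤ 1 := by
  rw [seqAverage, abs_div, Nat.abs_cast]
  refine div_le_one_of_le₀ ((Finset.abs_sum_le_sum_abs _ _).trans ?_) (by positivity)
  refine (Finset.sum_le_sum fun i _ => hy i).trans ?_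
  simp

theorem measurable_seqAverage (hYm : ∀ i, Measurable (Y i)) (n : ℕ) :
    Measurable fun ω => seqAverage (fun i => Y i ω) n :=
  (Finset.measurable_sum _ fun i _ => hYm i).div_const _

theorem integrable_of_bounded {f : Ω → ℝ} (hf : Measurable f) {C : ℝ} (h : ∀ ω, |f ω| ≤ C) :
    Integrable f P :=
  Integrable.of_bound hf.aestronglyMeasurable C (ae_of_all _ h)

theorem summable_const_div_sq (C : ℝ) : Summable fun j : ℕ => C / ((j : ℝ) + 1) ^ 2 := by
  have h := ((summable_nat_add_iff 1).2 (Real.summable_one_div_nat_pow (p := 2).2 (by norm_num)))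
  refine (h.mul_left C).congr fun j => ?_
  push_cast
  ring

theorem ae_tendsto_seqAverage_of_sq_le (hYm : ∀ i, Measurable (Y i)) (hY : ∀ i ω, |Y i ω| ≤ 1)
    {C : ℝ} (h : ∀ n, 0 < n → ∫ ω, seqAverage (fun i => Y i ω) n ^ 2 ∂P ≤ C / n) :
    ∀ᵐ ω ∂P, Tendsto (seqAverage fun i => Y i ω) atTop (𝓝 0) := by
  have hs := ae_summable_of_integral_le (P := P)
    (f := fun (j : ℕ) ω => seqAverage (fun i => Y i ω) ((j + 1) ^ 4) ^ 2)
    (fun j => integrable_of_bounded ((measurable_seqAverage hYm _).pow_const 2) (C := 1) fun ω => by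
      rw [abs_pow]
      exact pow_le_one₀ (abs_nonneg _) (abs_seqAverage_le (fun i => hY i ω) _))
    (fun j ω => sq_nonneg _) (summable_const_div_sq |C|) (fun j => by
      refine (h _ (by positivity)).trans ?_
      push_cast
      refine (div_le_div_of_nonneg_right (le_abs_self C) (by positivity)).trans ?_
      refine div_le_div_of_nonneg_left (abs_nonneg _) (by positivity) ?_
      exact pow_le_pow_right₀ (by linarith [(Nat.cast_nonneg j : (0 : ℝ) ≤ j)]) (by norm_num))
  filter_upwards [hs] with ω hω
  refine tendsto_seqAverage_of_subseq (fun i => hY i ω) ?_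
  have h1 := hω.tendsto_atTop_zero
  rw [tendsto_zero_iff_abs_tendsto_zero]
  have h2 := (Real.continuous_sqrt.tendsto 0).comp h1
  simp only [Real.sqrt_zero] at h2
  refine h2.congr fun j => ?_
  simp [Real.sqrt_sq_eq_abs]

/-- Here the limit is random and unknown, so the averages along fourth powers are shown to be
Cauchy: their successive differences have summable expected absolute values. -/
theorem ae_exists_tendsto_seqAverage_of_sq_sub_le (hYm : ∀ i, Measurable (Y i))
    (hY : ∀ i ω, |Y i ω| ≤ 1) {C : ℝ}
    (h : ∀ n m, 0 < n → n ≤ m → ∫ ω, (seqAverage (fun i => Y i ω) n -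
      seqAverage (fun i => Y i ω) m) ^ 2 ∂P ≤ C / n) :
    ∀ᵐ ω ∂P, ∃ x, Tendsto (seqAverage fun i => Y i ω) atTop (𝓝 x) := by
  set D : ℕ → Ω → ℝ := fun j ω => seqAverage (fun i => Y i ω) ((j + 1) ^ 4) -
    seqAverage (fun i => Y i ω) ((j + 1 + 1) ^ 4) with hD
  have hDm : ∀ j, Measurable (D j) := fun j =>
    (measurable_seqAverage hYm _).sub (measurable_seqAverage hYm _)
  have hD2 : ∀ j ω, |D j ω| ≤ 2 := fun j ω => (abs_sub _ _).trans (by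
    linarith [abs_seqAverage_le (fun i => hY i ω) ((j + 1) ^ 4),
      abs_seqAverage_le (fun i => hY i ω) ((j + 1 + 1) ^ 4)])
  have hs := ae_summable_of_integral_le (P := P) (f := fun (j : ℕ) ω => |D j ω|)
    (fun j => integrable_of_bounded (hDm j).abs (C := 2) fun ω => by rw [abs_abs]; exact hD2 j ω)
    (fun j ω => abs_nonneg _) (summable_const_div_sq ((|C| + 1) / 2)) (fun j => by
      have hp : (0 : ℝ) < (j : ℝ) + 1 := by positivity
      have hi : Integrable (fun ω => D j ω ^ 2) P :=
        integrable_of_bounded ((hDm j).pow_const 2) (C := 4) fun ω => by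
          rw [abs_pow]; nlinarith [hD2 j ω, abs_nonneg (D j ω)]
      calc ∫ ω, |D j ω| ∂P
          ≤ ∫ ω, (((j : ℝ) + 1) ^ 2 / 2 * D j ω ^ 2 + 1 / (2 * ((j : ℝ) + 1) ^ 2)) ∂P := by
            refine integral_mono
              (integrable_of_bounded (hDm j).abs (C := 2) fun ω => by rw [abs_abs]; exact hD2 j ω)
              ((hi.const_mul _).add (integrable_const _)) fun ω => ?_
            -- Weighted AM-GM, with the weight (j + 1)^2 that balances a second moment of order (j +
            -- 1)^(-4): both terms become of order (j + 1)^(-2).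
            have h1 : 0 ≤ (((j : ℝ) + 1) * |D j ω| - 1 / ((j : ℝ) + 1)) ^ 2 := sq_nonneg _
            have h2 : (((j : ℝ) + 1) * |D j ω| - 1 / ((j : ℝ) + 1)) ^ 2 =
              ((j : ℝ) + 1) ^ 2 * D j ω ^ 2 + 1 / ((j : ℝ) + 1) ^ 2 - 2 * |D j ω| := by
              rw [sub_sq, mul_pow, sq_abs]; field_simp; ring
            have h3 : 1 / (2 * ((j : ℝ) + 1) ^ 2) = 1 / ((j : ℝ) + 1) ^ 2 / 2 := by
              field_simp
            simp only
            rw [h3]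
            linarith
        _ = ((j : ℝ) + 1) ^ 2 / 2 * ∫ ω, D j ω ^ 2 ∂P + 1 / (2 * ((j : ℝ) + 1) ^ 2) := by
            rw [integral_add (hi.const_mul _) (integrable_const _), integral_const_mul]
            simp
        _ ≤ ((j : ℝ) + 1) ^ 2 / 2 * (|C| / ((j : ℝ) + 1) ^ 4) + 1 / (2 * ((j : ℝ) + 1) ^ 2) := by
            have := h ((j + 1) ^ 4) ((j + 1 + 1) ^ 4) (by positivity)
              (Nat.pow_le_pow_left (by omega) 4)
            push_cast at this
            have h5 : ∫ ω, D j ω ^ 2 ∂P ≤ |C| / ((j : ℝ) + 1) ^ 4 :=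
              this.trans (div_le_div_of_nonneg_right (le_abs_self C) (by positivity))
            gcongr
        _ = (|C| + 1) / 2 / ((j : ℝ) + 1) ^ 2 := by field_simp)
  filter_upwards [hs] with ω hω
  have hcs : CauchySeq fun j : ℕ => seqAverage (fun i => Y i ω) ((j + 1) ^ 4) :=
    cauchySeq_of_summable_dist (hω.congr fun j => by rw [Real.dist_eq])
  obtain ⟨x, hx⟩ := cauchySeq_tendsto_of_complete hcs
  exact ⟨x, tendsto_seqAverage_of_subseq (fun i => hY i ω) hx⟩

theorem integral_sum_mul_sum (hYm : ∀ i, Measurable (Y i)) (hY : ∀ i ω, |Y i ω| ≤ 1) (n m : ℕ) :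
    ∫ ω, seqAverage (fun i => Y i ω) n * seqAverage (fun i => Y i ω) m ∂P =
      (∑ i ∈ Finset.range n, ∑ j ∈ Finset.range m, ∫ ω, Y i ω * Y j ω ∂P) / (n * m) := by
  have hi : ∀ i j, Integrable (fun ω => Y i ω * Y j ω) P := fun i j =>
    integrable_of_bounded ((hYm i).mul (hYm j)) (C := 1) fun ω => by
      rw [abs_mul]; exact mul_le_one₀ (hY i ω) (abs_nonneg _) (hY j ω)
  have h1 : ∀ ω, seqAverage (fun i => Y i ω) n * seqAverage (fun i => Y i ω) m =
      (∑ i ∈ Finset.range n, ∑ j ∈ Finset.range m, Y i ω * Y j ω) / (n * m) := by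
    intro ω
    rw [seqAverage, seqAverage, div_mul_div_comm, Finset.sum_mul_sum]
  simp_rw [h1]
  rw [integral_div, integral_finsetSum _ fun i _ => integrable_finsetSum _ fun j _ => hi i j]
  congr 1
  exact Finset.sum_congr rfl fun i _ => integral_finsetSum _ fun j _ => hi i j

/-- The law of large numbers for bounded uncorrelated centred variables. -/
theorem ae_tendsto_seqAverage_of_uncorrelated (hYm : ∀ i, Measurable (Y i))
    (hY : ∀ i ω, |Y i ω| ≤ 1) (h : ∀ i j, i ≠ j → ∫ ω, Y i ω * Y j ω ∂P = 0) :
    ∀ᵐ ω ∂P, Tendsto (seqAverage fun i => Y i ω) atTop (𝓝 0) := by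
  refine ae_tendsto_seqAverage_of_sq_le hYm hY (C := 1) fun n hn => ?_
  simp_rw [sq]
  rw [integral_sum_mul_sum hYm hY]
  have hn' : (0 : ℝ) < n := by exact_mod_cast hn
  have : (∑ i ∈ Finset.range n, ∑ j ∈ Finset.range n, ∫ ω, Y i ω * Y j ω ∂P) ≤ n := by
    calc _ ≤ ∑ i ∈ Finset.range n, (1 : ℝ) := Finset.sum_le_sum fun i hi => by
          rw [Finset.sum_eq_single_of_mem i hi fun j _ hj => h i j hj.symm]
          refine (integral_mono (g := fun _ => (1 : ℝ))
            (integrable_of_bounded ((hYm i).mul (hYm i)) (C := 1) fun ω => by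
              rw [Pi.mul_apply, abs_mul]; exact mul_le_one₀ (hY i ω) (abs_nonneg _) (hY i ω))
            (integrable_const _) fun ω => ?_).trans (by simp)
          have := hY i ω
          rw [abs_le] at this
          change Y i ω * Y i ω ≤ 1
          nlinarith
      _ = n := by simp
  rw [div_le_div_iff₀ (by positivity) hn']
  nlinarith

/-- Averages of bounded sequences with exchangeable second moments converge. -/
theorem ae_exists_tendsto_seqAverage_of_exchangeable (hYm : ∀ i, Measurable (Y i))
    (hY : ∀ i ω, |Y i ω| ≤ 1) {c d : ℝ}
    (h : ∀ i j, ∫ ω, Y i ω * Y j ω ∂P = if i = j then d else c) :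
    ∀ᵐ ω ∂P, ∃ x, Tendsto (seqAverage fun i => Y i ω) atTop (𝓝 x) := by
  -- As n ≤ m, each index below n meets the diagonal exactly once, so the cross moment depends on m
  -- alone. Expanding the square then leaves (d - c)(1/n - 1/m).
  have key : ∀ n m, 0 < n → n ≤ m →
      ∫ ω, seqAverage (fun i => Y i ω) n * seqAverage (fun i => Y i ω) m ∂P = (d - c) / m + c := by
    intro n m hn hnm
    rw [integral_sum_mul_sum hYm hY]
    have h1 : ∀ i ∈ Finset.range n, ∑ j ∈ Finset.range m, ∫ ω, Y i ω * Y j ω ∂P =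
        (d - c) + m * c := by
      intro i hi
      have h2 : ∀ j, ∫ ω, Y i ω * Y j ω ∂P = (if i = j then d - c else 0) + c := by
        intro j
        rw [h i j]
        split_ifs <;> ring
      simp_rw [h2]
      rw [Finset.sum_add_distrib, Finset.sum_ite_eq, if_pos]
      · simp
      · simp only [Finset.mem_range] at hi ⊢; omega
    rw [Finset.sum_congr rfl h1]
    have hn' : (n : ℝ) ≠ 0 := by positivity
    have hm' : (m : ℝ) ≠ 0 := by have : 0 < m := by omega
                                 positivity
    simp only [Finset.sum_const, Finset.card_range, nsmul_eq_mul]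
    field_simp
  have hA : ∀ n m, Integrable (fun ω => seqAverage (fun i => Y i ω) n *
      seqAverage (fun i => Y i ω) m) P := fun n m =>
    integrable_of_bounded ((measurable_seqAverage hYm n).mul (measurable_seqAverage hYm m))
      (C := 1) fun ω => by
        rw [abs_mul]
        exact mul_le_one₀ (abs_seqAverage_le (fun i => hY i ω) n) (abs_nonneg _)
          (abs_seqAverage_le (fun i => hY i ω) m)
  refine ae_exists_tendsto_seqAverage_of_sq_sub_le hYm hY (C := |d - c|) fun n m hn hnm => ?_
  have h2 : ∀ ω, (seqAverage (fun i => Y i ω) n - seqAverage (fun i => Y i ω) m) ^ 2 =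
      seqAverage (fun i => Y i ω) n * seqAverage (fun i => Y i ω) n +
        seqAverage (fun i => Y i ω) m * seqAverage (fun i => Y i ω) m -
        2 * (seqAverage (fun i => Y i ω) n * seqAverage (fun i => Y i ω) m) := fun ω => by ring
  simp_rw [h2]
  have h1 : ∀ f g h : Ω → ℝ, Integrable f P → Integrable g P → Integrable h P →
      ∫ ω, (f ω + g ω - 2 * h ω) ∂P = ∫ ω, f ω ∂P + ∫ ω, g ω ∂P - 2 * ∫ ω, h ω ∂P := by
    intro f g h hf hg hh
    rw [integral_sub (f := fun ω => f ω + g ω) (hf.add hg) (hh.const_mul 2), integral_add hf hg,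
      integral_const_mul]
  rw [h1 _ _ _ (hA n n) (hA m m) (hA n m),
    key n n hn le_rfl, key m m (by omega) le_rfl, key n m hn hnm]
  have hn' : (0 : ℝ) < n := by positivity
  have hm' : (n : ℝ) ≤ m := by exact_mod_cast hnm
  have h3 : (d - c) / n + c + ((d - c) / m + c) - 2 * ((d - c) / m + c) =
      (d - c) * (1 / n - 1 / m) := by ring
  rw [h3, div_eq_mul_one_div |d - c|]
  have h4 : (1 : ℝ) / m ≤ 1 / n := one_div_le_one_div_of_le hn' hm'
  have h5 : (0 : ℝ) ≤ 1 / m := by positivity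
  exact mul_le_mul (le_abs_self _) (by linarith) (by linarith) (abs_nonneg _)

/-! ### Exchangeable partitions have asymptotic frequencies -/

theorem exists_hasAsymptoticFreq_of_shift {A : Set ℕ} (s : ℕ)
    (h : ∃ x, Tendsto (seqAverage fun j => A.indicator 1 (s + j)) atTop (𝓝 x)) :
    ∃ x, HasAsymptoticFreq A x := by
  obtain ⟨x, hx⟩ := h
  refine ⟨x, (hasAsymptoticFreq_iff _ _).2 ((tendsto_add_atTop_iff_nat s).1 ?_)⟩
  have h1 : Tendsto (fun n : ℕ => (∑ i ∈ Finset.range s, A.indicator (1 : ℕ → ℝ) i) / ((n + s : ℕ) : ℝ))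
      atTop (𝓝 0) :=
    tendsto_const_nhds.div_atTop
      (tendsto_natCast_atTop_atTop.comp (tendsto_add_atTop_nat s))
  have h2 : Tendsto (fun n : ℕ => (n : ℝ) / ((n : ℝ) + s)) atTop (𝓝 1) :=
    tendsto_natCast_div_add_atTop (s : ℝ)
  have h3 := h1.add (hx.mul h2)
  rw [zero_add, mul_one] at h3
  refine h3.congr' ?_
  filter_upwards [eventually_ne_atTop 0] with n hn
  have hn' : (n : ℝ) ≠ 0 := by exact_mod_cast hn
  rw [seqAverage, seqAverage, add_comm n s, Finset.sum_range_add]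
  push_cast
  rw [add_comm (s : ℝ), add_div]
  field_simp

/-- Some permutation of a large [n] fixes `i` and sends `a'`, `b'` to `a`, `b`; it exists because
the two triples have the same coincidences. Exchangeability then equates the probabilities. -/
theorem IsExchangeablePartition.measure_pair_eq {Ω : Type*} [MeasurableSpace Ω] {P : Measure Ω} {k : ℕ} {R : Ω → BoundedPartition ℕ k}
    (hR : IsExchangeablePartition P R) {i : ℕ} {a b a' b' : ℕ} (ha : i < a) (hb : i < b)
    (ha' : i < a') (hb' : i < b') (hab : a = b ↔ a' = b') :
    P.real {ω | (R ω).1 a i ∧ (R ω).1 b i} = P.real {ω | (R ω).1 a' i ∧ (R ω).1 b' i} := by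
  set n := max (max a b) (max a' b') + 1 with hn
  have hin : i < n := by omega
  have han : a < n := by omega
  have hbn : b < n := by omega
  have han' : a' < n := by omega
  have hbn' : b' < n := by omega
  obtain ⟨τ, hτ⟩ := exists_perm_of_ker_eq (k := n)
    (![⟨i, hin⟩, ⟨a', han'⟩, ⟨b', hbn'⟩] : Fin 3 → Fin n) ![⟨i, hin⟩, ⟨a, han⟩, ⟨b, hbn⟩] (by
      intro x y
      fin_cases x <;> fin_cases y <;> simp [Fin.ext_iff] <;> omega)
  have h0 : τ ⟨i, hin⟩ = ⟨i, hin⟩ := (hτ 0).symm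
  have h1 : τ ⟨a', han'⟩ = ⟨a, han⟩ := (hτ 1).symm
  have h2 : τ ⟨b', hbn'⟩ = ⟨b, hbn⟩ := (hτ 2).symm
  have hd := (hR n τ).measure_mem_eq (s := {π | π.1 ⟨a', han'⟩ ⟨i, hin⟩ ∧ π.1 ⟨b', hbn'⟩ ⟨i, hin⟩})
    (Set.toFinite _).measurableSet
  have e1 : (fun ω => ((R ω).restrict n).comap τ) ⁻¹'
      {π | π.1 ⟨a', han'⟩ ⟨i, hin⟩ ∧ π.1 ⟨b', hbn'⟩ ⟨i, hin⟩} =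
      {ω | (R ω).1 a i ∧ (R ω).1 b i} := by
    ext ω
    change (R ω).1 (τ ⟨a', han'⟩) (τ ⟨i, hin⟩) ∧ (R ω).1 (τ ⟨b', hbn'⟩) (τ ⟨i, hin⟩) ↔ _
    rw [h0, h1, h2]
    rfl
  rw [e1] at hd
  simp only [measureReal_def]
  rw [hd]
  rfl

/-- For fixed `i`, the indicators of `j ∼ i` over `j > i` have second moments that depend only on
whether the indices coincide. This already makes their averages converge, without a representation
theorem for exchangeable partitions. Countably many `i` cover all blocks. -/
theorem IsExchangeablePartition.ae_hasFrequencies {k : ℕ} {R : Ω → BoundedPartition ℕ k}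
    (hRm : Measurable R) (hR : IsExchangeablePartition P R) : ∀ᵐ ω ∂P, (R ω).HasFrequencies := by
  classical
  have key : ∀ i : ℕ, ∀ᵐ ω ∂P, ∃ x, HasAsymptoticFreq {x | (R ω).1 x i} x := by
    intro i
    -- Indices up to `i` are dropped: `i` itself always lies in its block, and the permutations used
    -- must fix it.
    set Y : ℕ → Ω → ℝ := fun j ω => {x | (R ω).1 x i}.indicator 1 (i + 1 + j) with hYdef
    have hY' : ∀ j, Y j = {ω | (R ω).1 (i + 1 + j) i}.indicator 1 := by
      intro j; funext ω
      by_cases h : (R ω).1 (i + 1 + j) i <;> simp [hYdef, h]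
    have hms : ∀ j, MeasurableSet {ω | (R ω).1 (i + 1 + j) i} := fun j =>
      hRm (BoundedPartition.measurableSet_rel (i + 1 + j) i)
    have hYm : ∀ j, Measurable (Y j) := fun j => by
      rw [hY']; exact measurable_one.indicator (hms j)
    have hYb : ∀ j ω, |Y j ω| ≤ 1 := fun j ω => by
      rw [hY']
      by_cases h : (R ω).1 (i + 1 + j) i <;> simp [h]
    have hint : ∀ j l, ∫ ω, Y j ω * Y l ω ∂P =
        P.real {ω | (R ω).1 (i + 1 + j) i ∧ (R ω).1 (i + 1 + l) i} := by
      intro j l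
      refine Eq.trans ?_ (integral_indicator_one ((hms j).inter (hms l)))
      refine integral_congr_ae (ae_of_all _ fun ω => ?_)
      simp only [hY']
      by_cases h : (R ω).1 (i + 1 + j) i <;> by_cases h' : (R ω).1 (i + 1 + l) i <;>
        simp [Set.indicator, h, h']
    have hc : ∀ᵐ ω ∂P, ∃ x, Tendsto (seqAverage fun j => Y j ω) atTop (𝓝 x) :=
      ae_exists_tendsto_seqAverage_of_exchangeable hYm hYb
        (d := P.real {ω | (R ω).1 (i + 1 + 0) i ∧ (R ω).1 (i + 1 + 0) i})
        (c := P.real {ω | (R ω).1 (i + 1 + 0) i ∧ (R ω).1 (i + 1 + 1) i}) (by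
        intro j l
        rw [hint]
        split_ifs with h
        · exact hR.measure_pair_eq (by omega) (by omega) (by omega) (by omega) (by omega)
        · exact hR.measure_pair_eq (by omega) (by omega) (by omega) (by omega) (by omega))
    filter_upwards [hc] with ω hω
    exact exists_hasAsymptoticFreq_of_shift (i + 1) hω
  filter_upwards [ae_all_iff.2 key] with ω hω
  rintro _ ⟨i, rfl⟩
  exact hω i

end Probability

/-! ### Kernels from random maps -/

section RandomMap

variable {E F Z : Type*} [MeasurableSpace E] [MeasurableSpace F] [MeasurableSpace Z]

/-- The kernel `x ↦ law of f x ζ` for a random `ζ` of law `μ`. -/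
noncomputable def randomMapKernel (μ : Measure Z) [SFinite μ] (f : E → Z → F)
    (hf : Measurable (Function.uncurry f)) : Kernel E F where
  toFun x := μ.map (f x)
  measurable' := by
    refine Measure.measurable_of_measurable_coe _ fun s hs => ?_
    have : ∀ x, μ.map (f x) s = μ (Prod.mk x ⁻¹' (Function.uncurry f ⁻¹' s)) := fun x =>
      Measure.map_apply (hf.comp measurable_prodMk_left) hs
    simp_rw [this]
    exact measurable_measure_prodMk_left (hf hs)

variable {μ : Measure Z} [SFinite μ] {f : E → Z → F} (hf : Measurable (Function.uncurry f))

theorem randomMapKernel_apply (x : E) : randomMapKernel μ f hf x = μ.map (f x) := rfl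

instance [IsProbabilityMeasure μ] : IsMarkovKernel (randomMapKernel μ f hf) where
  isProbabilityMeasure _ :=
    Measure.isProbabilityMeasure_map (hf.comp measurable_prodMk_left).aemeasurable

end RandomMap

theorem map_pi_comp_perm {ι Z : Type*} [Fintype ι] [MeasurableSpace Z] (μ : Measure Z)
    [SigmaFinite μ] (ρ : Equiv.Perm ι) :
    (Measure.pi fun _ : ι => μ).map (fun q => q ∘ ρ) = Measure.pi fun _ => μ := by
  refine (Measure.pi_eq fun s hs => ?_).symm
  have hm : Measurable fun q : ι → Z => q ∘ ρ :=
    measurable_pi_lambda _ fun i => measurable_pi_apply (ρ i)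
  rw [Measure.map_apply hm (MeasurableSet.univ_pi hs)]
  have : (fun q : ι → Z => q ∘ ρ) ⁻¹' Set.univ.pi s = Set.univ.pi fun i => s (ρ.symm i) := by
    ext q
    simp only [Set.mem_preimage, Set.mem_univ_pi, Function.comp_apply]
    exact ⟨fun h i => by simpa using h (ρ.symm i), fun h i => by simpa using h (ρ i)⟩
  rw [this, Measure.pi_pi]
  exact Equiv.prod_comp ρ.symm fun i => μ (s i)

/-! ### The noise which drives one step -/

section Noise

variable {k : ℕ}

theorem RankedSimplex.measurable_apply (j : Fin k) :
    Measurable fun s : RankedSimplex k => s.1 j :=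
  (measurable_pi_apply j).comp measurable_subtype_coe

theorem RankedSimplex.le_one (s : RankedSimplex k) (j : Fin k) : s.1 j ≤ 1 :=
  (Finset.single_le_sum (fun i _ => s.2.2.1 i) (Finset.mem_univ j)).trans_eq s.2.2.2

theorem colourLaw_apply (s : RankedSimplex k) (A : Set (Fin k)) :
    colourLaw s A = ∑ j, ENNReal.ofReal (s.1 j) * A.indicator 1 j := by
  simp [colourLaw]

instance (s : RankedSimplex k) : IsProbabilityMeasure (colourLaw s) where
  measure_univ := by
    rw [colourLaw_apply]
    simp only [Set.indicator_univ, Pi.one_apply, mul_one]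
    rw [← ENNReal.ofReal_sum_of_nonneg fun i _ => s.2.2.1 i, s.2.2.2, ENNReal.ofReal_one]

theorem colourLaw_real_singleton (s : RankedSimplex k) (j : Fin k) :
    (colourLaw s).real {j} = s.1 j := by
  rw [measureReal_def, colourLaw_apply, Finset.sum_eq_single j]
  · simp [s.2.2.1 j]
  · intro i _ hi; simp [hi]
  · simp

theorem measurable_colourLaw_apply (A : Set (Fin k)) :
    Measurable fun s : RankedSimplex k => colourLaw s A := by
  simp_rw [colourLaw_apply]
  exact Finset.measurable_sum _ fun j _ =>
    (RankedSimplex.measurable_apply j).ennreal_ofReal.mul_const _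

/-- The law of i.i.d. colours, as a kernel. -/
noncomputable def iidColours (k : ℕ) : Kernel (RankedSimplex k) (ℕ → Fin k) where
  toFun s := Measure.infinitePi fun _ => colourLaw s
  measurable' := by
    -- Measurability in the mass partition need only be checked on cylinders, where the product
    -- measure is a finite product of measurable functions.
    refine Measurable.measure_of_isPiSystem_of_isProbabilityMeasure
      (generateFrom_squareCylinders (α := fun _ : ℕ => Fin k)).symm
      (isPiSystem_squareCylinders (fun _ => MeasurableSpace.isPiSystem_measurableSet)
        fun _ => (MeasurableSet.univ : MeasurableSet (Set.univ : Set (Fin k)))) ?_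
    rintro _ ⟨I, t, ht, rfl⟩
    simp only [Set.mem_pi, Set.mem_univ, true_imp_iff, Set.mem_ofPred_eq] at ht
    have : ∀ s : RankedSimplex k, (Measure.infinitePi fun _ : ℕ => colourLaw s)
        ((I : Set ℕ).pi t) = ∏ i ∈ I, colourLaw s (t i) := fun s =>
      Measure.infinitePi_pi _ fun i _ => ht i
    simp_rw [this]
    exact Finset.measurable_prod _ fun i _ => measurable_colourLaw_apply _

theorem iidColours_apply (s : RankedSimplex k) :
    iidColours k s = Measure.infinitePi fun _ => colourLaw s := rfl

instance : IsMarkovKernel (iidColours k) where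
  isProbabilityMeasure s := by rw [iidColours_apply]; infer_instance

/-- The uniform law on the permutations of `[k]`. -/
noncomputable def uniformPerm (k : ℕ) : Measure (Equiv.Perm (Fin k)) :=
  (k.factorial : ℝ≥0∞)⁻¹ • Measure.count

theorem uniformPerm_singleton (σ : Equiv.Perm (Fin k)) :
    uniformPerm k {σ} = (k.factorial : ℝ≥0∞)⁻¹ := by
  simp [uniformPerm]

instance : DiscreteMeasurableSpace (Equiv.Perm (Fin k)) := ⟨fun _ => trivial⟩

instance : IsProbabilityMeasure (uniformPerm k) where
  measure_univ := by
    have : (k.factorial : ℝ≥0∞) ≠ 0 := by exact_mod_cast k.factorial_ne_zero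
    simp only [uniformPerm, Measure.smul_apply, smul_eq_mul]
    rw [Measure.count_apply MeasurableSet.univ, Set.encard_univ, ENat.card_eq_coe_fintype_card,
      Fintype.card_perm, Fintype.card_fin]
    exact ENNReal.inv_mul_cancel this (ENNReal.natCast_ne_top _)

/-- The noise attached to a block: a mass partition, colours drawn from it, and a permutation. -/
abbrev BlockNoise (k : ℕ) : Type := (RankedSimplex k × (ℕ → Fin k)) × Equiv.Perm (Fin k)

variable (ν : Measure (RankedSimplex k)) [IsProbabilityMeasure ν]

/-- The law of the noise of all (labelled) blocks. -/
noncomputable def noiseLaw : Measure (Fin k → BlockNoise k) :=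
  Measure.pi fun _ => (ν ⊗ₘ iidColours k).prod (uniformPerm k)

instance : IsProbabilityMeasure (noiseLaw ν) := by unfold noiseLaw; infer_instance

/-- The colour of an element of a labelled partition: the elements of block `i` are coloured by the
noise of block `i`. -/
noncomputable def stepColour (π : BoundedPartition ℕ k) (z : Fin k → BlockNoise k) (x : ℕ) : Fin k :=
  -- The inverse permutation makes the new colour equal `j` exactly when the drawn colour is `σ j`,
  -- which is the index convention of `rankedStep`.
  (z (π.label x)).2.symm ((z (π.label x)).1.2 x)

theorem measurable_stepColour (x : ℕ) :
    Measurable fun q : BoundedPartition ℕ k × (Fin k → BlockNoise k) => stepColour q.1 q.2 x := by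
  have h : ∀ i : Fin k, Measurable fun z : Fin k → BlockNoise k => (z i).2.symm ((z i).1.2 x) := by
    intro i
    have h1 : Measurable fun w : Fin k × Equiv.Perm (Fin k) => w.2.symm w.1 := measurable_of_finite _
    have h2 : Measurable fun b : BlockNoise k => (b.1.2 x, b.2) :=
      ((measurable_pi_apply x).comp (measurable_snd.comp measurable_fst)).prodMk measurable_snd
    exact (h1.comp h2).comp (measurable_pi_apply i)
  have h2 : Measurable fun q : (Fin k → BlockNoise k) × Fin k => (q.1 q.2).2.symm ((q.1 q.2).1.2 x) :=
    measurable_from_prod_countable_left h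
  exact h2.comp (measurable_snd.prodMk ((BoundedPartition.measurable_label x).comp measurable_fst))

theorem measurable_stepPartition : Measurable (Function.uncurry
    fun (π : BoundedPartition ℕ k) z => colourPartition (stepColour π z)) :=
  BoundedPartition.measurable_colourPartition.comp (measurable_pi_lambda _ measurable_stepColour)

/-- The transition kernel of the embedded chain of partitions. -/
noncomputable def partitionKernel : Kernel (BoundedPartition ℕ k) (BoundedPartition ℕ k) :=
  randomMapKernel (noiseLaw ν) (fun π z => colourPartition (stepColour π z)) measurable_stepPartition

instance : IsMarkovKernel (partitionKernel ν) := by unfold partitionKernel; infer_instance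

/-- The ranked column totals, for an arbitrary vector of masses. -/
noncomputable def massStep (x : Fin k → ℝ) (q : Fin k → RankedSimplex k × Equiv.Perm (Fin k)) :
    Fin k → ℝ :=
  decreasing fun j => ∑ i, x i * (q i).1.1 ((q i).2 j)

theorem measurable_massStep : Measurable (Function.uncurry (massStep (k := k))) := by
  refine measurable_decreasing.comp (measurable_pi_lambda _ fun j =>
    Finset.measurable_sum _ fun i _ => Measurable.mul ?_ ?_)
  · exact (measurable_pi_apply i).comp measurable_fst
  · have h1 : Measurable fun q : RankedSimplex k × Equiv.Perm (Fin k) => q.1.1 (q.2 j) :=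
      measurable_from_prod_countable_left fun τ => RankedSimplex.measurable_apply (τ j)
    exact h1.comp ((measurable_pi_apply i).comp measurable_snd)

/-- The law of the marks and permutations used in one step. -/
noncomputable def markLaw : Measure (Fin k → RankedSimplex k × Equiv.Perm (Fin k)) :=
  Measure.pi fun _ => ν.prod (uniformPerm k)

instance : IsProbabilityMeasure (markLaw ν) := by unfold markLaw; infer_instance

/-- The transition kernel of the embedded chain of mass partitions. -/
noncomputable def massKernel : Kernel (Fin k → ℝ) (Fin k → ℝ) :=
  randomMapKernel (markLaw ν) massStep measurable_massStep

instance : IsMarkovKernel (massKernel ν) := by unfold massKernel; infer_instance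

/-! ### Frequencies after one step -/

/-- The centred indicators of colour `c`, multiplied by the indicator of the deterministic set `A`,
are bounded and uncorrelated, so their averages vanish in the limit. What remains is `s.1 c` times
the average of the indicator of `A`. -/
theorem ae_iidColours_hasAsymptoticFreq (s : RankedSimplex k) (c : Fin k) {A : Set ℕ} {f : ℝ}
    (hA : HasAsymptoticFreq A f) :
    ∀ᵐ w ∂iidColours k s, HasAsymptoticFreq {x | x ∈ A ∧ w x = c} (f * s.1 c) := by
  classical
  rw [iidColours_apply]
  set μ := Measure.infinitePi fun _ : ℕ => colourLaw s
  set g : Fin k → ℝ := fun d => (if d = c then 1 else 0) - s.1 c with hg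
  set Y : ℕ → (ℕ → Fin k) → ℝ := fun x w => A.indicator 1 x * g (w x) with hY
  have hgb : ∀ d, |g d| ≤ 1 := by
    intro d
    have h0 := s.2.2.1 c
    have h1 := s.le_one c
    rw [hg, abs_le]
    simp only
    split_ifs <;> constructor <;> linarith
  have hgm : ∀ x : ℕ, Measurable fun w : ℕ → Fin k => g (w x) := fun x =>
    (measurable_of_finite g).comp (measurable_pi_apply x)
  have hYm : ∀ x, Measurable (Y x) := fun x => (hgm x).const_mul _
  have hYb : ∀ x w, |Y x w| ≤ 1 := by
    intro x w
    rw [hY]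
    simp only
    rw [abs_mul]
    refine mul_le_one₀ ?_ (abs_nonneg _) (hgb _)
    by_cases hx : x ∈ A <;> simp [hx]
  have hmean : ∀ x : ℕ, ∫ w, g (w x) ∂μ = 0 := by
    intro x
    have h1 : ∫ w, g (w x) ∂μ = ∫ d, g d ∂(colourLaw s) := by
      rw [← Measure.infinitePi_map_eval (fun _ : ℕ => colourLaw s) x,
        integral_map (measurable_pi_apply x).aemeasurable
          (measurable_of_finite g).aestronglyMeasurable]
    rw [h1, hg, integral_sub Integrable.of_finite Integrable.of_finite]
    have h2 : ∫ d, (if d = c then (1 : ℝ) else 0) ∂(colourLaw s) = s.1 c := by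
      rw [← colourLaw_real_singleton, ← integral_indicator_one (measurableSet_singleton c)]
      refine integral_congr_ae (ae_of_all _ fun d => ?_)
      simp [Set.indicator]
    rw [h2]
    simp
  have hind : ∀ x y, x ≠ y → ∫ w, Y x w * Y y w ∂μ = 0 := by
    intro x y hxy
    have hi := (iIndepFun_infinitePi (P := fun _ : ℕ => colourLaw s) (X := fun _ => g)
      fun _ => measurable_of_finite g).indepFun hxy
    have h1 : ∀ w, Y x w * Y y w =
        (A.indicator 1 x * A.indicator 1 y) * (g (w x) * g (w y)) := fun w => by
      simp only [hY]; ring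
    simp_rw [h1]
    rw [integral_const_mul, hi.integral_fun_mul_eq_mul_integral (hgm x).aestronglyMeasurable
      (hgm y).aestronglyMeasurable, hmean x]
    simp
  filter_upwards [ae_tendsto_seqAverage_of_uncorrelated (P := μ) hYm hYb hind] with w hw
  rw [hasAsymptoticFreq_iff] at hA ⊢
  have h2 := hw.add (hA.mul_const (s.1 c))
  rw [zero_add] at h2
  refine h2.congr fun n => ?_
  rw [seqAverage, seqAverage, seqAverage, div_mul_eq_mul_div, ← add_div, Finset.sum_mul,
    ← Finset.sum_add_distrib]
  congr 1
  refine Finset.sum_congr rfl fun x _ => ?_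
  by_cases hx : x ∈ A <;> by_cases hc : w x = c <;> simp [hY, hg, hx, hc]

theorem hasAsymptoticFreq_sum {A : Fin k → Set ℕ} {C : Set ℕ} {f : Fin k → ℝ}
    (hA : ∀ i, HasAsymptoticFreq (A i) (f i))
    (h : ∀ x, C.indicator (1 : ℕ → ℝ) x = ∑ i, (A i).indicator 1 x) :
    HasAsymptoticFreq C (∑ i, f i) := by
  rw [hasAsymptoticFreq_iff]
  refine (tendsto_finsetSum _ fun i _ => (hasAsymptoticFreq_iff _ _).1 (hA i)).congr fun n => ?_
  simp only [seqAverage]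
  rw [← Finset.sum_div, Finset.sum_comm]
  simp_rw [h]

/-- The class of colour `j` is the disjoint union, over the old blocks `i`, of the elements of block
`i` whose drawn colour is `σ_i j`. Each piece has a frequency by the law of large numbers within its
block. -/
theorem ae_noiseLaw_hasAsymptoticFreq {π : BoundedPartition ℕ k} (hπ : π.HasFrequencies) :
    ∀ᵐ z ∂noiseLaw ν, ∀ j, HasAsymptoticFreq {x | stepColour π z x = j}
      (∑ i, asymptoticFreq {x | π.label x = i} * (z i).1.1.1 ((z i).2 j)) := by
  have hf : ∀ i, HasAsymptoticFreq {x | π.label x = i} (asymptoticFreq {x | π.label x = i}) :=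
    fun i => hasAsymptoticFreq_asymptoticFreq ((π.hasFrequencies_iff).1 hπ i)
  have key : ∀ i, ∀ᵐ z ∂noiseLaw ν, ∀ c, HasAsymptoticFreq
      {x | x ∈ {x | π.label x = i} ∧ (z i).1.2 x = c}
      (asymptoticFreq {x | π.label x = i} * (z i).1.1.1 c) := by
    intro i
    have h1 : ∀ᵐ q ∂(ν ⊗ₘ iidColours k), ∀ c, HasAsymptoticFreq
        {x | x ∈ {x | π.label x = i} ∧ q.2 x = c}
        (asymptoticFreq {x | π.label x = i} * q.1.1 c) := by
      rw [ae_all_iff]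
      intro c
      refine Measure.ae_compProd_of_ae_ae ?_
        (ae_of_all _ fun s => ae_iidColours_hasAsymptoticFreq s c (hf i))
      simp_rw [hasAsymptoticFreq_iff]
      refine measurableSet_tendsto_fun (fun n => measurable_seqAverage_indicator
        (S := fun q : RankedSimplex k × (ℕ → Fin k) => {x | x ∈ {x | π.label x = i} ∧ q.2 x = c})
        (fun x => ?_) n) ?_
      · exact (MeasurableSet.const _).inter
          (measurableSet_eq_fun ((measurable_pi_apply x).comp measurable_snd) measurable_const)
      · exact ((RankedSimplex.measurable_apply c).comp measurable_fst).const_mul _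
    have h2 : MeasurePreserving (fun z : Fin k → BlockNoise k => (z i).1) (noiseLaw ν)
        (ν ⊗ₘ iidColours k) :=
      measurePreserving_fst.comp (measurePreserving_eval _ i)
    exact h2.quasiMeasurePreserving.ae h1
  filter_upwards [ae_all_iff.2 key] with z hz j
  refine hasAsymptoticFreq_sum (fun i => hz i ((z i).2 j)) fun x => ?_
  classical
  rw [Finset.sum_eq_single (π.label x)]
  · by_cases h : stepColour π z x = j
    · have h' : (z (π.label x)).1.2 x = (z (π.label x)).2 j := (Equiv.symm_apply_eq _).1 h
      simp [h, h']
    · have h' : ¬ (z (π.label x)).1.2 x = (z (π.label x)).2 j := fun h' =>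
        h ((Equiv.symm_apply_eq _).2 h')
      simp [h, h']
  · intro i _ hi
    simp [hi.symm]
  · simp

theorem ae_partitionKernel_hasFrequencies {π : BoundedPartition ℕ k} (hπ : π.HasFrequencies) :
    ∀ᵐ π' ∂partitionKernel ν π, π'.HasFrequencies := by
  rw [partitionKernel, randomMapKernel_apply]
  refine (ae_map_iff (measurable_stepPartition.comp measurable_prodMk_left).aemeasurable
    BoundedPartition.measurableSet_hasFrequencies).2 ?_
  filter_upwards [ae_noiseLaw_hasAsymptoticFreq ν hπ] with z hz
  exact (BoundedPartition.hasFrequencies_colourPartition_iff _).2 fun j => ⟨_, hz j⟩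

theorem massStep_comp_perm (x : Fin k → ℝ) (ρ : Equiv.Perm (Fin k))
    (q : Fin k → RankedSimplex k × Equiv.Perm (Fin k)) :
    massStep (x ∘ ρ) (q ∘ ρ) = massStep x q := by
  unfold massStep
  congr 1
  funext j
  exact Equiv.sum_comp ρ fun i => x i * (q i).1.1 ((q i).2 j)

/-- A permutation of the masses is absorbed by permuting the i.i.d. rows of marks. This reconciles
masses listed by label with the ranked vector. -/
theorem massKernel_decreasing (x : Fin k → ℝ) : massKernel ν (decreasing x) = massKernel ν x := by
  have hm : ∀ y : Fin k → ℝ, Measurable (massStep y) := fun y =>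
    measurable_massStep.comp measurable_prodMk_left
  set ρ := Tuple.sort fun i => OrderDual.toDual (x i)
  rw [massKernel, randomMapKernel_apply, randomMapKernel_apply, markLaw]
  conv_lhs => rw [← map_pi_comp_perm (ν.prod (uniformPerm k)) ρ]
  rw [Measure.map_map (hm _) (measurable_pi_lambda _ fun i => measurable_pi_apply _)]
  congr 1
  funext q
  exact massStep_comp_perm x ρ q

/-- The one-step intertwining: from a partition with frequencies, the law of the next ranked
frequencies depends only on the present ranked frequencies. Forgetting the colours turns `noiseLaw`
into `markLaw`. -/
theorem partitionKernel_map_rankedFreq {π : BoundedPartition ℕ k} (hπ : π.HasFrequencies) :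
    (partitionKernel ν π).map BoundedPartition.rankedFreq = massKernel ν π.rankedFreq := by
  have e1 : π.rankedFreq = decreasing fun i => asymptoticFreq {x | π.label x = i} := by
    rw [← BoundedPartition.rankedFreq_colourPartition, π.colourPartition_label]
  have hproj : Measurable fun b : BlockNoise k => (b.1.1, b.2) :=
    (measurable_fst.comp measurable_fst).prodMk measurable_snd
  have hm : (noiseLaw ν).map (fun z i => ((z i).1.1, (z i).2)) = markLaw ν := by
    have h := Measure.pi_map_pi (μ := fun _ : Fin k => (ν ⊗ₘ iidColours k).prod (uniformPerm k))
      (f := fun _ b => (b.1.1, b.2)) fun _ => hproj.aemeasurable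
    rw [noiseLaw, h, markLaw]
    congr 1
    funext _
    have h2 := Measure.map_prod_map (ν ⊗ₘ iidColours k) (uniformPerm k) measurable_fst measurable_id
    rw [Measure.map_id] at h2
    have h3 : (ν ⊗ₘ iidColours k).map Prod.fst = ν := Measure.fst_compProd _ _
    rw [h3] at h2
    exact h2.symm
  have hs : Measurable fun z => colourPartition (stepColour π z) :=
    measurable_stepPartition.comp measurable_prodMk_left
  have hms : ∀ x : Fin k → ℝ, Measurable (massStep x) := fun x =>
    measurable_massStep.comp measurable_prodMk_left
  have hmz : Measurable fun (z : Fin k → BlockNoise k) i => ((z i).1.1, (z i).2) :=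
    measurable_pi_lambda _ fun i => hproj.comp (measurable_pi_apply i)
  rw [e1, massKernel_decreasing, massKernel, randomMapKernel_apply, ← hm, partitionKernel,
    randomMapKernel_apply, Measure.map_map BoundedPartition.measurable_rankedFreq hs,
    Measure.map_map (hms _) hmz]
  refine Measure.map_congr ?_
  filter_upwards [ae_noiseLaw_hasAsymptoticFreq ν hπ] with z hz
  simp only [Function.comp_apply]
  rw [BoundedPartition.rankedFreq_colourPartition, massStep]
  congr 1
  funext j
  exact (hz j).asymptoticFreq_eq

end Noise

/-! ### Colourings of a finite partition -/

section Colourings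

variable {α : Type*} {k : ℕ}

namespace BoundedPartition

theorem exists_colouring [Finite α] (y : BoundedPartition α k) :
    ∃ c : α → Fin k, ∀ a b, c a = c b ↔ y.1 a b := by
  have hfin : y.1.classes.Finite := Set.finite_of_encard_le_coe y.2
  have := hfin.fintype
  have hcard : Fintype.card y.1.classes ≤ Fintype.card (Fin k) := by
    rw [Fintype.card_fin, ← Nat.card_eq_fintype_card]
    exact ENat.natCast_le_natCast.1 (hfin.cast_ncard_eq.trans_le y.2)
  obtain ⟨e⟩ := Function.Embedding.nonempty_of_card_le hcard
  refine ⟨fun a => e ⟨_, y.1.mem_classes a⟩, fun a b => ?_⟩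
  rw [e.apply_eq_iff_eq, Subtype.mk.injEq]
  constructor
  · intro h
    have h1 : a ∈ {x | y.1 x b} := by
      rw [← h]; exact y.1.refl a
    exact h1
  · intro h
    ext x
    exact ⟨fun hx => y.1.trans hx h, fun hx => y.1.trans hx (y.1.symm h)⟩

theorem ncard_blocks_eq {y : BoundedPartition α k} {c : α → Fin k}
    (hc : ∀ a b, c a = c b ↔ y.1 a b) : y.blocks.ncard = (Set.range c).ncard := by
  have h : y.blocks = (fun j => {x | c x = j}) '' Set.range c := by
    ext s
    constructor
    · rintro ⟨a, rfl⟩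
      refine ⟨c a, ⟨a, rfl⟩, ?_⟩
      ext x
      exact hc x a
    · rintro ⟨_, ⟨a, rfl⟩, rfl⟩
      refine ⟨a, ?_⟩
      ext x
      exact hc x a
  rw [h]
  refine Set.InjOn.ncard_image ?_
  rintro _ ⟨a, rfl⟩ _ ⟨b, rfl⟩ hab
  have h1 : a ∈ {x | c x = c b} := by
    rw [← show {x | c x = c a} = {x | c x = c b} from hab]; rfl
  exact h1

open Classical in
/-- The colourings which generate a given partition. -/
noncomputable def colourings [Fintype α] (y : BoundedPartition α k) : Finset (α → Fin k) :=
  Finset.univ.filter fun c => ∀ a b, c a = c b ↔ y.1 a b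

theorem mem_colourings [Fintype α] {y : BoundedPartition α k} {c : α → Fin k} :
    c ∈ y.colourings ↔ ∀ a b, c a = c b ↔ y.1 a b := by
  classical
  simp [colourings]

open Classical in
theorem card_perm_fixing (s : Set (Fin k)) :
    (Finset.univ.filter fun σ : Equiv.Perm (Fin k) => ∀ j ∈ s, σ j = j).card =
      (k - s.ncard).factorial := by
  rw [← Fintype.card_subtype]
  have e := Equiv.Perm.subtypeEquivSubtypePerm fun j => j ∉ s
  have e2 : {σ : Equiv.Perm (Fin k) // ∀ j ∈ s, σ j = j} ≃ Equiv.Perm {j // j ∉ s} :=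
    (Equiv.subtypeEquivRight fun σ => by simp).trans e.symm
  rw [Fintype.card_congr e2, Fintype.card_perm]
  congr 1
  rw [Fintype.card_subtype_compl, Fintype.card_fin, ← Nat.card_eq_fintype_card]
  rfl

open Classical in
-- These permutations form a coset of the pointwise stabiliser of the colours used by `c`, which has
-- as many elements as there are permutations of the unused colours.
theorem card_perm_comp_eq [Fintype α] {y : BoundedPartition α k} {c c' : α → Fin k}
    (hc : c ∈ y.colourings) (hc' : c' ∈ y.colourings) :
    (Finset.univ.filter fun σ : Equiv.Perm (Fin k) => σ ∘ c = c').card =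
      (k - y.blocks.ncard).factorial := by
  rw [mem_colourings] at hc hc'
  obtain ⟨τ, hτ⟩ := exists_perm_of_ker_eq c c' fun a b => (hc a b).trans (hc' a b).symm
  rw [ncard_blocks_eq hc, ← card_perm_fixing]
  refine Finset.card_bij (fun σ _ => τ⁻¹ * σ) ?_ ?_ ?_
  · intro σ hσ
    simp only [Finset.mem_filter, Finset.mem_univ, true_and] at hσ ⊢
    rintro _ ⟨a, rfl⟩
    have h := congrFun hσ a
    rw [hτ a] at h
    rw [Equiv.Perm.mul_apply, ← Function.comp_apply (f := σ), congrFun hσ a, hτ a]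
    simp
  · intro σ _ σ' _ h
    exact mul_left_cancel h
  · intro σ hσ
    simp only [Finset.mem_filter, Finset.mem_univ, true_and] at hσ
    refine ⟨τ * σ, ?_, by simp⟩
    simp only [Finset.mem_filter, Finset.mem_univ, true_and]
    funext a
    simp [hτ a, hσ (c a) ⟨a, rfl⟩]

/-- The colourings of `y` form a single orbit under permutations of the colours, and each of them is
reached equally often. -/
theorem sum_perm_comp [Fintype α] {y : BoundedPartition α k} {c : α → Fin k}
    (hc : c ∈ y.colourings) (f : (α → Fin k) → ℝ) :
    ∑ σ : Equiv.Perm (Fin k), f (σ ∘ c) =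
      (k - y.blocks.ncard).factorial * ∑ c' ∈ y.colourings, f c' := by
  classical
  rw [← Finset.sum_fiberwise_of_maps_to (s := Finset.univ) (t := y.colourings)
    (g := fun σ : Equiv.Perm (Fin k) => (σ ∘ c : α → Fin k)) (fun σ _ => by
      rw [mem_colourings] at hc ⊢
      intro a b
      simp [hc a b]), Finset.mul_sum]
  refine Finset.sum_congr rfl fun c' hc' => ?_
  rw [Finset.sum_congr rfl fun σ hσ => by rw [(Finset.mem_filter.1 hσ).2], Finset.sum_const,
    card_perm_comp_eq hc hc', nsmul_eq_mul]

theorem card_colourings [Fintype α] (y : BoundedPartition α k) :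
    (y.colourings.card : ℝ) = k.factorial / (k - y.blocks.ncard).factorial := by
  obtain ⟨c, hc⟩ := y.exists_colouring
  have h := sum_perm_comp (mem_colourings.2 hc) fun _ => 1
  simp only [Finset.sum_const, Finset.card_univ, Fintype.card_perm, Fintype.card_fin, nsmul_eq_mul,
    mul_one] at h
  rw [h, mul_div_cancel_left₀]
  exact_mod_cast Nat.factorial_ne_zero _

end BoundedPartition

end Colourings

theorem measureReal_mem_finset_eq_sum {Ω S : Type*} [MeasurableSpace Ω] [MeasurableSpace S]
    [MeasurableSingletonClass S] (μ : Measure Ω) [IsFiniteMeasure μ] {X : Ω → S} (hX : Measurable X)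
    (C : Finset S) : μ.real {ω | X ω ∈ C} = ∑ c ∈ C, μ.real {ω | X ω = c} := by
  have h : {ω | X ω ∈ C} = ⋃ c ∈ C, {ω | X ω = c} := by ext; simp
  rw [h, measureReal_biUnion_finset]
  · intro c _ d _ hcd
    exact Set.disjoint_left.2 fun ω h1 h2 => hcd (h1.symm.trans h2)
  · exact fun c _ => hX (measurableSet_singleton c)

/-! ### The restrictions of the chain of partitions -/

section Lumping

variable {k : ℕ} (ν : Measure (RankedSimplex k)) [IsProbabilityMeasure ν]

theorem mixedPaintbox_eq :
    mixedPaintbox ν = (ν ⊗ₘ iidColours k).snd.map colourPartition := by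
  have hp : paintbox = fun s => ((iidColours k).map colourPartition) s := by
    funext s
    rw [Kernel.map_apply _ BoundedPartition.measurable_colourPartition]
    rfl
  rw [Measure.snd_compProd, mixedPaintbox, hp]
  exact (Measure.map_comp ν (iidColours k) BoundedPartition.measurable_colourPartition).symm

theorem measurable_restrict_colours {n : ℕ} (b : Set (Fin n)) :
    Measurable fun (w : ℕ → Fin k) (x : b) => w x :=
  measurable_pi_lambda _ fun _ => measurable_pi_apply _

theorem paintboxProb_eq_sum {n : ℕ} (y : BoundedPartition (Fin n) k) (b : Set (Fin n)) [Fintype b] :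
    paintboxProb ν y b = ∑ c ∈ (y.restrictTo b).colourings,
      (ν ⊗ₘ iidColours k).snd.real {w | (fun x : b => w x) = c} := by
  rw [← measureReal_mem_finset_eq_sum _ (measurable_restrict_colours b), paintboxProb,
    mixedPaintbox_eq, map_measureReal_apply BoundedPartition.measurable_colourPartition]
  · congr 1
    ext w
    simp only [Set.mem_preimage, Set.mem_ofPred_eq, BoundedPartition.mem_colourings]
    constructor
    · intro h a c
      rw [← h]
      rfl
    · intro h
      exact BoundedPartition.ext_rel fun a c => h a c
  · exact ((BoundedPartition.measurable_comap _).comp (BoundedPartition.measurable_restrict n))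
      (measurableSet_singleton _)

/-- The event says that the drawn colours on `b` equal `σ ∘ c`. Averaging over the uniform `σ` runs
through all colourings of `y` on `b`, whose total probability is the paintbox probability; the
multiplicity over `k!` is the fraction in p_n. -/
theorem measureReal_blockNoise {n : ℕ} {y : BoundedPartition (Fin n) k} {c : Fin n → Fin k}
    (hc : ∀ a b, c a = c b ↔ y.1 a b) (b : Set (Fin n)) :
    ((ν ⊗ₘ iidColours k).prod (uniformPerm k)).real
        {z | ∀ x ∈ b, z.2.symm (z.1.2 x) = c x} =
      ((k - (y.restrictTo b).blocks.ncard).factorial : ℝ) / k.factorial * paintboxProb ν y b := by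
  classical
  have hcb : (fun x : b => c x) ∈ (y.restrictTo b).colourings :=
    BoundedPartition.mem_colourings.2 fun x x' => hc x x'
  have hm : MeasurableSet {z : BlockNoise k | ∀ x ∈ b, z.2.symm (z.1.2 x) = c x} := by
    simp only [Set.ofPred_forall]
    refine MeasurableSet.iInter fun x => MeasurableSet.iInter fun _ => ?_
    have h1 : Measurable fun w : Fin k × Equiv.Perm (Fin k) => w.2.symm w.1 := measurable_of_finite _
    have h2 : Measurable fun b : BlockNoise k => (b.1.2 x, b.2) :=
      ((measurable_pi_apply _).comp (measurable_snd.comp measurable_fst)).prodMk measurable_snd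
    exact (h1.comp h2) (measurableSet_singleton _)
  have h1 : ((ν ⊗ₘ iidColours k).prod (uniformPerm k)).real
        {z | ∀ x ∈ b, z.2.symm (z.1.2 x) = c x} =
      ∑ σ : Equiv.Perm (Fin k), (ν ⊗ₘ iidColours k).snd.real
        {w | (fun x : b => w x) = σ ∘ fun x : b => c x} * (k.factorial : ℝ)⁻¹ := by
    rw [measureReal_def, Measure.prod_apply_symm hm, lintegral_fintype, ENNReal.toReal_sum]
    · refine Finset.sum_congr rfl fun σ _ => ?_
      rw [ENNReal.toReal_mul, uniformPerm_singleton, ENNReal.toReal_inv, ENNReal.toReal_natCast,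
        measureReal_def, Measure.snd_apply]
      · congr 3
        ext q
        simp only [Set.mem_preimage, Set.mem_ofPred_eq, funext_iff, Subtype.forall,
          Function.comp_apply, Equiv.symm_apply_eq]
      · exact measurable_restrict_colours b (measurableSet_singleton _)
    · intro σ _
      rw [uniformPerm_singleton]
      exact ENNReal.mul_ne_top (measure_ne_top _ _)
        (ENNReal.inv_ne_top.2 (by exact_mod_cast k.factorial_ne_zero))
  rw [h1, ← Finset.sum_mul, BoundedPartition.sum_perm_comp hcb
    (fun c' => (ν ⊗ₘ iidColours k).snd.real {w | (fun x : b => w x) = c'}),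
    ← paintboxProb_eq_sum]
  ring

/-- The noise is indexed by all `k` labels, the product in p_n by the actual blocks; `hF` lets the
unused labels contribute a factor 1. -/
theorem prod_fibres_eq_prod_blocks {n : ℕ} (B : BoundedPartition (Fin n) k) {l : Fin n → Fin k}
    (hl : ∀ a b, l a = l b ↔ B.1 a b) (F : Set (Fin n) → ℝ) (hF : F ∅ = 1) :
    ∏ i, F {x | l x = i} = ∏ b ∈ (Set.toFinite B.blocks).toFinset, F b := by
  classical
  symm
  have himg : (Set.toFinite B.blocks).toFinset =
      (Finset.univ.image l).image fun i => {x | l x = i} := by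
    ext s
    simp only [Set.Finite.mem_toFinset, Finset.mem_image, Finset.mem_univ, true_and]
    constructor
    · rintro ⟨a, rfl⟩
      exact ⟨l a, ⟨a, rfl⟩, Set.ext fun x => hl x a⟩
    · rintro ⟨_, ⟨a, rfl⟩, rfl⟩
      exact ⟨a, Set.ext fun x => hl x a⟩
  rw [himg, Finset.prod_image]
  · refine Finset.prod_subset (Finset.subset_univ _) fun i _ hi => ?_
    have : {x | l x = i} = ∅ := by
      ext x
      simp only [Set.mem_ofPred_eq, Set.mem_empty_iff_false, iff_false]
      rintro rfl
      exact hi (Finset.mem_image_of_mem _ (Finset.mem_univ x))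
    rw [this, hF]
  · intro i hi j hj hij
    simp only [Finset.coe_image, Finset.coe_univ, Set.image_univ, Set.mem_range] at hi
    obtain ⟨a, rfl⟩ := hi
    have h1 : a ∈ {x | l x = j} := by
      rw [← show {x | l x = l a} = {x | l x = j} from hij]; rfl
    exact h1

/-- A prescribed colouring of [n] imposes a separate condition on the noise of each old block, and
these noises are independent. -/
theorem measureReal_noiseLaw_stepColour (π : BoundedPartition ℕ k) {n : ℕ}
    {y : BoundedPartition (Fin n) k} {c : Fin n → Fin k} (hc : ∀ a b, c a = c b ↔ y.1 a b) :
    (noiseLaw ν).real {z | (fun x : Fin n => stepColour π z x) = c} =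
      ∏ b ∈ (Set.toFinite (π.restrict n).blocks).toFinset,
        ((k - (y.restrictTo b).blocks.ncard).factorial : ℝ) / k.factorial * paintboxProb ν y b := by
  have h1 : {z : Fin k → BlockNoise k | (fun x : Fin n => stepColour π z x) = c} =
      Set.univ.pi fun i => {z | ∀ x ∈ {x : Fin n | π.label x = i}, z.2.symm (z.1.2 x) = c x} := by
    ext z
    simp only [Set.mem_ofPred_eq, funext_iff, Set.mem_univ_pi, stepColour]
    exact ⟨fun h i x hx => by subst hx; exact h x, fun h x => h _ x rfl⟩
  have h2 : ∀ b : Set (Fin n), ((ν ⊗ₘ iidColours k).prod (uniformPerm k)).real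
        {z | ∀ x ∈ b, z.2.symm (z.1.2 x) = c x} =
      ((k - (y.restrictTo b).blocks.ncard).factorial : ℝ) / k.factorial * paintboxProb ν y b :=
    measureReal_blockNoise ν hc
  rw [h1, measureReal_def, noiseLaw, Measure.pi_pi, ENNReal.toReal_prod]
  simp_rw [← h2]
  refine prod_fibres_eq_prod_blocks (π.restrict n) (l := fun x => π.label x)
    (fun a b => BoundedPartition.label_eq_iff) (fun b => ((ν ⊗ₘ iidColours k).prod
      (uniformPerm k)).real {z | ∀ x ∈ b, z.2.symm (z.1.2 x) = c x}) ?_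
  simp

/-- The restriction to `[n]` of the chain of partitions has transition matrix `p_n`. -/
theorem partitionKernel_real_restrict (π : BoundedPartition ℕ k) {n : ℕ}
    (y : BoundedPartition (Fin n) k) :
    (partitionKernel ν π).real {π' | π'.restrict n = y} = transProb ν (π.restrict n) y := by
  have hm : Measurable fun z => colourPartition (stepColour π z) :=
    measurable_stepPartition.comp measurable_prodMk_left
  have hm2 : Measurable fun (z : Fin k → BlockNoise k) (x : Fin n) => stepColour π z x :=
    measurable_pi_lambda _ fun x => (measurable_stepColour _).comp measurable_prodMk_left
  have hms : MeasurableSet {π' : BoundedPartition ℕ k | π'.restrict n = y} :=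
    BoundedPartition.measurable_restrict n (measurableSet_singleton y)
  rw [partitionKernel, randomMapKernel_apply, map_measureReal_apply hm hms]
  have h1 : (fun z => colourPartition (stepColour π z)) ⁻¹' {π' | π'.restrict n = y} =
      {z | (fun x : Fin n => stepColour π z x) ∈ y.colourings} := by
    ext z
    simp only [Set.mem_preimage, Set.mem_ofPred_eq, BoundedPartition.mem_colourings]
    constructor
    · intro h a c
      rw [← h]
      rfl
    · intro h
      exact BoundedPartition.ext_rel fun a c => h a c
  -- The probability is the same for every colouring of `y`, so the sum is their number, which is
  -- the leading factor of p_n, times one product.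
  rw [h1, measureReal_mem_finset_eq_sum _ hm2, Finset.sum_congr rfl fun c hc =>
    measureReal_noiseLaw_stepColour ν π (BoundedPartition.mem_colourings.1 hc), Finset.sum_const,
    nsmul_eq_mul, BoundedPartition.card_colourings, transProb]

end Lumping

/-! ### Powers of kernels and Poisson subordination -/

section Subordination

variable {E F : Type*} [MeasurableSpace E] [MeasurableSpace F]

/-- The `j`-step transition kernel. -/
noncomputable def kernelPow (κ : Kernel E E) : ℕ → Kernel E E
  | 0 => Kernel.id
  | j + 1 => κ ∘ₖ kernelPow κ j

instance (κ : Kernel E E) [IsMarkovKernel κ] (j : ℕ) : IsMarkovKernel (kernelPow κ j) := by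
  induction j with
  | zero => unfold kernelPow; infer_instance
  | succ j ih => unfold kernelPow; infer_instance

theorem kernelPow_succ_apply (κ : Kernel E E) (j : ℕ) (x : E) {s : Set E} (hs : MeasurableSet s) :
    kernelPow κ (j + 1) x s = ∫⁻ y, κ y s ∂kernelPow κ j x := by
  rw [kernelPow, Kernel.comp_apply' _ _ _ hs]

/-- The transition kernel of the chain run for a Poisson number of steps. -/
noncomputable def poissonizedKernel (κ : Kernel E E) (r : ℝ≥0) : Kernel E E where
  toFun x := Measure.sum fun j => poissonMeasure r {j} • kernelPow κ j x
  measurable' := by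
    refine Measure.measurable_of_measurable_coe _ fun s hs => ?_
    simp only [Measure.sum_apply _ hs, Measure.smul_apply, smul_eq_mul]
    exact Measurable.tsum fun j => ((kernelPow κ j).measurable_coe hs).const_mul _

theorem poissonizedKernel_apply (κ : Kernel E E) (r : ℝ≥0) (x : E) :
    poissonizedKernel κ r x = Measure.sum fun j => poissonMeasure r {j} • kernelPow κ j x := rfl

theorem poissonizedKernel_apply' (κ : Kernel E E) (r : ℝ≥0) (x : E) {s : Set E} (hs : MeasurableSet s) :
    poissonizedKernel κ r x s = ∑' j, poissonMeasure r {j} * kernelPow κ j x s := by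
  simp [poissonizedKernel_apply, Measure.sum_apply _ hs]

theorem lintegral_poissonizedKernel (κ : Kernel E E) (r : ℝ≥0) (x : E) (f : E → ℝ≥0∞) :
    ∫⁻ y, f y ∂poissonizedKernel κ r x = ∑' j, poissonMeasure r {j} * ∫⁻ y, f y ∂kernelPow κ j x := by
  simp [poissonizedKernel_apply, lintegral_sum_measure, lintegral_smul_measure]

theorem tsum_poissonMeasure_singleton (r : ℝ≥0) : ∑' j, poissonMeasure r {j} = 1 := by
  have h := lintegral_countable' (μ := poissonMeasure r) fun _ => (1 : ℝ≥0∞)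
  simpa using h.symm

instance (κ : Kernel E E) [IsMarkovKernel κ] (r : ℝ≥0) : IsMarkovKernel (poissonizedKernel κ r) where
  isProbabilityMeasure x := ⟨by
    rw [poissonizedKernel_apply' _ _ _ MeasurableSet.univ]
    simpa using tsum_poissonMeasure_singleton r⟩

/-! ### Intertwined kernels on an absorbing set -/

section Intertwining

variable {κ : Kernel E E} {κ' : Kernel F F} {Λ : E → F} {G : Set E}

theorem ae_kernelPow_mem (hG : MeasurableSet G) (h : ∀ x ∈ G, ∀ᵐ y ∂κ x, y ∈ G) (j : ℕ) {x : E}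
    (hx : x ∈ G) : ∀ᵐ y ∂kernelPow κ j x, y ∈ G := by
  induction j with
  | zero =>
    rw [kernelPow, Kernel.id_apply]
    exact (ae_dirac_iff hG).2 hx
  | succ j ih =>
    change kernelPow κ (j + 1) x Gᶜ = 0
    rw [kernelPow_succ_apply _ _ _ hG.compl, lintegral_eq_zero_iff (κ.measurable_coe hG.compl)]
    filter_upwards [ih] with y hy
    exact h y hy

/-- The intertwining is available only on `G` (later: partitions with frequencies), so the induction
also uses that the chain never leaves `G`. -/
theorem kernelPow_map (hΛ : Measurable Λ) (hG : MeasurableSet G)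
    (h : ∀ x ∈ G, ∀ᵐ y ∂κ x, y ∈ G) (hmap : ∀ x ∈ G, (κ x).map Λ = κ' (Λ x)) (j : ℕ) {x : E}
    (hx : x ∈ G) : (kernelPow κ j x).map Λ = kernelPow κ' j (Λ x) := by
  induction j with
  | zero =>
    rw [kernelPow, kernelPow, Kernel.id_apply, Kernel.id_apply, Measure.map_dirac' hΛ]
  | succ j ih =>
    ext s hs
    rw [Measure.map_apply hΛ hs, kernelPow_succ_apply _ _ _ (hΛ hs), kernelPow_succ_apply _ _ _ hs,
      ← ih, lintegral_map (κ'.measurable_coe hs) hΛ]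
    refine lintegral_congr_ae ?_
    filter_upwards [ae_kernelPow_mem hG h j hx] with y hy
    rw [← hmap y hy, Measure.map_apply hΛ hs]

theorem ae_poissonizedKernel_mem (hG : MeasurableSet G) (h : ∀ x ∈ G, ∀ᵐ y ∂κ x, y ∈ G) (r : ℝ≥0)
    {x : E} (hx : x ∈ G) : ∀ᵐ y ∂poissonizedKernel κ r x, y ∈ G := by
  change poissonizedKernel κ r x Gᶜ = 0
  rw [poissonizedKernel_apply' _ _ _ hG.compl, ENNReal.tsum_eq_zero]
  intro j
  have : kernelPow κ j x Gᶜ = 0 := ae_kernelPow_mem hG h j hx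
  rw [this, mul_zero]

theorem poissonizedKernel_map (hΛ : Measurable Λ) (hG : MeasurableSet G)
    (h : ∀ x ∈ G, ∀ᵐ y ∂κ x, y ∈ G) (hmap : ∀ x ∈ G, (κ x).map Λ = κ' (Λ x)) (r : ℝ≥0) {x : E}
    (hx : x ∈ G) : (poissonizedKernel κ r x).map Λ = poissonizedKernel κ' r (Λ x) := by
  ext s hs
  rw [Measure.map_apply hΛ hs, poissonizedKernel_apply' _ _ _ (hΛ hs), poissonizedKernel_apply' _ _ _ hs]
  refine tsum_congr fun j => ?_
  rw [← kernelPow_map hΛ hG h hmap j hx, Measure.map_apply hΛ hs]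

end Intertwining

end Subordination

/-- An intertwining that holds for almost every starting point suffices to push a joint law forward
in both coordinates. -/
theorem compProd_map_prodMap {E F E' F' : Type*} [MeasurableSpace E] [MeasurableSpace F]
    [MeasurableSpace E'] [MeasurableSpace F'] {μ : Measure E} [SFinite μ] {κ : Kernel E F}
    [IsSFiniteKernel κ] {κ' : Kernel E' F'} [IsSFiniteKernel κ'] {f : E → E'} {g : F → F'}
    (hf : Measurable f) (hg : Measurable g) (h : ∀ᵐ x ∂μ, (κ x).map g = κ' (f x)) :
    (μ ⊗ₘ κ).map (Prod.map f g) = μ.map f ⊗ₘ κ' := by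
  ext s hs
  rw [Measure.map_apply (hf.prodMap hg) hs, Measure.compProd_apply (hf.prodMap hg hs),
    Measure.compProd_apply hs, lintegral_map (Kernel.measurable_kernel_prodMk_left hs) hf]
  refine lintegral_congr_ae ?_
  filter_upwards [h] with x hx
  rw [← hx, Measure.map_apply hg (measurable_prodMk_left hs)]
  rfl

/-! ### Markov processes with given transition kernels -/

section Transition

variable {Ω E F : Type*} [MeasurableSpace Ω] [MeasurableSpace E] [MeasurableSpace F]

theorem measurable_finSnoc {m : ℕ} :
    Measurable fun q : (Fin m → E) × E => (Fin.snoc q.1 q.2 : Fin (m + 1) → E) := by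
  refine measurable_pi_lambda _ fun i => ?_
  induction i using Fin.lastCases with
  | last => simpa using measurable_snd
  | cast i =>
    simp only [Fin.snoc_castSucc]
    exact (measurable_pi_apply i).comp measurable_fst

/-- The transition kernels `κ u` applied to the last of finitely many states. -/
noncomputable def lastKernel {m : ℕ} (κ : Kernel E E) : Kernel (Fin (m + 1) → E) E :=
  κ.comap (fun y => y (Fin.last m)) (measurable_pi_apply _)

instance {m : ℕ} (κ : Kernel E E) [IsMarkovKernel κ] : IsMarkovKernel (lastKernel (m := m) κ) := by
  unfold lastKernel; infer_instance

/-- The process `Y` is Markov with transition kernels `κ u` over time spans `u`, in terms of its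
finite-dimensional distributions. -/
def HasTransition (P : Measure Ω) (Y : ℝ≥0 → Ω → E) (κ : ℝ≥0 → Kernel E E) : Prop :=
  ∀ (m : ℕ) (t : Fin (m + 2) → ℝ≥0), Monotone t →
    P.map (fun ω i => Y (t i) ω) =
      (P.map (fun ω (i : Fin (m + 1)) => Y (t i.castSucc) ω) ⊗ₘ
        lastKernel (κ (t (Fin.last _) - t (Fin.last m).castSucc))).map fun q => Fin.snoc q.1 q.2

variable {P : Measure Ω}

/-- Dynkin's criterion for a function of a Markov process to be Markov. The intertwining is needed
only on a set that contains the process almost surely at each fixed time. -/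
theorem HasTransition.map [IsProbabilityMeasure P] {Y : ℝ≥0 → Ω → E} (hYm : ∀ t, Measurable (Y t))
    {κ : ℝ≥0 → Kernel E E} [∀ u, IsMarkovKernel (κ u)] {κ' : ℝ≥0 → Kernel F F}
    [∀ u, IsMarkovKernel (κ' u)] (h : HasTransition P Y κ) {Λ : E → F} (hΛ : Measurable Λ)
    {G : Set E} (hYG : ∀ t, ∀ᵐ ω ∂P, Y t ω ∈ G) (hG : MeasurableSet G)
    (hmap : ∀ u, ∀ x ∈ G, (κ u x).map Λ = κ' u (Λ x)) :
    HasTransition P (fun t ω => Λ (Y t ω)) κ' := by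
  intro m t ht
  have hΛ' : ∀ {l : ℕ}, Measurable fun (y : Fin l → E) i => Λ (y i) := fun {l} =>
    measurable_pi_lambda _ fun i => hΛ.comp (measurable_pi_apply i)
  have hYt : ∀ {l : ℕ} (s : Fin l → ℝ≥0), Measurable fun ω i => Y (s i) ω := fun s =>
    measurable_pi_lambda _ fun i => hYm (s i)
  have e1 : P.map (fun ω i => Λ (Y (t i) ω)) =
      (P.map (fun ω i => Y (t i) ω)).map fun y i => Λ (y i) := by
    rw [Measure.map_map hΛ' (hYt _)]; rfl
  have e2 : P.map (fun ω (i : Fin (m + 1)) => Λ (Y (t i.castSucc) ω)) =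
      (P.map (fun ω (i : Fin (m + 1)) => Y (t i.castSucc) ω)).map fun y i => Λ (y i) := by
    rw [Measure.map_map hΛ' (hYt _)]; rfl
  rw [e1, e2, h m t ht, Measure.map_map hΛ' measurable_finSnoc]
  have : IsProbabilityMeasure (P.map fun ω (i : Fin (m + 1)) => Y (t i.castSucc) ω) :=
    Measure.isProbabilityMeasure_map (hYt _).aemeasurable
  rw [← compProd_map_prodMap hΛ' hΛ (κ := lastKernel (κ (t (Fin.last _) - t (Fin.last m).castSucc)))
    (κ' := lastKernel (κ' (t (Fin.last _) - t (Fin.last m).castSucc))) ?_,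
    Measure.map_map measurable_finSnoc (hΛ'.prodMap hΛ)]
  · congr 1
    funext q i
    induction i using Fin.lastCases with
    | last => simp
    | cast i => simp
  · refine (ae_map_iff (hYt _).aemeasurable ?_).2 ?_ |>.mono fun y (hy : y (Fin.last m) ∈ G) => ?_
    · exact measurable_pi_apply _ hG
    · exact hYG _
    · exact hmap _ _ hy

/-- Induction on the number of times: both joint laws are extended by the same kernel. The times
must begin at 0, where the laws are known to agree. -/
theorem HasTransition.map_eq {Ω' : Type*} [MeasurableSpace Ω'] {P' : Measure Ω'}
    {Y : ℝ≥0 → Ω → E} {Y' : ℝ≥0 → Ω' → E} (hYm : ∀ t, Measurable (Y t))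
    (hYm' : ∀ t, Measurable (Y' t)) {κ : ℝ≥0 → Kernel E E}
    (h : HasTransition P Y κ) (h' : HasTransition P' Y' κ) (h0 : P.map (Y 0) = P'.map (Y' 0))
    (m : ℕ) (t : Fin (m + 1) → ℝ≥0) (ht : Monotone t) (ht0 : t 0 = 0) :
    P.map (fun ω i => Y (t i) ω) = P'.map fun ω i => Y' (t i) ω := by
  induction m with
  | zero =>
    have hc : Measurable fun (y : E) (_ : Fin (0 + 1)) => y :=
      measurable_pi_lambda _ fun _ => measurable_id
    have ht' : ∀ i, t i = 0 := fun i => by rw [show i = 0 from Fin.ext (by omega), ht0]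
    simp_rw [ht']
    have h1 := congrArg (Measure.map fun (y : E) (_ : Fin (0 + 1)) => y) h0
    rw [Measure.map_map hc (hYm 0), Measure.map_map hc (hYm' 0)] at h1
    exact h1
  | succ m ih =>
    rw [h m t ht, h' m t ht, ih (fun i => t i.castSucc)
      (fun i j hij => ht (Fin.castSucc_le_castSucc_iff.2 hij)) (by simpa using ht0)]

theorem HasTransition.identDistrib [IsProbabilityMeasure P] {Ω' : Type*} [MeasurableSpace Ω'] {P' : Measure Ω'}
    [IsProbabilityMeasure P']
    {Y : ℝ≥0 → Ω → E} {Y' : ℝ≥0 → Ω' → E} (hYm : ∀ t, Measurable (Y t))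
    (hYm' : ∀ t, Measurable (Y' t)) {κ : ℝ≥0 → Kernel E E}
    (h : HasTransition P Y κ) (h' : HasTransition P' Y' κ) (h0 : P.map (Y 0) = P'.map (Y' 0)) :
    IdentDistrib (fun ω t => Y t ω) (fun ω t => Y' t ω) P P' := by
  classical
  have hY : Measurable fun ω t => Y t ω := measurable_pi_lambda _ hYm
  have hY' : Measurable fun ω t => Y' t ω := measurable_pi_lambda _ hYm'
  refine ⟨hY.aemeasurable, hY'.aemeasurable, ?_⟩
  have l1 := isProjectiveLimit_map (P := P) hY.aemeasurable
  have l2 := isProjectiveLimit_map (P := P') hY'.aemeasurable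
  have hfam : (fun I : Finset ℝ≥0 => P.map fun ω => I.restrict fun t => Y t ω) =
      fun I => P'.map fun ω => I.restrict fun t => Y' t ω := by
    funext I
    -- Time 0 is added so that the comparison can start from the common initial law; projecting to
    -- `I` removes it again.
    set J := insert 0 I with hJ
    obtain ⟨m, hm⟩ : ∃ m, J.card = m + 1 :=
      Nat.exists_eq_succ_of_ne_zero (Finset.card_ne_zero_of_mem (Finset.mem_insert_self 0 I))
    set e := J.orderIsoOfFin hm with he
    have ht0 : (e 0 : ℝ≥0) = 0 := by
      have h1 : e 0 ≤ e (e.symm ⟨0, Finset.mem_insert_self 0 I⟩) := e.monotone (Fin.zero_le _)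
      rw [e.apply_symm_apply] at h1
      exact le_antisymm h1 zero_le
    have key := h.map_eq hYm hYm' h' h0 m (fun i => (e i : ℝ≥0)) (fun i j hij => e.monotone hij) ht0
    have hr : Measurable fun (y : Fin (m + 1) → E) (i : I) =>
        y (e.symm ⟨i, Finset.mem_insert_of_mem i.2⟩) :=
      measurable_pi_lambda _ fun i => measurable_pi_apply _
    have h1 := congrArg (Measure.map fun (y : Fin (m + 1) → E) (i : I) =>
        y (e.symm ⟨i, Finset.mem_insert_of_mem i.2⟩)) key
    rw [Measure.map_map hr (measurable_pi_lambda _ fun i => hYm _),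
      Measure.map_map hr (measurable_pi_lambda _ fun i => hYm' _)] at h1
    convert h1 using 2
    · funext ω i
      simp
    · funext ω i
      simp
  have l1' : IsProjectiveLimit (P.map fun ω t => Y t ω)
      (fun I : Finset ℝ≥0 => P'.map fun ω => I.restrict fun t => Y' t ω) := hfam ▸ l1
  have : ∀ I : Finset ℝ≥0, IsFiniteMeasure (P'.map fun ω => I.restrict fun t => Y' t ω) :=
    fun I => inferInstance
  exact l1'.unique l2

end Transition

/-! ### Exponentials of `Q`-matrices -/

section MatrixExp

variable {S : Type*} [Fintype S] [DecidableEq S]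

/-- The matrix `r • p` commutes with the scalar matrix -r, so the exponential is exp(-r) times that
of `r • p`. The coefficients are the Poisson weights of a chain run on a Poisson clock. -/
theorem Matrix.hasSum_exp_smul_sub_one (p : Matrix S S ℝ) (r : ℝ) (x y : S) :
    HasSum (fun j : ℕ => Real.exp (-r) * r ^ j / j.factorial * (p ^ j) x y)
      (NormedSpace.exp (r • (p - 1)) x y) := by
  have h1 : NormedSpace.exp (r • (p - 1)) = Real.exp (-r) • NormedSpace.exp (r • p) := by
    have e1 : r • (p - 1) = r • p + Matrix.diagonal (fun _ : S => -r) := by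
      rw [smul_sub, sub_eq_add_neg]
      congr 1
      ext i j
      by_cases hij : i = j
      · subst hij; simp
      · simp [hij]
    have e2 : Matrix.diagonal (fun _ : S => -r) = (-r) • (1 : Matrix S S ℝ) := by
      ext i j
      by_cases hij : i = j
      · subst hij; simp
      · simp [hij]
    have hcomm : Commute (r • p) (Matrix.diagonal fun _ : S => -r) := by
      rw [e2]
      exact (Commute.one_right _).smul_right _
    rw [e1, Matrix.exp_add_of_commute _ _ hcomm, Matrix.exp_diagonal]
    have e3 : NormedSpace.exp (fun _ : S => -r) = fun _ => Real.exp (-r) := by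
      funext i
      rw [Pi.coe_exp, Real.exp_eq_exp_ℝ]
    rw [e3]
    ext i j
    rw [Matrix.mul_diagonal, Matrix.smul_apply, smul_eq_mul, mul_comm]
  have h2 : HasSum (fun j : ℕ => ((j.factorial : ℝ)⁻¹) • (r • p) ^ j)
      (NormedSpace.exp (r • p)) := by
    open scoped Matrix.Norms.Operator in
    exact NormedSpace.exp_series_hasSum_exp' (𝕂 := ℝ) (r • p)
  have h3 := ((Pi.hasSum.1 ((Pi.hasSum.1 h2) x)) y).mul_left (Real.exp (-r))
  rw [h1, Matrix.smul_apply, smul_eq_mul]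
  have h4 : (fun j : ℕ => Real.exp (-r) * r ^ j / j.factorial * (p ^ j) x y) =
      fun j : ℕ => Real.exp (-r) * ((j.factorial : ℝ)⁻¹ • (r • p) ^ j) x y := by
    funext j
    rw [smul_pow, Matrix.smul_apply, Matrix.smul_apply, smul_eq_mul, smul_eq_mul]
    ring
  rw [h4]
  exact h3

end MatrixExp

/-! ### The transition kernels of the process of partitions -/

section PartitionProcess

variable {k : ℕ} (ν : Measure (RankedSimplex k)) [IsProbabilityMeasure ν]

/-- The matrix `p_n`. -/
noncomputable def transMatrix (n : ℕ) :
    Matrix (BoundedPartition (Fin n) k) (BoundedPartition (Fin n) k) ℝ :=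
  Matrix.of fun B B' => transProb ν B B'

omit [IsProbabilityMeasure ν] in
theorem generatorMatrix_eq (lam : ℝ≥0) (n : ℕ) :
    generatorMatrix lam ν n = (lam : ℝ) • (transMatrix ν n - 1) := by
  ext B B'
  by_cases h : B = B'
  · subst h; simp [generatorMatrix, transMatrix]
  · simp [generatorMatrix, transMatrix, h]

omit [IsProbabilityMeasure ν] in
theorem transMatrix_nonneg (n : ℕ) (B B' : BoundedPartition (Fin n) k) :
    0 ≤ transMatrix ν n B B' := by
  refine mul_nonneg (by positivity) (Finset.prod_nonneg fun b _ => mul_nonneg (by positivity) ?_)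
  exact measureReal_nonneg

theorem measurableSet_restrict_eq {n : ℕ} (y : BoundedPartition (Fin n) k) :
    MeasurableSet {π : BoundedPartition ℕ k | π.restrict n = y} :=
  BoundedPartition.measurable_restrict n (measurableSet_singleton y)

theorem partitionKernel_restrict (π : BoundedPartition ℕ k) {n : ℕ}
    (y : BoundedPartition (Fin n) k) :
    partitionKernel ν π {π' | π'.restrict n = y} =
      ENNReal.ofReal (transMatrix ν n (π.restrict n) y) := by
  rw [transMatrix, Matrix.of_apply, ← partitionKernel_real_restrict, ofReal_measureReal]

/-- The chain can be lumped: one step of the restriction to [n] depends on the present partition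
through its restriction only. Powers of the kernel therefore become powers of the matrix. -/
theorem kernelPow_partitionKernel_restrict (π : BoundedPartition ℕ k) {n : ℕ}
    (y : BoundedPartition (Fin n) k) (j : ℕ) :
    kernelPow (partitionKernel ν) j π {π' | π'.restrict n = y} =
      ENNReal.ofReal ((transMatrix ν n ^ j) (π.restrict n) y) := by
  induction j generalizing y with
  | zero =>
    rw [kernelPow, Kernel.id_apply, Measure.dirac_apply' _ (measurableSet_restrict_eq y), pow_zero,
      Matrix.one_apply]
    by_cases h : π.restrict n = y <;> simp [h]
  | succ j ih =>
    rw [kernelPow_succ_apply _ _ _ (measurableSet_restrict_eq y)]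
    simp_rw [partitionKernel_restrict]
    have hr := BoundedPartition.measurable_restrict (k := k) n
    rw [← lintegral_map (f := fun z => ENNReal.ofReal (transMatrix ν n z y))
      (measurable_of_finite _) hr, lintegral_fintype, pow_succ, Matrix.mul_apply,
      ENNReal.ofReal_sum_of_nonneg fun z _ => mul_nonneg
        (Matrix.pow_apply_nonneg (transMatrix_nonneg ν n) _ _ _) (transMatrix_nonneg ν n _ _)]
    refine Finset.sum_congr rfl fun z _ => ?_
    rw [Measure.map_apply hr (measurableSet_singleton z), mul_comm, ENNReal.ofReal_mul
      (Matrix.pow_apply_nonneg (transMatrix_nonneg ν n) _ _ _), ← ih z]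
    rfl

theorem poissonizedKernel_restrict (π : BoundedPartition ℕ k) {n : ℕ}
    (y : BoundedPartition (Fin n) k) (r : ℝ≥0) :
    poissonizedKernel (partitionKernel ν) r π {π' | π'.restrict n = y} =
      ENNReal.ofReal (NormedSpace.exp ((r : ℝ) • (transMatrix ν n - 1)) (π.restrict n) y) := by
  have h := Matrix.hasSum_exp_smul_sub_one (transMatrix ν n) r (π.restrict n) y
  rw [poissonizedKernel_apply' _ _ _ (measurableSet_restrict_eq y), ← h.tsum_eq,
    ENNReal.ofReal_tsum_of_nonneg _ h.summable]
  · refine tsum_congr fun j => ?_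
    rw [kernelPow_partitionKernel_restrict, poissonMeasure_singleton,
      ← ENNReal.ofReal_mul (by positivity)]
  · exact fun j => mul_nonneg (by positivity)
      (Matrix.pow_apply_nonneg (transMatrix_nonneg ν n) _ _ _)

/-- Laws of finitely many partitions are determined by the restrictions to `[n]`. -/
theorem measure_ext_of_restrict {ι : Type*} [Finite ι] {μ μ' : Measure (ι → BoundedPartition ℕ k)}
    [IsFiniteMeasure μ]
    (h : ∀ n (y : ι → BoundedPartition (Fin n) k),
      μ {π | (fun i => (π i).restrict n) = y} = μ' {π | (fun i => (π i).restrict n) = y}) :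
    μ = μ' := by
  set ρ : ∀ n, (ι → BoundedPartition ℕ k) → ι → BoundedPartition (Fin n) k :=
    fun n π i => (π i).restrict n
  have hρ : ∀ n, Measurable (ρ n) := fun n => measurable_pi_lambda _ fun i =>
    (BoundedPartition.measurable_restrict n).comp (measurable_pi_apply i)
  have hF : ∀ n (F : Set (ι → BoundedPartition (Fin n) k)), μ (ρ n ⁻¹' F) = μ' (ρ n ⁻¹' F) := by
    intro n F
    have hms : MeasurableSet F := (Set.toFinite F).measurableSet
    rw [← Measure.map_apply (hρ n) hms, ← Measure.map_apply (hρ n) hms]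
    congr 1
    refine Measure.ext_of_singleton fun y => ?_
    rw [Measure.map_apply (hρ n) (measurableSet_singleton y),
      Measure.map_apply (hρ n) (measurableSet_singleton y)]
    exact h n y
  -- An event about restrictions to [n] is also one about restrictions to any larger [m]; this makes
  -- the generating family closed under intersections.
  have hmono : ∀ {n m : ℕ}, n ≤ m → ∀ F : Set (ι → BoundedPartition (Fin n) k),
      ∃ G : Set (ι → BoundedPartition (Fin m) k), ρ n ⁻¹' F = ρ m ⁻¹' G := by
    intro n m hnm F
    refine ⟨(fun y i => (y i).comap (Fin.castLE hnm)) ⁻¹' F, ?_⟩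
    rfl
  refine ext_of_generate_finite {S | ∃ n F, S = ρ n ⁻¹' F} ?_ ?_ ?_ ?_
  · refine le_antisymm (iSup_le fun i => ?_) (MeasurableSpace.generateFrom_le ?_)
    · change MeasurableSpace.comap _ (MeasurableSpace.generateFrom _) ≤ _
      rw [MeasurableSpace.comap_generateFrom]
      refine MeasurableSpace.generateFrom_le ?_
      rintro _ ⟨_, ⟨a, b, rfl⟩, rfl⟩
      refine MeasurableSpace.measurableSet_generateFrom ⟨max a b + 1,
        {y | (y i).1 ⟨a, by omega⟩ ⟨b, by omega⟩}, rfl⟩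
    · rintro _ ⟨n, F, rfl⟩
      exact hρ n (Set.toFinite F).measurableSet
  · rintro _ ⟨n, F, rfl⟩ _ ⟨m, G, rfl⟩ _
    obtain ⟨F', hF'⟩ := hmono (le_max_left n m) F
    obtain ⟨G', hG'⟩ := hmono (le_max_right n m) G
    exact ⟨max n m, F' ∩ G', by rw [hF', hG']; rfl⟩
  · rintro _ ⟨n, F, rfl⟩
    exact hF n F
  · exact hF 0 Set.univ

variable {ν} {Ω : Type*} [MeasurableSpace Ω] {P : Measure Ω} [IsProbabilityMeasure P] {lam : ℝ≥0}
  {B : ℝ≥0 → Ω → BoundedPartition ℕ k}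

/-- The Markov property is given for every restriction separately. As the restricted kernels are the
exponentials of the `Q`-matrices and restrictions determine laws, it lifts to the entire partition.
-/
theorem IsPaintboxMarkovProcess.hasTransition (hB : IsPaintboxMarkovProcess P lam ν B) :
    HasTransition P B fun u => poissonizedKernel (partitionKernel ν) (lam * u) := by
  intro m t ht
  have hBt : ∀ {l : ℕ} (s : Fin l → ℝ≥0), Measurable fun ω i => B (s i) ω := fun s =>
    measurable_pi_lambda _ fun i => hB.measurable (s i)
  have := Measure.isProbabilityMeasure_map (μ := P) (hBt t).aemeasurable
  have := Measure.isProbabilityMeasure_map (μ := P)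
    (hBt fun i : Fin (m + 1) => t i.castSucc).aemeasurable
  refine measure_ext_of_restrict fun n y => ?_
  have hms : ∀ {l : ℕ} (y : Fin l → BoundedPartition (Fin n) k),
      MeasurableSet {π : Fin l → BoundedPartition ℕ k | (fun i => (π i).restrict n) = y} :=
    fun {l} y => (measurable_pi_lambda _ fun i => (BoundedPartition.measurable_restrict n).comp
      (measurable_pi_apply i)) (measurableSet_singleton y)
  have hprob : ∀ {l : ℕ} (s : Fin (l + 1) → ℝ≥0), Monotone s →
      ∀ y : Fin (l + 1) → BoundedPartition (Fin n) k,
      P.map (fun ω i => B (s i) ω) {π | (fun i => (π i).restrict n) = y} =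
        ENNReal.ofReal (P.real {ω | (B (s 0) ω).restrict n = y 0} *
          ∏ i : Fin l, (NormedSpace.exp (((s i.succ : ℝ) - (s i.castSucc : ℝ)) •
            generatorMatrix lam ν n)) (y i.castSucc) (y i.succ)) := by
    intro l s hs y
    rw [← hB.markov n l s hs y, ofReal_measureReal, Measure.map_apply (hBt s) (hms y)]
    congr 1
    ext ω
    simp [funext_iff]
  have hset : (fun q : (Fin (m + 1) → BoundedPartition ℕ k) × BoundedPartition ℕ k =>
      (Fin.snoc q.1 q.2 : Fin (m + 2) → BoundedPartition ℕ k)) ⁻¹'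
        {π | (fun i => (π i).restrict n) = y} =
      {π | (fun i => (π i).restrict n) = fun i : Fin (m + 1) => y i.castSucc} ×ˢ
        {π | π.restrict n = y (Fin.last _)} := by
    ext q
    simp only [Set.mem_preimage, Set.mem_ofPred_eq, Set.mem_prod, funext_iff]
    rw [Fin.forall_fin_succ']
    simp
  rw [Measure.map_apply measurable_finSnoc (hms y), hset,
    Measure.compProd_apply_prod (hms _) (measurableSet_restrict_eq _)]
  have hker : ∀ π ∈ {π : Fin (m + 1) → BoundedPartition ℕ k |
      (fun i => (π i).restrict n) = fun i : Fin (m + 1) => y i.castSucc},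
      lastKernel (poissonizedKernel (partitionKernel ν)
        (lam * (t (Fin.last _) - t (Fin.last m).castSucc))) π
        {π | π.restrict n = y (Fin.last _)} =
      ENNReal.ofReal (NormedSpace.exp (((t (Fin.last m).succ : ℝ) - (t (Fin.last m).castSucc : ℝ)) •
            generatorMatrix lam ν n) (y (Fin.last m).castSucc) (y (Fin.last m).succ)) := by
    intro π hπ
    rw [lastKernel, Kernel.comap_apply, poissonizedKernel_restrict, generatorMatrix_eq, smul_smul,
      NNReal.coe_mul, NNReal.coe_sub (ht (Fin.le_last _)), mul_comm, Fin.succ_last,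
      show (π (Fin.last m)).restrict n = y (Fin.last m).castSucc from congrFun hπ (Fin.last m)]
  rw [setLIntegral_congr_fun (hms _) hker, setLIntegral_const, hprob t ht,
    hprob (fun i : Fin (m + 1) => t i.castSucc)
      (fun i j hij => ht (Fin.castSucc_le_castSucc_iff.2 hij)), Fin.prod_univ_castSucc, ← mul_assoc,
    ENNReal.ofReal_mul, mul_comm]
  · rfl
  · have := hB.markov n m (fun i : Fin (m + 1) => t i.castSucc)
      (fun i j hij => ht (Fin.castSucc_le_castSucc_iff.2 hij)) fun i => y i.castSucc
    exact (measureReal_nonneg).trans_eq this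

end PartitionProcess

/-! ### Paths with few changes along dyadic grids -/

section Dyadic

/-- The dyadic number `a / 2^r`. -/
noncomputable def dyadic (r a : ℕ) : ℝ≥0 := a / 2 ^ r

theorem dyadic_lt_dyadic {r a b : ℕ} : dyadic r a < dyadic r b ↔ a < b := by
  unfold dyadic
  rw [div_lt_div_iff_of_pos_right (by positivity)]
  exact_mod_cast Iff.rfl

theorem exists_dyadic_eq_of_le {r s : ℕ} (h : r ≤ s) (a : ℕ) : ∃ b, dyadic s b = dyadic r a := by
  refine ⟨a * 2 ^ (s - r), ?_⟩
  unfold dyadic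
  obtain ⟨d, rfl⟩ := Nat.exists_eq_add_of_le h
  push_cast
  rw [Nat.add_sub_cancel_left, pow_add]
  field_simp

open Classical in
/-- The number of changes of a path along the dyadic grid of level `r` in `[0, N]`. -/
noncomputable def dyadicChanges {S : Type*} (b : ℝ≥0 → S) (N r : ℕ) : ℕ :=
  ((Finset.range (N * 2 ^ r)).filter fun i => b (dyadic r i) ≠ b (dyadic r (i + 1))).card

theorem exists_change {S : Type*} {f : ℕ → S} {m n : ℕ} (hmn : m ≤ n) (h : f m ≠ f n) :
    ∃ i, m ≤ i ∧ i < n ∧ f i ≠ f (i + 1) := by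
  by_contra! hc
  refine h ?_
  induction n, hmn using Nat.le_induction with
  | base => rfl
  | succ n hmn ih =>
    by_cases hfn : f m = f n
    · rw [hfn]; exact hc n hmn (Nat.lt_succ_self n)
    · exact absurd (ih hfn fun i h1 h2 => hc i h1 (h2.trans (Nat.lt_succ_self n))) hfn

/-- If the number of changes is bounded along infinitely many dyadic grids, then the path is
constant along the dyadic numbers in some interval to the right of each time. -/
theorem exists_dyadic_const {S : Type*} {b : ℝ≥0 → S} {N K : ℕ}
    (h : ∃ᶠ r in atTop, dyadicChanges b N r ≤ K) {t : ℝ≥0} (ht : t < N) :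
    ∃ r a, t < dyadic r a ∧ ∀ s c, t < dyadic s c → dyadic s c ≤ dyadic r a →
      b (dyadic s c) = b (dyadic r a) := by
  classical
  by_contra! hc
  let D := {q : ℕ × ℕ // t < dyadic q.1 q.2 ∧ dyadic q.1 q.2 ≤ N}
  have hstep : ∀ q : D, ∃ q' : D, dyadic q'.1.1 q'.1.2 ≤ dyadic q.1.1 q.1.2 ∧
      b (dyadic q'.1.1 q'.1.2) ≠ b (dyadic q.1.1 q.1.2) := by
    rintro ⟨⟨r, a⟩, h1, h2⟩
    obtain ⟨s, c, h3, h4, h5⟩ := hc r a h1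
    exact ⟨⟨⟨s, c⟩, h3, h4.trans h2⟩, h4, h5⟩
  choose f hf1 hf2 using hstep
  -- If the claim fails, iterating `f` from time `N` yields dyadic times that decrease within (t, N]
  -- and at which consecutive values differ.
  let q0 : D := ⟨⟨0, N⟩, by simpa [dyadic] using ht, by simp [dyadic]⟩
  let q : ℕ → D := fun j => f^[j] q0
  have hq : ∀ j, q (j + 1) = f (q j) := fun j => Function.iterate_succ_apply' f j q0
  -- Finitely many dyadic times lie on one common grid. The first `K + 2` of them leave `K + 1`
  -- disjoint gaps, each containing a change along the grid, against the bound `K`.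
  obtain ⟨r0, hr0⟩ : ∃ r0, ∀ j ≤ K + 1, (q j).1.1 ≤ r0 :=
    ⟨∑ j ∈ Finset.range (K + 2), (q j).1.1, fun j hj =>
      Finset.single_le_sum (f := fun j => (q j).1.1) (fun _ _ => Nat.zero_le _)
        (Finset.mem_range.2 (by omega))⟩
  obtain ⟨r, hr, hrK⟩ := (frequently_atTop.1 h) r0
  have hex : ∀ j, ∃ a, j ≤ K + 1 → dyadic r a = dyadic (q j).1.1 (q j).1.2 := by
    intro j
    by_cases hj : j ≤ K + 1
    · obtain ⟨a, ha⟩ := exists_dyadic_eq_of_le ((hr0 j hj).trans hr) (q j).1.2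
      exact ⟨a, fun _ => ha⟩
    · exact ⟨0, fun h => absurd h hj⟩
  choose a ha using hex
  have hle : ∀ j, j ≤ K → a (j + 1) ≤ a j := by
    intro j hj
    by_contra! hlt
    have h1 := dyadic_lt_dyadic (r := r).2 hlt
    rw [ha j (by omega), ha (j + 1) (by omega), hq] at h1
    exact absurd (hf1 (q j)) (not_le.2 h1)
  have hch : ∀ j, ∃ i, j ≤ K → a (j + 1) ≤ i ∧ i < a j ∧ b (dyadic r i) ≠ b (dyadic r (i + 1)) := by
    intro j
    by_cases hj : j ≤ K
    · have hne : b (dyadic r (a (j + 1))) ≠ b (dyadic r (a j)) := by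
        rw [ha j (by omega), ha (j + 1) (by omega), hq]
        exact hf2 (q j)
      obtain ⟨i, hi⟩ := exists_change (f := fun i => b (dyadic r i)) (hle j hj) hne
      exact ⟨i, fun _ => hi⟩
    · exact ⟨0, fun h => absurd h hj⟩
  choose i hi using hch
  have haN : ∀ j ≤ K, a j ≤ N * 2 ^ r := by
    intro j hj
    by_contra! hlt
    have h1 := dyadic_lt_dyadic (r := r).2 hlt
    rw [ha j (by omega)] at h1
    refine absurd (q j).2.2 (not_le.2 (lt_of_eq_of_lt ?_ h1))
    simp [dyadic]
  have hanti : ∀ j l, j < l → l ≤ K → i l < i j := by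
    intro j l hjl hl
    have h1 : a l ≤ a (j + 1) := by
      induction l, Nat.succ_le_of_lt hjl using Nat.le_induction with
      | base => exact le_rfl
      | succ l hjl' ih => exact (hle l (by omega)).trans (ih (by omega) (by omega))
    exact lt_of_lt_of_le (hi l hl).2.1 (h1.trans (hi j (by omega)).1)
  have hcard : K + 1 ≤ dyadicChanges b N r := by
    rw [← Finset.card_range (K + 1)]
    refine Finset.card_le_card_of_injOn i ?_ ?_
    · intro j hj
      have hj' : j ≤ K := by
        have := Finset.mem_range.1 (Finset.mem_coe.1 hj)
        omega
      simp only [Finset.coe_filter, Set.mem_ofPred_eq, Finset.mem_range]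
      exact ⟨(hi j hj').2.1.trans_le (haN j hj'), (hi j hj').2.2⟩
    · intro j hj l hl hjl
      have hj' := Finset.mem_range.1 (Finset.mem_coe.1 hj)
      have hl' := Finset.mem_range.1 (Finset.mem_coe.1 hl)
      rcases lt_trichotomy j l with h1 | h1 | h1
      · exact absurd hjl (hanti j l h1 (by omega)).ne'
      · exact h1
      · exact absurd hjl (hanti l j h1 (by omega)).ne
  omega

theorem exists_dyadic_tendsto (t : ℝ≥0) :
    ∃ a : ℕ → ℕ, (∀ r, t < dyadic r (a r)) ∧
      Tendsto (fun r => dyadic r (a r)) atTop (𝓝[>] t) := by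
  have hlt : ∀ r : ℕ, t < dyadic r (⌊t * 2 ^ r⌋₊ + 1) := by
    intro r
    rw [dyadic, lt_div_iff₀ (by positivity)]
    exact_mod_cast Nat.lt_floor_add_one (t * 2 ^ r)
  refine ⟨fun r => ⌊t * 2 ^ r⌋₊ + 1, hlt, tendsto_nhdsWithin_iff.2 ⟨?_, Eventually.of_forall hlt⟩⟩
  have h1 : Tendsto (fun r : ℕ => t + (1 / 2 : ℝ≥0) ^ r) atTop (𝓝 (t + 0)) :=
    tendsto_const_nhds.add (tendsto_pow_atTop_nhds_zero_of_lt_one zero_le (by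
      rw [div_lt_one (by norm_num)]; norm_num))
  rw [add_zero] at h1
  refine tendsto_of_tendsto_of_tendsto_of_le_of_le tendsto_const_nhds h1 (fun r => (hlt r).le)
    fun r => ?_
  simp only [dyadic]
  rw [div_le_iff₀ (by positivity), add_mul, ← mul_pow]
  push_cast
  have := Nat.floor_le (zero_le (a := t * 2 ^ r))
  gcongr
  norm_num

end Dyadic

/-! ### All frequencies exist simultaneously -/

section Frequencies

variable {k : ℕ} {ν : Measure (RankedSimplex k)} [IsProbabilityMeasure ν] {Ω : Type*}
  [MeasurableSpace Ω] {P : Measure Ω} [IsProbabilityMeasure P] {lam : ℝ≥0}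
  {B : ℝ≥0 → Ω → BoundedPartition ℕ k}

/-- At one fixed time only: the initial partition has frequencies by exchangeability, and the
transition kernel preserves them. -/
theorem IsPaintboxMarkovProcess.ae_hasFrequencies (hB : IsPaintboxMarkovProcess P lam ν B)
    (hB0 : IsExchangeablePartition P (B 0)) (t : ℝ≥0) : ∀ᵐ ω ∂P, (B t ω).HasFrequencies := by
  have h0 := hB0.ae_hasFrequencies (hB.measurable 0)
  have hF := BoundedPartition.measurableSet_hasFrequencies (k := k)
  have ht := hB.hasTransition 0 ![0, t] (by
    intro i j hij
    fin_cases i <;> fin_cases j <;> simp_all)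
  have hm : Measurable fun ω (i : Fin 2) => B (![0, t] i) ω :=
    measurable_pi_lambda _ fun i => hB.measurable _
  have hm0 : Measurable fun ω (i : Fin 1) => B (![0, t] i.castSucc) ω :=
    measurable_pi_lambda _ fun i => hB.measurable _
  have : IsProbabilityMeasure (P.map fun ω (i : Fin 1) => B (![0, t] i.castSucc) ω) :=
    Measure.isProbabilityMeasure_map hm0.aemeasurable
  have hS : ∀ {l : ℕ} (i : Fin l),
      MeasurableSet {y : Fin l → BoundedPartition ℕ k | (y i).HasFrequencies} :=
    fun i => hF.preimage (measurable_pi_apply i)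
  have h1 : ∀ᵐ y ∂P.map (fun ω (i : Fin 1) => B (![0, t] i.castSucc) ω), (y 0).HasFrequencies :=
    (ae_map_iff hm0.aemeasurable (hS 0)).2 h0
  have key : ∀ᵐ y ∂P.map (fun ω (i : Fin 2) => B (![0, t] i) ω), (y 1).HasFrequencies := by
    refine ht ▸ ?_
    refine (ae_map_iff measurable_finSnoc.aemeasurable (hS 1)).2 ?_
    refine Measure.ae_compProd_of_ae_ae (measurable_finSnoc (hS 1)) ?_
    filter_upwards [h1] with y hy
    exact ae_poissonizedKernel_mem hF (fun _ hπ => ae_partitionKernel_hasFrequencies ν hπ) _ hy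
  exact (ae_map_iff hm.aemeasurable (hS 1)).1 key

theorem measurableSet_eq_partition {α : Type*} [MeasurableSpace α]
    {f g : α → BoundedPartition ℕ k} (hf : Measurable f) (hg : Measurable g) :
    MeasurableSet {x | f x = g x} := by
  have : {x | f x = g x} = ⋂ i, ⋂ j, {x | (f x).1 i j ↔ (g x).1 i j} := by
    ext x
    simp only [Set.mem_iInter, Set.mem_ofPred_eq]
    exact ⟨fun h i j => h ▸ Iff.rfl, fun h => BoundedPartition.ext_rel h⟩
  rw [this]
  refine MeasurableSet.iInter fun i => MeasurableSet.iInter fun j => ?_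
  have h1 := hf (BoundedPartition.measurableSet_rel i j)
  have h2 := hg (BoundedPartition.measurableSet_rel i j)
  have h3 : {x | (f x).1 i j ↔ (g x).1 i j} =
      ((f ⁻¹' {π | π.1 i j}) ∩ (g ⁻¹' {π | π.1 i j})) ∪
        ((f ⁻¹' {π | π.1 i j})ᶜ ∩ (g ⁻¹' {π | π.1 i j})ᶜ) := by
    ext x
    exact iff_iff_and_or_not_and_not
  rw [h3]
  exact (h1.inter h2).union (h1.compl.inter h2.compl)

/-- The Poisson clock does not ring during the time span with probability exp(-lam (t - s)), and
then nothing moves. This controls the entire partition at once, uniformly over restrictions. -/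
theorem IsPaintboxMarkovProcess.measure_ne_le (hB : IsPaintboxMarkovProcess P lam ν B)
    {s t : ℝ≥0} (hst : s ≤ t) : P {ω | B s ω ≠ B t ω} ≤ lam * (t - s : ℝ≥0) := by
  have ht := hB.hasTransition 0 ![s, t] (by
    intro i j hij
    fin_cases i <;> fin_cases j <;> simp_all)
  have hm : Measurable fun ω (i : Fin 2) => B (![s, t] i) ω :=
    measurable_pi_lambda _ fun i => hB.measurable _
  have hm0 : Measurable fun ω (i : Fin 1) => B (![s, t] i.castSucc) ω :=
    measurable_pi_lambda _ fun i => hB.measurable _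
  have : IsProbabilityMeasure (P.map fun ω (i : Fin 1) => B (![s, t] i.castSucc) ω) :=
    Measure.isProbabilityMeasure_map hm0.aemeasurable
  set r := lam * (t - s) with hr
  have hD : MeasurableSet {y : Fin 2 → BoundedPartition ℕ k | y 0 = y 1} :=
    measurableSet_eq_partition (measurable_pi_apply 0) (measurable_pi_apply 1)
  have h1 : P {ω | B s ω = B t ω} =
      P.map (fun ω (i : Fin 2) => B (![s, t] i) ω) {y | y 0 = y 1} := by
    rw [Measure.map_apply hm hD]
    rfl
  have h2 : ENNReal.ofReal (Real.exp (-r)) ≤ P {ω | B s ω = B t ω} := by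
    rw [h1, ht, Measure.map_apply measurable_finSnoc hD,
      Measure.compProd_apply (measurable_finSnoc hD)]
    calc ENNReal.ofReal (Real.exp (-r))
        = ∫⁻ _, ENNReal.ofReal (Real.exp (-r))
            ∂(P.map fun ω (i : Fin 1) => B (![s, t] i.castSucc) ω) := by simp
      _ ≤ _ := by
        refine lintegral_mono fun y => ?_
        have h3 : Prod.mk y ⁻¹' ((fun q : (Fin 1 → BoundedPartition ℕ k) × BoundedPartition ℕ k =>
            (Fin.snoc q.1 q.2 : Fin 2 → BoundedPartition ℕ k)) ⁻¹' {y | y 0 = y 1}) = {y 0} := by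
          ext π
          exact eq_comm
        change _ ≤ lastKernel (poissonizedKernel (partitionKernel ν) r) y _
        rw [h3, lastKernel, Kernel.comap_apply,
          poissonizedKernel_apply' _ _ _ (measurableSet_singleton _)]
        refine le_trans ?_ (ENNReal.le_tsum 0)
        rw [kernelPow, Kernel.id_apply, Measure.dirac_apply' _ (measurableSet_singleton _),
          poissonMeasure_singleton]
        simp
  have h4 : P {ω | B s ω ≠ B t ω} = 1 - P {ω | B s ω = B t ω} :=
    prob_compl_eq_one_sub (measurableSet_eq_partition (hB.measurable s) (hB.measurable t))
  have h5 : 1 - Real.exp (-r) ≤ r := by linarith [Real.add_one_le_exp (-(r : ℝ))]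
  calc P {ω | B s ω ≠ B t ω} ≤ 1 - ENNReal.ofReal (Real.exp (-r)) := by
        rw [h4]; exact tsub_le_tsub_left h2 1
    _ = ENNReal.ofReal (1 - Real.exp (-r)) := by
        rw [ENNReal.ofReal_sub _ (Real.exp_nonneg _), ENNReal.ofReal_one]
    _ ≤ ENNReal.ofReal r := ENNReal.ofReal_le_ofReal h5
    _ = lam * (t - s : ℝ≥0) := by rw [ENNReal.ofReal_coe_nnreal, hr, ENNReal.coe_mul]

omit [MeasurableSpace Ω] in
theorem dyadicChanges_eq_sum (B : ℝ≥0 → Ω → BoundedPartition ℕ k) (N r : ℕ) (ω : Ω) :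
    (dyadicChanges (fun t => B t ω) N r : ℝ≥0∞) =
      ∑ i ∈ Finset.range (N * 2 ^ r),
        {ω | B (dyadic r i) ω ≠ B (dyadic r (i + 1)) ω}.indicator (1 : Ω → ℝ≥0∞) ω := by
  classical
  rw [dyadicChanges, Finset.card_filter]
  push_cast
  refine Finset.sum_congr rfl fun i _ => ?_
  simp [Set.indicator]

/-- The `N * 2 ^ r` grid steps each cost at most `lam / 2 ^ r`, so the bound does not depend on the
mesh. -/
theorem IsPaintboxMarkovProcess.lintegral_dyadicChanges_le (hB : IsPaintboxMarkovProcess P lam ν B)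
    (N r : ℕ) : ∫⁻ ω, (dyadicChanges (fun t => B t ω) N r : ℝ≥0∞) ∂P ≤ N * lam := by
  have hms : ∀ s t, MeasurableSet {ω | B s ω ≠ B t ω} := fun s t =>
    (measurableSet_eq_partition (hB.measurable s) (hB.measurable t)).compl
  simp_rw [dyadicChanges_eq_sum]
  rw [lintegral_finsetSum _ fun i _ => measurable_one.indicator (hms _ _)]
  have hstep : ∀ i, dyadic r (i + 1) - dyadic r i = 1 / 2 ^ r := by
    intro i
    unfold dyadic
    rw [← NNReal.sub_div]
    push_cast
    rw [add_tsub_cancel_left]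
  calc _ ≤ ∑ i ∈ Finset.range (N * 2 ^ r), (lam : ℝ≥0∞) * ((1 / 2 ^ r : ℝ≥0) : ℝ≥0∞) := by
        refine Finset.sum_le_sum fun i _ => ?_
        rw [lintegral_indicator_one (hms _ _), ← hstep i]
        exact hB.measure_ne_le (dyadic_lt_dyadic.2 (Nat.lt_succ_self i)).le
    _ = ((N * 2 ^ r * (lam * (1 / 2 ^ r)) : ℝ≥0) : ℝ≥0∞) := by
        rw [Finset.sum_const, Finset.card_range, nsmul_eq_mul]
        push_cast
        rfl
    _ = N * lam := by
        have : (N : ℝ≥0) * 2 ^ r * (lam * (1 / 2 ^ r)) = N * lam := by field_simp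
        rw [this]
        push_cast
        rfl

/-- Almost surely, all the partitions visited have asymptotic frequencies. -/
theorem IsPaintboxMarkovProcess.ae_forall_hasFrequencies (hB : IsPaintboxMarkovProcess P lam ν B)
    (hB0 : IsExchangeablePartition P (B 0)) : ∀ᵐ ω ∂P, ∀ t, (B t ω).HasFrequencies := by
  have h1 : ∀ᵐ ω ∂P, ∀ r a, (B (dyadic r a) ω).HasFrequencies :=
    ae_all_iff.2 fun r => ae_all_iff.2 fun a => hB.ae_hasFrequencies hB0 _
  have hm : ∀ N r, Measurable fun ω => (dyadicChanges (fun t => B t ω) N r : ℝ≥0∞) := by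
    intro N r
    simp_rw [dyadicChanges_eq_sum]
    exact Finset.measurable_sum _ fun i _ => measurable_one.indicator
      (measurableSet_eq_partition (hB.measurable _) (hB.measurable _)).compl
  have h2 : ∀ᵐ ω ∂P, ∀ N : ℕ, ∃ K : ℕ, ∃ᶠ r in atTop, dyadicChanges (fun t => B t ω) N r ≤ K := by
    refine ae_all_iff.2 fun N => ?_
    -- Fatou's lemma turns the uniform bound on expectations into an almost surely finite liminf,
    -- hence a bounded number of changes along infinitely many grids.
    have hfin : ∫⁻ ω, liminf (fun r => (dyadicChanges (fun t => B t ω) N r : ℝ≥0∞)) atTop ∂P ≠ ∞ := by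
      refine ne_top_of_le_ne_top (b := (N : ℝ≥0∞) * lam)
        (ENNReal.mul_ne_top (ENNReal.natCast_ne_top _) ENNReal.coe_ne_top) ?_
      refine (lintegral_liminf_le (hm N)).trans ?_
      refine (liminf_le_liminf (Eventually.of_forall fun r =>
        hB.lintegral_dyadicChanges_le N r)).trans ?_
      simp
    filter_upwards [ae_lt_top (Measurable.liminf (hm N)) hfin] with ω hω
    obtain ⟨K, hK⟩ := ENNReal.exists_nat_gt hω.ne
    refine ⟨K, (frequently_lt_of_liminf_lt (by isBoundedDefault) hK).mono fun r hr => ?_⟩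
    exact_mod_cast hr.le
  filter_upwards [h1, h2, hB.cadlag] with ω hω1 hω2 hω3 t
  obtain ⟨N, hN⟩ := exists_nat_gt t
  obtain ⟨K, hK⟩ := hω2 N
  obtain ⟨r, a, hta, hconst⟩ := exists_dyadic_const hK hN
  suffices h : B t ω = B (dyadic r a) ω from h ▸ hω1 r a
  -- Dyadic times decreasing to `t` see the constant partition, while each restriction converges to
  -- its value at `t`.
  refine BoundedPartition.eq_of_forall_restrict_eq fun n => ?_
  obtain ⟨c, hc1, hc2⟩ := exists_dyadic_tendsto t
  have h4 := hc2.eventually (hω3 n t).1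
  have h5 := hc2.eventually (mem_nhdsWithin_of_mem_nhds (Iic_mem_nhds hta))
  obtain ⟨s, hs1, hs2⟩ := (h4.and h5).exists
  exact hs1.symm.trans (congrArg _ (hconst s (c s) (hc1 s) hs2))

theorem IsPaintboxMarkovProcess.hasTransition_rankedFreq (hB : IsPaintboxMarkovProcess P lam ν B)
    (hB0 : IsExchangeablePartition P (B 0)) :
    HasTransition P (fun t ω => (B t ω).rankedFreq)
      fun u => poissonizedKernel (massKernel ν) (lam * u) :=
  hB.hasTransition.map hB.measurable BoundedPartition.measurable_rankedFreq
    (hB.ae_hasFrequencies hB0) BoundedPartition.measurableSet_hasFrequencies fun _ _ hπ =>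
      poissonizedKernel_map BoundedPartition.measurable_rankedFreq
        BoundedPartition.measurableSet_hasFrequencies
        (fun _ hπ => ae_partitionKernel_hasFrequencies ν hπ)
        (fun _ hπ => partitionKernel_map_rankedFreq ν hπ) _ hπ

end Frequencies

/-! ### Chains driven by i.i.d. marks -/

section DrivenChain

variable {M V E : Type*} [MeasurableSpace M] [MeasurableSpace V] [MeasurableSpace E]
  (μ : Measure M) [IsProbabilityMeasure μ]

theorem measurable_update_prod (n : ℕ) :
    Measurable fun q : (ℕ → M) × M => Function.update q.1 n q.2 := by
  refine measurable_pi_lambda _ fun i => ?_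
  by_cases h : i = n
  · subst h; simpa using measurable_snd
  · simp only [Function.update_of_ne h]
    exact (measurable_pi_apply i).comp measurable_fst

/-- Resampling one coordinate of an i.i.d. sequence leaves its law unchanged. This is how the
independence of the next mark from the earlier ones enters. -/
theorem infinitePi_prod_map_update (n : ℕ) :
    ((Measure.infinitePi fun _ : ℕ => μ).prod μ).map (fun q => Function.update q.1 n q.2) =
      Measure.infinitePi fun _ => μ := by
  classical
  refine Measure.eq_infinitePi _ fun s t ht => ?_
  rw [Measure.map_apply (measurable_update_prod n)
    (MeasurableSet.pi s.countable_toSet fun i _ => ht i)]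
  have h : (fun q : (ℕ → M) × M => Function.update q.1 n q.2) ⁻¹' (s : Set ℕ).pi t =
      ((s.erase n : Finset ℕ) : Set ℕ).pi t ×ˢ (if n ∈ s then t n else Set.univ) := by
    ext ⟨m, q⟩
    simp only [Set.mem_preimage, Set.mem_pi, Finset.mem_coe, Set.mem_prod, Finset.mem_erase]
    constructor
    · intro h
      refine ⟨fun i hi => by simpa [Function.update_of_ne hi.1] using h i hi.2, ?_⟩
      split_ifs with hn
      · simpa using h n hn
      · trivial
    · rintro ⟨h1, h2⟩ i hi
      by_cases hin : i = n
      · subst hin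
        rw [if_pos hi] at h2
        simpa using h2
      · simpa [Function.update_of_ne hin] using h1 i ⟨hin, hi⟩
  rw [h, Measure.prod_prod, Measure.infinitePi_pi _ fun i _ => ht i]
  split_ifs with hn
  · rw [Finset.prod_erase_mul s (fun i => μ (t i)) hn]
  · rw [Finset.erase_eq_of_notMem hn, measure_univ, mul_one]

/-- The chain started at `z` which moves by `f` and the marks `m 0, m 1, …`. -/
def drivenChain (f : V → M → V) (z : V) (m : ℕ → M) : ℕ → V
  | 0 => z
  | n + 1 => f (drivenChain f z m n) (m n)

variable {f : V → M → V} (hf : Measurable (Function.uncurry f)) (z : V)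

omit [MeasurableSpace M] [MeasurableSpace V] in
theorem drivenChain_update (m : ℕ → M) {n i : ℕ} (h : n ≤ i) (q : M) :
    drivenChain f z (Function.update m i q) n = drivenChain f z m n := by
  induction n with
  | zero => rfl
  | succ n ih =>
    rw [drivenChain, drivenChain, ih (by omega), Function.update_of_ne (by omega)]

include hf in
theorem measurable_drivenChain (n : ℕ) :
    Measurable fun q : V × (ℕ → M) => drivenChain f q.1 q.2 n := by
  induction n with
  | zero => exact measurable_fst
  | succ n ih => exact hf.comp (ih.prodMk ((measurable_pi_apply n).comp measurable_snd))

theorem lintegral_infinitePi_update {ψ : (ℕ → M) → E} (hψ : Measurable ψ) {n : ℕ}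
    (hψn : ∀ m q, ψ (Function.update m n q) = ψ m) {g : E × M → ℝ≥0∞} (hg : Measurable g) :
    ∫⁻ m, g (ψ m, m n) ∂(Measure.infinitePi fun _ : ℕ => μ) =
      ∫⁻ m, ∫⁻ q, g (ψ m, q) ∂μ ∂(Measure.infinitePi fun _ : ℕ => μ) := by
  have hm : Measurable fun m : ℕ → M => g (ψ m, m n) :=
    hg.comp (hψ.prodMk (measurable_pi_apply n))
  conv_lhs => rw [← infinitePi_prod_map_update μ n]
  have hm2 : Measurable fun a : (ℕ → M) × M => g (ψ (Function.update a.1 n a.2),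
      Function.update a.1 n a.2 n) := hm.comp (measurable_update_prod n)
  rw [lintegral_map hm (measurable_update_prod n), lintegral_prod _ hm2.aemeasurable]
  simp only [hψn, Function.update_self]

/-- The Markov property of the chain. -/
theorem lintegral_drivenChain {n : ℕ} {φ : (ℕ → M) → E} (hφ : Measurable φ)
    (hφn : ∀ m i q, n ≤ i → φ (Function.update m i q) = φ m) (j : ℕ) {h : E × V → ℝ≥0∞}
    (hh : Measurable h) :
    ∫⁻ m, h (φ m, drivenChain f z m (n + j)) ∂(Measure.infinitePi fun _ : ℕ => μ) =
      ∫⁻ m, ∫⁻ y, h (φ m, y) ∂kernelPow (randomMapKernel μ f hf) j (drivenChain f z m n)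
        ∂(Measure.infinitePi fun _ : ℕ => μ) := by
  have hZ : ∀ n, Measurable fun m => drivenChain f z m n := fun n =>
    (measurable_drivenChain hf n).comp measurable_prodMk_left
  induction j generalizing h with
  | zero =>
    refine lintegral_congr fun m => ?_
    have hm : Measurable fun y => h (φ m, y) := hh.comp measurable_prodMk_left
    rw [kernelPow, Kernel.id_apply, lintegral_dirac' _ hm]
    rfl
  | succ j ih =>
    have hK : Measurable fun p : E × V => ∫⁻ y, h (p.1, y) ∂randomMapKernel μ f hf p.2 := by
      have h1 : Measurable fun w : (E × V) × V => h (w.1.1, w.2) :=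
        hh.comp ((measurable_fst.comp measurable_fst).prodMk measurable_snd)
      exact Measurable.lintegral_kernel_prod_right'
        (κ := (randomMapKernel μ f hf).comap Prod.snd measurable_snd) h1
    have e1 : ∀ m, h (φ m, drivenChain f z m (n + (j + 1))) =
        (fun w : (E × V) × M => h (w.1.1, f w.1.2 w.2))
          ((φ m, drivenChain f z m (n + j)), m (n + j)) := fun m => rfl
    have hg : Measurable fun w : (E × V) × M => h (w.1.1, f w.1.2 w.2) :=
      hh.comp ((measurable_fst.comp measurable_fst).prodMk
        (hf.comp ((measurable_snd.comp measurable_fst).prodMk measurable_snd)))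
    simp_rw [e1]
    rw [lintegral_infinitePi_update μ (ψ := fun m => (φ m, drivenChain f z m (n + j)))
      (hφ.prodMk (hZ _)) (fun m q => by
        simp only [hφn m (n + j) q (by omega), drivenChain_update z m le_rfl q]) hg]
    have e2 : ∀ m, ∫⁻ q, h (φ m, f (drivenChain f z m (n + j)) q) ∂μ =
        (fun p : E × V => ∫⁻ y, h (p.1, y) ∂randomMapKernel μ f hf p.2)
          (φ m, drivenChain f z m (n + j)) := by
      intro m
      have h1 : Measurable fun y => h (φ m, y) := hh.comp measurable_prodMk_left
      have h2 : Measurable (f (drivenChain f z m (n + j))) := hf.comp measurable_prodMk_left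
      simp only [randomMapKernel_apply]
      rw [lintegral_map h1 h2]
    simp only [e2]
    rw [ih hK]
    refine lintegral_congr fun m => ?_
    have h1 : Measurable fun y => h (φ m, y) := hh.comp measurable_prodMk_left
    rw [kernelPow, Kernel.lintegral_comp _ _ _ h1]

end DrivenChain

/-! ### Poisson point processes listed in increasing order of time -/

section Separated

/-- The part of the time axis up to the last of the intervals `[a j, b j)` which they do not
cover. -/
def uncovered {J : ℕ} (a b : Fin J → ℝ≥0) : Set ℝ≥0 :=
  {x | (∃ j, x < b j) ∧ ∀ j, x ∉ Set.Ico (a j) (b j)}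

theorem measurableSet_uncovered {J : ℕ} (a b : Fin J → ℝ≥0) : MeasurableSet (uncovered a b) := by
  have : uncovered a b = (⋃ j, Set.Iio (b j)) ∩ ⋂ j, (Set.Ico (a j) (b j))ᶜ := by
    ext x; simp [uncovered]
  rw [this]
  exact (MeasurableSet.iUnion fun j => measurableSet_Iio).inter
    (MeasurableSet.iInter fun j => measurableSet_Ico.compl)

/-- The first points lie one by one in ordered intervals iff each interval contains exactly one
point and there are no points in between. -/
theorem separated_iff {Y : Type*} {t : ℕ → ℝ≥0} (ht : StrictMono t) (y : ℕ → Y) {J : ℕ}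
    {a b : Fin J → ℝ≥0} (hab : ∀ i j, i < j → b i ≤ a j) (A : Fin J → Set Y) :
    ({m | t m ∈ uncovered a b}.encard = 0 ∧
      ∀ j, {m | t m ∈ Set.Ico (a j) (b j) ∧ y m ∈ A j}.encard = 1 ∧
        {m | t m ∈ Set.Ico (a j) (b j) ∧ y m ∈ (A j)ᶜ}.encard = 0) ↔
    ∀ j : Fin J, t j ∈ Set.Ico (a j) (b j) ∧ b j ≤ t J ∧ y j ∈ A j := by
  have hdisj : ∀ {x : ℝ≥0} {i j : Fin J}, x ∈ Set.Ico (a i) (b i) → x ∈ Set.Ico (a j) (b j) →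
      i = j := by
    intro x i j hi hj
    rcases lt_trichotomy i j with h | h | h
    · exact absurd (hi.2.trans_le (hab i j h)) (not_lt.2 hj.1)
    · exact h
    · exact absurd (hj.2.trans_le (hab j i h)) (not_lt.2 hi.1)
  simp only [Set.encard_eq_zero, Set.eq_empty_iff_forall_notMem, Set.mem_ofPred_eq,
    Set.encard_eq_one, Set.mem_compl_iff, not_and, not_not]
  constructor
  · rintro ⟨hU, h⟩
    have huniq : ∀ j, ∃ m, ∀ m', t m' ∈ Set.Ico (a j) (b j) ↔ m' = m := by
      intro j
      obtain ⟨⟨m, hm⟩, h2⟩ := h j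
      refine ⟨m, fun m' => ⟨fun h3 => ?_, ?_⟩⟩
      · have : m' ∈ {m | t m ∈ Set.Ico (a j) (b j) ∧ y m ∈ A j} := ⟨h3, h2 m' h3⟩
        rw [hm] at this
        exact this
      · rintro rfl
        have : m' ∈ {m | t m ∈ Set.Ico (a j) (b j) ∧ y m ∈ A j} := by rw [hm]; rfl
        exact this.1
    have hcov : ∀ m j, t m < b j → ∃ i, t m ∈ Set.Ico (a i) (b i) := by
      intro m j hm
      by_contra! hc
      exact hU m ⟨⟨j, hm⟩, hc⟩
    -- Strong induction: earlier intervals already hold their only point, and the `n`-th point comes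
    -- no later than the point of interval `n`. No point is uncovered, so it must lie in that
    -- interval.
    have key : ∀ n, ∀ hn : n < J, t n ∈ Set.Ico (a ⟨n, hn⟩) (b ⟨n, hn⟩) := by
      intro n
      induction n using Nat.strong_induction_on with
      | _ n ih =>
        intro hn
        obtain ⟨m, hm⟩ := huniq ⟨n, hn⟩
        have hmI := (hm m).2 rfl
        have hnm : n ≤ m := by
          by_contra! hlt
          have := hdisj (ih m hlt (hlt.trans hn)) hmI
          rw [Fin.mk.injEq] at this
          omega
        obtain ⟨i, hi⟩ := hcov n ⟨n, hn⟩ ((ht.monotone hnm).trans_lt hmI.2)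
        rcases lt_trichotomy i ⟨n, hn⟩ with hlt | heq | hlt
        · obtain ⟨m', hm'⟩ := huniq i
          have h1 := (hm' i).1 (ih i hlt i.2)
          have h2 := (hm' n).1 hi
          have : (i : ℕ) < n := hlt
          omega
        · rwa [← heq]
        · exact absurd (hmI.2.trans_le (hab _ _ hlt)) (not_lt.2 (hi.1.trans (ht.monotone hnm)))
    intro j
    refine ⟨key j j.2, ?_, (h j).2 j (key j j.2)⟩
    by_contra! hlt
    obtain ⟨i, hi⟩ := hcov J j hlt
    obtain ⟨m', hm'⟩ := huniq i
    have h1 := (hm' i).1 (key i i.2)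
    have h2 := (hm' J).1 hi
    have := i.2
    omega
  · intro h
    have huniq : ∀ j : Fin J, ∀ m, t m ∈ Set.Ico (a j) (b j) → m = j := by
      intro j m hm
      have hmJ : m < J := by
        by_contra! hJm
        exact absurd hm.2 (not_lt.2 ((h j).2.1.trans (ht.monotone hJm)))
      have := hdisj (h ⟨m, hmJ⟩).1 hm
      exact congrArg Fin.val this
    refine ⟨fun m hm => ?_, fun j => ⟨⟨j, ?_⟩, fun m hm => ?_⟩⟩
    · obtain ⟨⟨j, hj⟩, hc⟩ := hm
      have hmJ : m < J := by
        by_contra! hJm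
        exact absurd hj (not_lt.2 ((h j).2.1.trans (ht.monotone hJm)))
      exact hc ⟨m, hmJ⟩ (h ⟨m, hmJ⟩).1
    · ext m
      simp only [Set.mem_ofPred_eq, Set.mem_singleton_iff]
      exact ⟨fun hm => huniq j m hm.1, fun hm => by rw [hm]; exact ⟨(h j).1, (h j).2.2⟩⟩
    · rw [huniq j m hm]
      exact (h j).2.2

end Separated

/-! ### Joint counts of a Poisson point process -/

section PoissonPoint

variable {Ω E : Type*} [MeasurableSpace Ω] [MeasurableSpace E] {P : Measure Ω}
  {N : Ω → Set E} {μ : Measure E}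

theorem IsPoissonPointProcess.iIndepFun_encard (hN : IsPoissonPointProcess P N μ) {ι : Type*}
    [Fintype ι] {A : ι → Set E} (hA : ∀ i, MeasurableSet (A i))
    (hd : Pairwise fun i j => Disjoint (A i) (A j)) :
    iIndepFun (fun i ω => (N ω ∩ A i).encard) P := by
  have e := Fintype.equivFin ι
  have h := hN.indep (Fintype.card ι) (fun i => A (e.symm i)) (fun i => hA _)
    fun i j hij => hd (e.symm.injective.ne hij)
  have h2 := h.precomp e.injective
  simpa using h2

theorem IsPoissonPointProcess.measure_iInter (hN : IsPoissonPointProcess P N μ) {ι : Type*}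
    [Fintype ι] {A : ι → Set E} (hA : ∀ i, MeasurableSet (A i))
    (hd : Pairwise fun i j => Disjoint (A i) (A j)) (c : ι → ℕ) :
    P (⋂ i, {ω | (N ω ∩ A i).encard = c i}) = ∏ i, P {ω | (N ω ∩ A i).encard = c i} := by
  have h := (hN.iIndepFun_encard hA hd).measure_inter_preimage_eq_mul Finset.univ
    (sets := fun i => {(c i : ℕ∞)}) fun i _ => measurableSet_singleton _
  simp only [Finset.mem_univ, Set.iInter_true] at h
  exact h

end PoissonPoint

theorem lebesgueNonneg_apply {S : Set ℝ≥0} (hS : MeasurableSet S) :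
    lebesgueNonneg S = volume ((↑) '' S : Set ℝ) :=
  Measure.comap_apply _ NNReal.coe_injective
    (fun _ hs => (MeasurableEmbedding.subtype_coe measurableSet_Ici).measurableSet_image.2 hs) _ hS

theorem lebesgueNonneg_Ico (a b : ℝ≥0) : lebesgueNonneg (Set.Ico a b) = (b - a : ℝ≥0) := by
  rw [lebesgueNonneg_apply measurableSet_Ico, NNReal.image_coe_Ico, Real.volume_Ico]
  rw [ENNReal.ofReal, NNReal.sub_def]

theorem lebesgueNonneg_Ioc (a b : ℝ≥0) : lebesgueNonneg (Set.Ioc a b) = (b - a : ℝ≥0) := by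
  rw [lebesgueNonneg_apply measurableSet_Ioc, NNReal.image_coe_Ioc, Real.volume_Ioc,
    ENNReal.ofReal, NNReal.sub_def]

theorem lebesgueNonneg_Iic (a : ℝ≥0) : lebesgueNonneg (Set.Iic a) = a := by
  have : ((↑) '' Set.Iic a : Set ℝ) = Set.Icc 0 (a : ℝ) := by
    ext x
    constructor
    · rintro ⟨y, hy, rfl⟩
      exact ⟨y.2, hy⟩
    · rintro ⟨h0, h1⟩
      exact ⟨⟨x, h0⟩, h1, rfl⟩
  rw [lebesgueNonneg_apply measurableSet_Iic, this, Real.volume_Icc, sub_zero,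
    ENNReal.ofReal_coe_nnreal]

section Input

variable {k : ℕ} {Ω : Type*} [MeasurableSpace Ω] {P : Measure Ω} {lam : ℝ≥0}
  {ν : Measure (RankedSimplex k)} [IsProbabilityMeasure ν] {p₀ : Ω → RankedSimplex k}
  {T : ℕ → Ω → ℝ≥0} {M : ℕ → Ω → Fin k → RankedSimplex k}
  {σ : ℕ → Ω → Fin k → Equiv.Perm (Fin k)}

theorem intensity_prod (I : Set ℝ≥0) (C : Set (Fin k → RankedSimplex k)) :
    (lebesgueNonneg.prod (lam • Measure.pi fun _ : Fin k => ν)) (I ×ˢ C) =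
      lebesgueNonneg I * (lam * (Measure.pi fun _ : Fin k => ν) C) := by
  rw [Measure.prod_prod, Measure.smul_apply, ENNReal.smul_def, smul_eq_mul]

theorem encard_range_inter {Y : Type*} {t : ℕ → ℝ≥0} (ht : StrictMono t) (y : ℕ → Y)
    (I : Set ℝ≥0) (C : Set Y) :
    (Set.range (fun m => (t m, y m)) ∩ I ×ˢ C).encard = {m | t m ∈ I ∧ y m ∈ C}.encard := by
  have hinj : Function.Injective fun m => (t m, y m) := fun m n h =>
    ht.injective (congrArg Prod.fst h)
  rw [← hinj.encard_image]
  congr 1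
  ext q
  simp only [Set.mem_inter_iff, Set.mem_range, Set.mem_prod, Set.mem_image, Set.mem_ofPred_eq]
  constructor
  · rintro ⟨⟨m, rfl⟩, h⟩
    exact ⟨m, h, rfl⟩
  · rintro ⟨m, h, rfl⟩
    exact ⟨⟨m, rfl⟩, h⟩

/-- As `C` and its complement have total mass 1, the two exponentials merge and the mark set
survives only through the factor ν^(k)(C). -/
theorem poissonMeasure_one_mul_zero (w : ℝ≥0) (C : Set (Fin k → RankedSimplex k))
    (hC : MeasurableSet C) :
    poissonMeasure ((w : ℝ≥0∞) * (Measure.pi fun _ : Fin k => ν) C).toNNReal {1} *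
        poissonMeasure ((w : ℝ≥0∞) * (Measure.pi fun _ : Fin k => ν) Cᶜ).toNNReal {0} =
      (Measure.pi fun _ : Fin k => ν) C * ENNReal.ofReal (w * Real.exp (-w)) := by
  set μ := Measure.pi fun _ : Fin k => ν
  have h1 : μ.real C + μ.real Cᶜ = 1 := by
    rw [measureReal_add_measureReal_compl hC]; simp
  have e1 : ∀ D, ((((w : ℝ≥0∞) * μ D).toNNReal : ℝ≥0) : ℝ) = w * μ.real D := by
    intro D
    rw [ENNReal.toNNReal_mul, NNReal.coe_mul, ENNReal.toNNReal_coe]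
    rfl
  rw [poissonMeasure_singleton, poissonMeasure_singleton, e1, e1,
    ← ENNReal.ofReal_mul (by positivity),
    ← ofReal_measureReal (μ := μ) (s := C), ← ENNReal.ofReal_mul measureReal_nonneg]
  congr 1
  have e2 : Real.exp (-(w : ℝ)) = Real.exp (-(w * μ.real C)) * Real.exp (-(w * μ.real Cᶜ)) := by
    rw [← Real.exp_add]
    congr 1
    linear_combination -(w : ℝ) * (-h1)
  rw [e2]
  simp only [pow_one, Nat.factorial_one, Nat.cast_one, pow_zero, Nat.factorial_zero]
  ring

/-- By `separated_iff` the event concerns counts in disjoint sets, which are independent. The mark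
sets enter only through the product of their measures, the key to separating marks from times. -/
theorem IsRankedMassInput.measure_separated [IsProbabilityMeasure P]
    (h : IsRankedMassInput P lam ν p₀ T M σ) {J : ℕ}
    {a b : Fin J → ℝ≥0} (hab : ∀ i j, i < j → b i ≤ a j)
    {A : Fin J → Set (Fin k → RankedSimplex k)} (hA : ∀ j, MeasurableSet (A j)) :
    P {ω | ∀ j : Fin J, T j ω ∈ Set.Ico (a j) (b j) ∧ b j ≤ T J ω ∧ M j ω ∈ A j} =
      P {ω | (Set.range (fun m => (T m ω, M m ω)) ∩ uncovered a b ×ˢ Set.univ).encard = 0} *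
        ∏ j, (Measure.pi fun _ : Fin k => ν) (A j) * ENNReal.ofReal
          ((lam * (b j - a j) : ℝ≥0) * Real.exp (-(lam * (b j - a j) : ℝ≥0))) := by
  classical
  set N : Ω → Set (ℝ≥0 × (Fin k → RankedSimplex k)) := fun ω => Set.range fun m => (T m ω, M m ω)
  -- `none` stands for the uncovered times, which carry no point; `(j, true)` and `(j, false)` are
  -- interval `j` with mark in `A j` (one point) or outside it (no point).
  let S : Option (Fin J × Bool) → Set (ℝ≥0 × (Fin k → RankedSimplex k)) := fun o =>
    o.elim (uncovered a b ×ˢ Set.univ)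
      fun q => Set.Ico (a q.1) (b q.1) ×ˢ (if q.2 then A q.1 else (A q.1)ᶜ)
  let c : Option (Fin J × Bool) → ℕ := fun o => o.elim 0 fun q => if q.2 then 1 else 0
  have hS : ∀ o, MeasurableSet (S o) := by
    rintro (_ | ⟨j, _ | _⟩)
    · exact (measurableSet_uncovered a b).prod MeasurableSet.univ
    · exact measurableSet_Ico.prod (hA j).compl
    · exact measurableSet_Ico.prod (hA j)
  have hIco : ∀ {i j : Fin J} {x : ℝ≥0}, x ∈ Set.Ico (a i) (b i) → x ∈ Set.Ico (a j) (b j) →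
      i = j := by
    intro i j x hi hj
    rcases lt_trichotomy i j with hlt | heq | hlt
    · exact absurd (hi.2.trans_le (hab i j hlt)) (not_lt.2 hj.1)
    · exact heq
    · exact absurd (hj.2.trans_le (hab j i hlt)) (not_lt.2 hi.1)
  have hd : Pairwise fun i j => Disjoint (S i) (S j) := by
    intro o o' ho
    rw [Set.disjoint_left]
    rintro ⟨x, y⟩ h1 h2
    rcases o with _ | ⟨i, s⟩ <;> rcases o' with _ | ⟨j, s'⟩
    · exact ho rfl
    · exact h1.1.2 j h2.1
    · exact h2.1.2 i h1.1
    · have hij := hIco h1.1 h2.1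
      subst hij
      rcases s with _ | _ <;> rcases s' with _ | _
      · exact ho rfl
      · exact h1.2 h2.2
      · exact h2.2 h1.2
      · exact ho rfl
  have hev : {ω | ∀ j : Fin J, T j ω ∈ Set.Ico (a j) (b j) ∧ b j ≤ T J ω ∧ M j ω ∈ A j} =ᵐ[P]
      ⋂ o, {ω | (N ω ∩ S o).encard = c o} := by
    filter_upwards [h.strictMono] with ω hω
    refine propext (Iff.trans ?_ Set.mem_iInter.symm)
    refine (separated_iff hω (fun m => M m ω) hab A).symm.trans ?_
    rw [Option.forall, Prod.forall]
    refine and_congr ?_ (forall_congr' fun j => ?_)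
    · change _ ↔ (N ω ∩ uncovered a b ×ˢ Set.univ).encard = ((0 : ℕ) : ℕ∞)
      rw [encard_range_inter hω]
      simp
    · rw [Bool.forall_bool, and_comm]
      change _ ↔ (N ω ∩ Set.Ico (a j) (b j) ×ˢ (A j)ᶜ).encard = ((0 : ℕ) : ℕ∞) ∧
        (N ω ∩ Set.Ico (a j) (b j) ×ˢ A j).encard = ((1 : ℕ) : ℕ∞)
      rw [encard_range_inter hω, encard_range_inter hω]
      simp
  have hpo : ∀ j C, MeasurableSet C → ∀ i : ℕ,
      P {ω | (N ω ∩ Set.Ico (a j) (b j) ×ˢ C).encard = i} =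
      poissonMeasure (((lam * (b j - a j) : ℝ≥0) : ℝ≥0∞) *
        (Measure.pi fun _ : Fin k => ν) C).toNNReal {i} := by
    intro j C hC i
    have e : (lebesgueNonneg.prod (lam • Measure.pi fun _ : Fin k => ν))
        (Set.Ico (a j) (b j) ×ˢ C) = ((lam * (b j - a j) : ℝ≥0) : ℝ≥0∞) *
        (Measure.pi fun _ : Fin k => ν) C := by
      rw [intensity_prod, lebesgueNonneg_Ico, ← mul_assoc, ENNReal.coe_mul,
        mul_comm (lam : ℝ≥0∞)]
    rw [h.poisson.poisson _ (measurableSet_Ico.prod hC)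
      (by rw [e]; exact ENNReal.mul_ne_top ENNReal.coe_ne_top (measure_ne_top _ _)), e]
  rw [measure_congr hev, h.poisson.measure_iInter hS hd, Fintype.prod_option,
    Fintype.prod_prod_type]
  congr 1
  refine Finset.prod_congr rfl fun j _ => ?_
  rw [Fintype.prod_bool, ← poissonMeasure_one_mul_zero _ _ (hA j), ← hpo j _ (hA j),
    ← hpo j _ (hA j).compl]
  rfl

end Input

/-! ### The marks of a Poisson point process are independent of the times -/

theorem exists_dyadic_cell (r : ℕ) (x : ℝ≥0) :
    ∃ l, x ∈ Set.Ico (dyadic r l) (dyadic r (l + 1)) := by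
  refine ⟨⌊x * 2 ^ r⌋₊, ?_, ?_⟩
  · rw [dyadic, div_le_iff₀ (by positivity)]
    exact Nat.floor_le (zero_le)
  · rw [dyadic, lt_div_iff₀ (by positivity)]
    push_cast
    exact Nat.lt_floor_add_one _

theorem dyadic_le_dyadic {r a b : ℕ} : dyadic r a ≤ dyadic r b ↔ a ≤ b := by
  rw [← not_lt, dyadic_lt_dyadic, not_lt]

theorem dyadic_cell_unique {r l l' : ℕ} {x : ℝ≥0}
    (h : x ∈ Set.Ico (dyadic r l) (dyadic r (l + 1)))
    (h' : x ∈ Set.Ico (dyadic r l') (dyadic r (l' + 1))) : l = l' := by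
  have h1 := dyadic_lt_dyadic.1 (h.1.trans_lt h'.2)
  have h2 := dyadic_lt_dyadic.1 (h'.1.trans_lt h.2)
  omega

theorem eventually_dyadic_cell_le {x : ℝ≥0} {y : ℝ≥0∞} (h : (x : ℝ≥0∞) < y) :
    ∀ᶠ r in atTop, ∀ l, x ∈ Set.Ico (dyadic r l) (dyadic r (l + 1)) →
      (dyadic r (l + 1) : ℝ≥0∞) ≤ y := by
  obtain ⟨z, hxz, hzy⟩ := ENNReal.lt_iff_exists_nnreal_btwn.1 h
  rw [ENNReal.coe_lt_coe] at hxz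
  have h1 : Tendsto (fun r : ℕ => x + (1 / 2 : ℝ≥0) ^ r) atTop (𝓝 x) := by
    have := (tendsto_const_nhds (x := x)).add
      (NNReal.tendsto_pow_atTop_nhds_zero_of_lt_one (r := (1 / 2 : ℝ≥0)) (by rw [← NNReal.coe_lt_coe]; norm_num))
    rwa [add_zero] at this
  filter_upwards [h1.eventually_lt_const hxz] with r hr l hl
  refine le_trans (ENNReal.coe_le_coe.2 ?_) hzy.le
  refine le_trans ?_ hr.le
  have : dyadic r (l + 1) = dyadic r l + (1 / 2) ^ r := by
    unfold dyadic
    push_cast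
    rw [add_div, one_div_pow]
  rw [this]
  exact add_le_add_left hl.1 _

theorem comap_le_of_Iio {δ : Type*} {m : MeasurableSpace δ} {f : δ → ℝ≥0}
    (hf : ∀ x, MeasurableSet (f ⁻¹' Set.Iio x)) : MeasurableSpace.comap f inferInstance ≤ m :=
  (measurable_of_Iio hf).comap_le

section Input

variable {k : ℕ} {Ω : Type*} [MeasurableSpace Ω] {P : Measure Ω} [IsProbabilityMeasure P]
  {lam : ℝ≥0} {ν : Measure (RankedSimplex k)} [IsProbabilityMeasure ν] {p₀ : Ω → RankedSimplex k}
  {T : ℕ → Ω → ℝ≥0} {M : ℕ → Ω → Fin k → RankedSimplex k}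
  {σ : ℕ → Ω → Fin k → Equiv.Perm (Fin k)}

/-- The event is approximated by a disjoint union of events that place the first `J` times in
prescribed separate dyadic cells. On each of these the marks factor out, and almost surely a fine
enough grid separates the times. A bound `c j = ⊤` imposes nothing on time `j`. -/
theorem IsRankedMassInput.measure_times_marks (h : IsRankedMassInput P lam ν p₀ T M σ) (J : ℕ)
    (c : ℕ → ℝ≥0∞) {A : ℕ → Set (Fin k → RankedSimplex k)} (hA : ∀ j, MeasurableSet (A j)) :
    P {ω | ∀ j : Fin J, (T j ω : ℝ≥0∞) < c j ∧ M j ω ∈ A j} =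
      P {ω | ∀ j : Fin J, (T j ω : ℝ≥0∞) < c j} *
        ∏ j : Fin J, (Measure.pi fun _ : Fin k => ν) (A j) := by
  -- Ordered, non-overlapping cells whose right ends respect the bounds `c`, so that every cell
  -- event lies inside the target event.
  let good : ℕ → (Fin J → ℕ) → Prop := fun r l =>
    (∀ i j, i < j → dyadic r (l i + 1) ≤ dyadic r (l j)) ∧
      ∀ j, (dyadic r (l j + 1) : ℝ≥0∞) ≤ c j
  let sep : ℕ → (ℕ → Set (Fin k → RankedSimplex k)) → (Fin J → ℕ) → Set Ω := fun r A l =>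
    {ω | ∀ j : Fin J, T j ω ∈ Set.Ico (dyadic r (l j)) (dyadic r (l j + 1)) ∧
      dyadic r (l j + 1) ≤ T J ω ∧ M j ω ∈ A j}
  let E : ℕ → (ℕ → Set (Fin k → RankedSimplex k)) → Set Ω := fun r A =>
    ⋃ l : {l // good r l}, sep r A l
  have hsep : ∀ r A l, (∀ j, MeasurableSet (A j)) → MeasurableSet (sep r A l) := by
    intro r A l hA
    have : sep r A l = ⋂ j : Fin J, (T j ⁻¹' Set.Ico (dyadic r (l j)) (dyadic r (l j + 1))) ∩
        ((T J ⁻¹' Set.Ici (dyadic r (l j + 1))) ∩ (M j ⁻¹' A j)) := by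
      ext ω; simp [sep]
    rw [this]
    exact MeasurableSet.iInter fun j => (h.measurable_time _ measurableSet_Ico).inter
      ((h.measurable_time _ measurableSet_Ici).inter (h.measurable_mark _ (hA j)))
  have hE : ∀ r A, (∀ j, MeasurableSet (A j)) → MeasurableSet (E r A) := fun r A hA =>
    MeasurableSet.iUnion fun l => hsep r A l hA
  have hsum : ∀ r A, (∀ j, MeasurableSet (A j)) → P (E r A) = ∑' l : {l // good r l}, P (sep r A l) := by
    intro r A hA
    refine measure_iUnion (fun l l' hl => Set.disjoint_left.2 fun ω h1 h2 => hl ?_)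
      fun l => hsep r A l hA
    exact Subtype.ext (funext fun j => dyadic_cell_unique (h1 j).1 (h2 j).1)
  have hprod : ∀ r, P (E r A) = P (E r fun _ => Set.univ) *
      ∏ j : Fin J, (Measure.pi fun _ : Fin k => ν) (A j) := by
    intro r
    rw [hsum r A hA, hsum r _ fun _ => MeasurableSet.univ, ← ENNReal.tsum_mul_right]
    refine tsum_congr fun l => ?_
    have h1 := h.measure_separated (a := fun j => dyadic r (l.1 j))
      (b := fun j => dyadic r (l.1 j + 1)) l.2.1 (A := fun j => A j) fun j => hA j
    have h2 := h.measure_separated (a := fun j => dyadic r (l.1 j))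
      (b := fun j => dyadic r (l.1 j + 1)) l.2.1 (A := fun _ => Set.univ) fun j => MeasurableSet.univ
    change P (sep r A l) = _ at h1
    change P (sep r (fun _ => Set.univ) l) = _ at h2
    rw [h1, h2]
    simp only [measure_univ, one_mul]
    rw [mul_assoc, ← Finset.prod_mul_distrib]
    congr 1
    exact Finset.prod_congr rfl fun j _ => mul_comm _ _
  have hF : ∀ A : ℕ → Set (Fin k → RankedSimplex k), (∀ j, MeasurableSet (A j)) →
      MeasurableSet {ω | ∀ j : Fin J, (T j ω : ℝ≥0∞) < c j ∧ M j ω ∈ A j} := by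
    intro A hA
    rw [Set.ofPred_forall]
    exact MeasurableSet.iInter fun j => (measurableSet_lt (h.measurable_time j).coe_nnreal_ennreal
      measurable_const).inter (h.measurable_mark j (hA j))
  have hlim : ∀ A : ℕ → Set (Fin k → RankedSimplex k), (∀ j, MeasurableSet (A j)) →
      Tendsto (fun r => P (E r A)) atTop
        (𝓝 (P {ω | ∀ j : Fin J, (T j ω : ℝ≥0∞) < c j ∧ M j ω ∈ A j})) := by
    intro A hA
    refine tendsto_measure_of_ae_tendsto_indicator_of_isFiniteMeasure atTop (hF A hA)
      (fun r => hE r A hA) ?_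
    filter_upwards [h.strictMono] with ω hω
    by_cases hmem : ω ∈ {ω | ∀ j : Fin J, (T j ω : ℝ≥0∞) < c j ∧ M j ω ∈ A j}
    · have h1 : ∀ᶠ r in atTop, ∀ i j : Fin (J + 1), i < j → ∀ l,
          T i ω ∈ Set.Ico (dyadic r l) (dyadic r (l + 1)) → dyadic r (l + 1) ≤ T j ω := by
        simp only [eventually_all]
        intro i j hij
        filter_upwards [eventually_dyadic_cell_le (ENNReal.coe_lt_coe.2 (hω hij))] with r hr l hl
        exact ENNReal.coe_le_coe.1 (hr l hl)
      have h2 : ∀ᶠ r in atTop, ∀ j : Fin J, ∀ l,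
          T j ω ∈ Set.Ico (dyadic r l) (dyadic r (l + 1)) → (dyadic r (l + 1) : ℝ≥0∞) ≤ c j := by
        simp only [eventually_all]
        exact fun j => eventually_dyadic_cell_le (hmem j).1
      filter_upwards [h1, h2] with r hr1 hr2
      refine iff_of_true ?_ hmem
      choose l hl using fun j : Fin J => exists_dyadic_cell r (T j ω)
      refine Set.mem_iUnion.2 ⟨⟨l, fun i j hij => ?_, fun j => hr2 j _ (hl j)⟩, fun j =>
        ⟨hl j, ?_, (hmem j).2⟩⟩
      · have h3 := hr1 i.castSucc j.castSucc hij (l i) (hl i)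
        rw [dyadic_le_dyadic]
        exact Nat.lt_succ_iff.1 (dyadic_lt_dyadic.1 (h3.trans_lt (hl j).2))
      · simpa using hr1 j.castSucc (Fin.last J) (Fin.castSucc_lt_last j) (l j) (hl j)
    · refine Eventually.of_forall fun r => iff_of_false (fun hr => hmem ?_) hmem
      obtain ⟨l, hl⟩ := Set.mem_iUnion.1 hr
      exact fun j => ⟨(ENNReal.coe_lt_coe.2 (hl j).1.2).trans_le (l.2.2 j), (hl j).2.2⟩
  have l1 := hlim A hA
  have l2 := ENNReal.Tendsto.mul_const (b := ∏ j : Fin J, (Measure.pi fun _ : Fin k => ν) (A j))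
    (hlim (fun _ => Set.univ) fun _ => MeasurableSet.univ)
    (Or.inr (ENNReal.prod_ne_top fun j _ => measure_ne_top _ _))
  simp only [hprod] at l1
  have := tendsto_nhds_unique l1 l2
  rw [this]
  simp

/-- The times and the marks are independent, and the marks are i.i.d. -/
theorem IsRankedMassInput.map_times_marks (h : IsRankedMassInput P lam ν p₀ T M σ) :
    P.map (fun ω => ((fun m => T m ω), fun m => M m ω)) =
      (P.map fun ω m => T m ω).prod
        (Measure.infinitePi fun _ : ℕ => Measure.pi fun _ : Fin k => ν) := by
  classical
  have hT : Measurable fun ω m => T m ω := measurable_pi_lambda _ h.measurable_time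
  have hM : Measurable fun ω m => M m ω := measurable_pi_lambda _ h.measurable_mark
  have := Measure.isProbabilityMeasure_map (μ := P) hT.aemeasurable
  -- Initial segments form a π-system; the value `⊤` puts the whole half-line among them, as
  -- cylinders require.
  set C₀ : Set (Set ℝ≥0) := {S | ∃ c : ℝ≥0∞, S = {x : ℝ≥0 | (x : ℝ≥0∞) < c}} with hC₀
  have hC₀m : ∀ S ∈ C₀, MeasurableSet S := by
    rintro _ ⟨c, rfl⟩
    exact measurableSet_lt measurable_coe_nnreal_ennreal measurable_const
  have hC₀u : Set.univ ∈ C₀ := ⟨⊤, by ext; simp⟩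
  set C := squareCylinders fun _ : ℕ => C₀ with hC
  set D := squareCylinders fun _ : ℕ => {S : Set (Fin k → RankedSimplex k) | MeasurableSet S}
    with hD
  have hC1 : MeasurableSpace.generateFrom C = MeasurableSpace.pi := by
    refine le_antisymm (MeasurableSpace.generateFrom_le ?_) (iSup_le fun i => ?_)
    · rintro _ ⟨s, t, ht, rfl⟩
      exact MeasurableSet.pi s.countable_toSet fun i _ => hC₀m _ (ht i trivial)
    · refine comap_le_of_Iio (m := MeasurableSpace.generateFrom C) fun x => ?_
      refine MeasurableSpace.measurableSet_generateFrom ⟨{i}, fun _ => Set.Iio x, fun _ _ => ?_, ?_⟩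
      · exact ⟨x, by ext; simp⟩
      · ext; simp
  have hC2 : IsPiSystem C := by
    refine isPiSystem_squareCylinders (fun _ => ?_) fun _ => hC₀u
    rintro _ ⟨c, rfl⟩ _ ⟨c', rfl⟩ -
    exact ⟨min c c', by ext; simp⟩
  have hD1 : MeasurableSpace.generateFrom D = MeasurableSpace.pi := generateFrom_squareCylinders
  have hD2 : IsPiSystem D := isPiSystem_squareCylinders
    (fun _ => MeasurableSpace.isPiSystem_measurableSet) fun _ => MeasurableSet.univ (α := Fin k → RankedSimplex k)
  have hCu : Set.univ ∈ C := ⟨∅, fun _ => Set.univ, fun _ _ => hC₀u, by simp⟩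
  have hDu : Set.univ ∈ D := ⟨∅, fun _ => Set.univ,
    fun _ _ => MeasurableSet.univ (α := Fin k → RankedSimplex k), by simp⟩
  refine (Measure.prod_eq_generateFrom hC1 hD1 hC2 hD2
    ⟨fun _ => Set.univ, fun _ => hCu, fun _ => measure_lt_top _ _, Set.iUnion_const _⟩
    ⟨fun _ => Set.univ, fun _ => hDu, fun _ => measure_lt_top _ _, Set.iUnion_const _⟩ ?_).symm
  rintro _ ⟨s, t, ht, rfl⟩ _ ⟨s', A, hA, rfl⟩
  choose c hc using fun i => ht i trivial
  have hA' : ∀ i, MeasurableSet (A i) := fun i => hA i trivial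
  obtain ⟨J, hJ⟩ : ∃ J, s ∪ s' ⊆ Finset.range J := (s ∪ s').exists_nat_subset_range
  have hsJ : ∀ i ∈ s, i < J := fun i hi => Finset.mem_range.1 (hJ (Finset.mem_union_left _ hi))
  have hsJ' : ∀ i ∈ s', i < J := fun i hi => Finset.mem_range.1 (hJ (Finset.mem_union_right _ hi))
  have key := h.measure_times_marks J (fun i => if i ∈ s then c i else ⊤)
    (A := fun i => if i ∈ s' then A i else Set.univ)
    (fun j => by split_ifs; exacts [hA' j, MeasurableSet.univ])
  have hs1 : MeasurableSet ((s : Set ℕ).pi t) :=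
    MeasurableSet.pi s.countable_toSet fun i _ => hC₀m _ (ht i trivial)
  have hs2 : MeasurableSet ((s' : Set ℕ).pi A) :=
    MeasurableSet.pi s'.countable_toSet fun i _ => hA' i
  have e1 : (fun ω m => T m ω) ⁻¹' (s : Set ℕ).pi t =
      {ω | ∀ j : Fin J, (T j ω : ℝ≥0∞) < if (j : ℕ) ∈ s then c j else ⊤} := by
    ext ω
    simp only [Set.mem_preimage, Set.mem_pi, Finset.mem_coe, Set.mem_ofPred_eq]
    constructor
    · intro h1 j
      split_ifs with hj
      · have := h1 j hj
        rw [hc] at this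
        exact this
      · exact ENNReal.coe_lt_top
    · intro h1 i hi
      have := h1 ⟨i, hsJ i hi⟩
      rw [if_pos hi] at this
      rw [hc]
      exact this
  have e2 : (fun ω m => M m ω) ⁻¹' (s' : Set ℕ).pi A =
      {ω | ∀ j : Fin J, M j ω ∈ if (j : ℕ) ∈ s' then A j else Set.univ} := by
    ext ω
    simp only [Set.mem_preimage, Set.mem_pi, Finset.mem_coe, Set.mem_ofPred_eq]
    constructor
    · intro h1 j
      split_ifs with hj
      · exact h1 j hj
      · trivial
    · intro h1 i hi
      have := h1 ⟨i, hsJ' i hi⟩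
      rwa [if_pos hi] at this
  have e3 : ∏ j : Fin J, (Measure.pi fun _ : Fin k => ν) (if (j : ℕ) ∈ s' then A j else Set.univ) =
      ∏ j ∈ s', (Measure.pi fun _ : Fin k => ν) (A j) := by
    rw [Fin.prod_univ_eq_prod_range (fun j => (Measure.pi fun _ : Fin k => ν)
      (if j ∈ s' then A j else Set.univ)) J, ← Finset.prod_subset
      (Finset.subset_union_right.trans hJ) fun j _ hj => by rw [if_neg hj, measure_univ]]
    exact Finset.prod_congr rfl fun j hj => by rw [if_pos hj]
  rw [Measure.map_apply (hT.prodMk hM) (hs1.prod hs2), Measure.map_apply hT hs1,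
    Measure.infinitePi_pi _ fun i _ => hA' i, e1, ← e3, ← key, Set.mk_preimage_prod, e1, e2]
  congr 1
  ext ω
  simp only [Set.mem_inter_iff, Set.mem_ofPred_eq, forall_and]

end Input

/-- Zipping two independent i.i.d. sequences. -/
theorem infinitePi_prod_infinitePi_map_zip {A B : Type*} [MeasurableSpace A] [MeasurableSpace B]
    (α : Measure A) (β : Measure B) [IsProbabilityMeasure α] [IsProbabilityMeasure β] :
    ((Measure.infinitePi fun _ : ℕ => α).prod (Measure.infinitePi fun _ : ℕ => β)).map
      (fun q i => (q.1 i, q.2 i)) = Measure.infinitePi fun _ => α.prod β := by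
  classical
  have hm : Measurable fun (q : (ℕ → A) × (ℕ → B)) (i : ℕ) => (q.1 i, q.2 i) :=
    measurable_pi_lambda _ fun i => ((measurable_pi_apply i).comp measurable_fst).prodMk
      ((measurable_pi_apply i).comp measurable_snd)
  have h1 : IsProjectiveLimit (((Measure.infinitePi fun _ : ℕ => α).prod
      (Measure.infinitePi fun _ : ℕ => β)).map (fun q i => (q.1 i, q.2 i)))
      fun I : Finset ℕ => Measure.pi fun _ : I => α.prod β := by
    intro I
    refine (Measure.pi_eq_generateFrom (C := fun _ => Set.image2 (· ×ˢ ·) {s : Set A | MeasurableSet s}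
      {t : Set B | MeasurableSet t}) (fun _ => generateFrom_prod) (fun _ => isPiSystem_prod)
      (fun _ => ⟨fun _ => Set.univ, fun _ => ⟨_, MeasurableSet.univ, _, MeasurableSet.univ,
        Set.univ_prod_univ⟩, fun _ => measure_lt_top _ _, Set.iUnion_const _⟩) fun S hS => ?_).symm
    choose s hs t ht hst using hS
    obtain rfl : (fun i => s i ×ˢ t i) = S := funext hst
    let s' : ℕ → Set A := fun i => if h : i ∈ I then s ⟨i, h⟩ else Set.univ
    let t' : ℕ → Set B := fun i => if h : i ∈ I then t ⟨i, h⟩ else Set.univ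
    have hs' : ∀ i, MeasurableSet (s' i) := fun i => by
      simp only [s']; split_ifs with h
      exacts [hs _, MeasurableSet.univ]
    have ht' : ∀ i, MeasurableSet (t' i) := fun i => by
      simp only [t']; split_ifs with h
      exacts [ht _, MeasurableSet.univ]
    rw [Measure.map_map (Finset.measurable_restrict I) hm, Measure.map_apply
      ((Finset.measurable_restrict I).comp hm)
      (MeasurableSet.univ_pi fun i => (hs i).prod (ht i))]
    have e : (I.restrict ∘ fun (q : (ℕ → A) × (ℕ → B)) i => (q.1 i, q.2 i)) ⁻¹'
        Set.univ.pi (fun i => s i ×ˢ t i) = (I : Set ℕ).pi s' ×ˢ (I : Set ℕ).pi t' := by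
      ext q
      simp only [Set.mem_preimage, Function.comp_apply, Finset.restrict,
        Set.mem_prod, Set.mem_pi, Finset.mem_coe]
      constructor
      · intro h1
        refine ⟨fun i hi => ?_, fun i hi => ?_⟩
        · simp only [s', dif_pos hi]; exact (h1 ⟨i, hi⟩ trivial).1
        · simp only [t', dif_pos hi]; exact (h1 ⟨i, hi⟩ trivial).2
      · rintro ⟨h1, h2⟩ ⟨i, hi⟩ -
        have h3 := h1 i hi
        have h4 := h2 i hi
        simp only [s', t', dif_pos hi] at h3 h4
        exact ⟨h3, h4⟩
    rw [e, Measure.prod_prod, Measure.infinitePi_pi _ fun i _ => hs' i,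
      Measure.infinitePi_pi _ fun i _ => ht' i, ← Finset.prod_mul_distrib, ← Finset.prod_attach,
      Finset.univ_eq_attach]
    refine Finset.prod_congr rfl fun i _ => ?_
    rw [Measure.prod_prod]
    simp only [s', t', dif_pos i.2]
  exact h1.unique (Measure.isProjectiveLimit_infinitePi _)

/-! ### The chain at the times of a Poisson process -/

section PoissonChain

variable {Ω M V : Type*} [MeasurableSpace Ω] [MeasurableSpace M] [MeasurableSpace V]
  {P : Measure Ω} [IsProbabilityMeasure P] (μ : Measure M) [IsProbabilityMeasure μ]
  {f : V → M → V}

theorem measurable_drivenChain_uncurry (hf : Measurable (Function.uncurry f)) :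
    Measurable fun q : (V × (ℕ → M)) × ℕ => drivenChain f q.1.1 q.1.2 q.2 :=
  measurable_from_prod_countable_left fun n => measurable_drivenChain hf n

/-- If the number of further steps is Poisson and independent of everything else, then the chain
moves by the poissonized kernel. -/
theorem map_drivenChain_poisson (hf : Measurable (Function.uncurry f)) {n : ℕ} {p : Ω → V}
    {N : Ω → Fin (n + 1) → ℕ} {D : Ω → ℕ} {Z : Ω → ℕ → M} (hp : Measurable p)
    (hN : Measurable N) (hD : Measurable D) (hZ : Measurable Z)
    (hmono : ∀ᵐ ω ∂P, ∀ i, N ω i ≤ N ω (Fin.last n)) {r : ℝ≥0}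
    (hlaw : P.map (fun ω => (((p ω, N ω), D ω), Z ω)) =
      ((P.map fun ω => (p ω, N ω)).prod (poissonMeasure r)).prod (Measure.infinitePi fun _ => μ)) :
    P.map (fun ω => ((fun i => drivenChain f (p ω) (Z ω) (N ω i)),
        drivenChain f (p ω) (Z ω) (N ω (Fin.last n) + D ω))) =
      (P.map fun ω i => drivenChain f (p ω) (Z ω) (N ω i)) ⊗ₘ
        lastKernel (poissonizedKernel (randomMapKernel μ f hf) r) := by
  have hpN : Measurable fun ω => (p ω, N ω) := hp.prodMk hN
  have := Measure.isProbabilityMeasure_map (μ := P) hpN.aemeasurable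
  set Q := P.map fun ω => (p ω, N ω)
  set L := (Q.prod (poissonMeasure r)).prod (Measure.infinitePi fun _ : ℕ => μ)
  have hall : Measurable fun ω => (((p ω, N ω), D ω), Z ω) := (hpN.prodMk hD).prodMk hZ
  have hc := measurable_drivenChain_uncurry (f := f) hf
  have hY : Measurable fun q : (V × (Fin (n + 1) → ℕ)) × (ℕ → M) =>
      fun i => drivenChain f q.1.1 q.2 (q.1.2 i) :=
    measurable_pi_lambda _ fun i => hc.comp (((measurable_fst.comp measurable_fst).prodMk
      measurable_snd).prodMk ((measurable_pi_apply i).comp (measurable_snd.comp measurable_fst)))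
  have hY' : Measurable fun q : ((V × (Fin (n + 1) → ℕ)) × ℕ) × (ℕ → M) =>
      fun i => drivenChain f q.1.1.1 q.2 (q.1.1.2 i) :=
    hY.comp ((measurable_fst.comp measurable_fst).prodMk measurable_snd)
  have hW : Measurable fun q : ((V × (Fin (n + 1) → ℕ)) × ℕ) × (ℕ → M) =>
      drivenChain f q.1.1.1 q.2 (q.1.1.2 (Fin.last n) + q.1.2) := by
    have h1 : Measurable fun q : ((V × (Fin (n + 1) → ℕ)) × ℕ) × (ℕ → M) => q.1.1.2 (Fin.last n) :=
      (measurable_pi_apply _).comp (measurable_snd.comp (measurable_fst.comp measurable_fst))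
    have h2 : Measurable fun q : ((V × (Fin (n + 1) → ℕ)) × ℕ) × (ℕ → M) =>
        q.1.1.2 (Fin.last n) + q.1.2 := h1.add (measurable_snd.comp measurable_fst)
    exact hc.comp (((measurable_fst.comp (measurable_fst.comp measurable_fst)).prodMk
      measurable_snd).prodMk h2)
  have hQ : ∀ᵐ q ∂Q, ∀ i, q.2 i ≤ q.2 (Fin.last n) := by
    refine (ae_map_iff hpN.aemeasurable ?_).2 hmono
    rw [Set.ofPred_forall]
    exact MeasurableSet.iInter fun i => measurableSet_le
      ((measurable_pi_apply i).comp measurable_snd)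
      ((measurable_pi_apply (Fin.last n)).comp measurable_snd)
  refine Measure.ext_of_lintegral _ fun F hF => ?_
  have hG : Measurable fun q : ((V × (Fin (n + 1) → ℕ)) × ℕ) × (ℕ → M) =>
      F ((fun i => drivenChain f q.1.1.1 q.2 (q.1.1.2 i)),
        drivenChain f q.1.1.1 q.2 (q.1.1.2 (Fin.last n) + q.1.2)) := hF.comp (hY'.prodMk hW)
  set K : (Fin (n + 1) → V) → ℝ≥0∞ := fun x =>
    ∫⁻ y, F (x, y) ∂lastKernel (poissonizedKernel (randomMapKernel μ f hf) r) x with hK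
  have hKm : Measurable K := Measurable.lintegral_kernel_prod_right' hF
  have hH : Measurable fun q : ((V × (Fin (n + 1) → ℕ)) × ℕ) × (ℕ → M) =>
      K fun i => drivenChain f q.1.1.1 q.2 (q.1.1.2 i) := hKm.comp hY'
  have hl : ∫⁻ x, F x ∂P.map (fun ω => ((fun i => drivenChain f (p ω) (Z ω) (N ω i)),
        drivenChain f (p ω) (Z ω) (N ω (Fin.last n) + D ω))) =
      ∫⁻ q, ∫⁻ d, ∫⁻ z, F ((fun i => drivenChain f q.1 z (q.2 i)),
        drivenChain f q.1 z (q.2 (Fin.last n) + d)) ∂(Measure.infinitePi fun _ : ℕ => μ)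
        ∂poissonMeasure r ∂Q := by
    have h1 : Measurable fun ω => ((fun i => drivenChain f (p ω) (Z ω) (N ω i)),
        drivenChain f (p ω) (Z ω) (N ω (Fin.last n) + D ω)) := (hY'.comp hall).prodMk (hW.comp hall)
    rw [lintegral_map hF h1]
    have h2 := lintegral_map (μ := P) hG hall
    rw [hlaw] at h2
    rw [← h2, lintegral_prod _ hG.aemeasurable, lintegral_prod]
    exact hG.lintegral_prod_right'.aemeasurable
  have hr : ∫⁻ x, F x ∂((P.map fun ω i => drivenChain f (p ω) (Z ω) (N ω i)) ⊗ₘ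
        lastKernel (poissonizedKernel (randomMapKernel μ f hf) r)) =
      ∫⁻ q, ∫⁻ z, K (fun i => drivenChain f q.1 z (q.2 i))
        ∂(Measure.infinitePi fun _ : ℕ => μ) ∂Q := by
    have h1 : Measurable fun ω i => drivenChain f (p ω) (Z ω) (N ω i) := hY'.comp hall
    rw [Measure.lintegral_compProd hF, lintegral_map hKm h1]
    have h2 := lintegral_map (μ := P) hH hall
    rw [hlaw] at h2
    rw [← h2, lintegral_prod _ hH.aemeasurable, lintegral_prod _
      hH.lintegral_prod_right'.aemeasurable]
    simp
  rw [hl, hr]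
  refine lintegral_congr_ae ?_
  filter_upwards [hQ] with q hq
  have hφ : Measurable fun (z : ℕ → M) (i : Fin (n + 1)) => drivenChain f q.1 z (q.2 i) :=
    hY.comp measurable_prodMk_left
  -- The observed states use only marks of index below `q.2 (Fin.last n)`, so the marks of all
  -- further steps are fresh.
  have hφn : ∀ (m : ℕ → M) (i : ℕ) (x : M), q.2 (Fin.last n) ≤ i →
      (fun j => drivenChain f q.1 (Function.update m i x) (q.2 j)) =
        fun j => drivenChain f q.1 m (q.2 j) := fun m i x hi =>
    funext fun j => drivenChain_update q.1 m ((hq j).trans hi) x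
  rw [lintegral_countable']
  have hstep : ∀ d, ∫⁻ z, F ((fun i => drivenChain f q.1 z (q.2 i)),
        drivenChain f q.1 z (q.2 (Fin.last n) + d)) ∂(Measure.infinitePi fun _ : ℕ => μ) =
      ∫⁻ z, ∫⁻ y, F ((fun i => drivenChain f q.1 z (q.2 i)), y)
        ∂kernelPow (randomMapKernel μ f hf) d (drivenChain f q.1 z (q.2 (Fin.last n)))
        ∂(Measure.infinitePi fun _ : ℕ => μ) := fun d =>
    lintegral_drivenChain μ hf q.1 hφ hφn d hF
  have hmeas : ∀ d, Measurable fun z : ℕ → M =>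
      ∫⁻ y, F ((fun i => drivenChain f q.1 z (q.2 i)), y)
        ∂kernelPow (randomMapKernel μ f hf) d (drivenChain f q.1 z (q.2 (Fin.last n))) := by
    intro d
    have h1 : Measurable fun x : Fin (n + 1) → V =>
        ∫⁻ y, F (x, y) ∂lastKernel (kernelPow (randomMapKernel μ f hf) d) x :=
      Measurable.lintegral_kernel_prod_right' hF
    exact h1.comp hφ
  simp only [hstep]
  calc ∑' d, (∫⁻ z, ∫⁻ y, F ((fun i => drivenChain f q.1 z (q.2 i)), y)
        ∂kernelPow (randomMapKernel μ f hf) d (drivenChain f q.1 z (q.2 (Fin.last n)))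
        ∂(Measure.infinitePi fun _ : ℕ => μ)) * poissonMeasure r {d}
      = ∑' d, ∫⁻ z, poissonMeasure r {d} * ∫⁻ y, F ((fun i => drivenChain f q.1 z (q.2 i)), y)
        ∂kernelPow (randomMapKernel μ f hf) d (drivenChain f q.1 z (q.2 (Fin.last n)))
        ∂(Measure.infinitePi fun _ : ℕ => μ) := by
        refine tsum_congr fun d => ?_
        rw [lintegral_const_mul _ (hmeas d), mul_comm]
    _ = ∫⁻ z, ∑' d, poissonMeasure r {d} * ∫⁻ y, F ((fun i => drivenChain f q.1 z (q.2 i)), y)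
        ∂kernelPow (randomMapKernel μ f hf) d (drivenChain f q.1 z (q.2 (Fin.last n)))
        ∂(Measure.infinitePi fun _ : ℕ => μ) :=
        (lintegral_tsum fun d => ((hmeas d).const_mul _).aemeasurable).symm
    _ = _ := lintegral_congr fun z => (lintegral_poissonizedKernel _ _ _ _).symm

end PoissonChain

/-- The hypotheses make the joint law of the three variables a product of three factors, which may
be bracketed either way. -/
theorem indepFun_prodMk_left {Ω A B C : Type*} [MeasurableSpace Ω] [MeasurableSpace A]
    [MeasurableSpace B] [MeasurableSpace C] {P : Measure Ω} [IsProbabilityMeasure P] {f : Ω → A}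
    {g : Ω → B} {h : Ω → C} (hf : Measurable f) (hg : Measurable g) (hh : Measurable h)
    (h1 : IndepFun f (fun ω => (g ω, h ω)) P) (h2 : IndepFun g h P) :
    IndepFun (fun ω => (f ω, g ω)) h P := by
  have i1 := Measure.isProbabilityMeasure_map (μ := P) hf.aemeasurable
  have i2 := Measure.isProbabilityMeasure_map (μ := P) hg.aemeasurable
  have i3 := Measure.isProbabilityMeasure_map (μ := P) hh.aemeasurable
  rw [indepFun_iff_map_prod_eq_prod_map_map hf.aemeasurable (hg.prodMk hh).aemeasurable,
    (indepFun_iff_map_prod_eq_prod_map_map hg.aemeasurable hh.aemeasurable).1 h2] at h1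
  have h3 : IndepFun f g P := by
    rw [indepFun_iff_map_prod_eq_prod_map_map hf.aemeasurable hg.aemeasurable]
    have := congrArg (Measure.map (Prod.map id Prod.fst)) h1
    rw [Measure.map_map (measurable_id.prodMap measurable_fst) (hf.prodMk (hg.prodMk hh)),
      ← Measure.map_prod_map _ _ measurable_id measurable_fst, Measure.map_id,
      Measure.map_fst_prod, measure_univ, one_smul] at this
    exact this
  rw [indepFun_iff_map_prod_eq_prod_map_map (hf.prodMk hg).aemeasurable hh.aemeasurable,
    (indepFun_iff_map_prod_eq_prod_map_map hf.aemeasurable hg.aemeasurable).1 h3]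
  have e := congrArg (Measure.map MeasurableEquiv.prodAssoc.symm) h1
  rw [Measure.map_map MeasurableEquiv.prodAssoc.symm.measurable (hf.prodMk (hg.prodMk hh))] at e
  exact e.trans (measurePreserving_prodAssoc _ _ _).symm.map_eq

theorem measurable_ncard_time {S : Set ℝ≥0} (hS : MeasurableSet S) :
    Measurable fun τ : ℕ → ℝ≥0 => {m | τ m ∈ S}.ncard := by
  refine measurable_ncard.comp (measurable_set_iff.2 fun m => ?_)
  exact measurableSet_setOfPred.1 (measurable_pi_apply m hS)

/-! ### The joint law of the random input -/

section Input

variable {k : ℕ} {Ω : Type*} [MeasurableSpace Ω] {P : Measure Ω} [IsProbabilityMeasure P]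
  {lam : ℝ≥0} {ν : Measure (RankedSimplex k)} [IsProbabilityMeasure ν] {p₀ : Ω → RankedSimplex k}
  {T : ℕ → Ω → ℝ≥0} {M : ℕ → Ω → Fin k → RankedSimplex k}
  {σ : ℕ → Ω → Fin k → Equiv.Perm (Fin k)}

omit [IsProbabilityMeasure P] [IsProbabilityMeasure ν] in
theorem IsRankedMassInput.map_perm (h : IsRankedMassInput P lam ν p₀ T M σ) :
    P.map (fun ω m => σ m ω) =
      Measure.infinitePi fun _ : ℕ => Measure.pi fun _ : Fin k => uniformPerm k := by
  have hm : ∀ q : ℕ × Fin k, Measurable fun ω => σ q.1 ω q.2 := fun q =>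
    (measurable_pi_apply q.2).comp (h.measurable_perm q.1)
  have h1 := h.perm_indep.map_fun_eq_infinitePi_map hm
  have h2 : ∀ q : ℕ × Fin k, P.map (fun ω => σ q.1 ω q.2) = uniformPerm k := by
    intro q
    refine Measure.ext_of_singleton fun τ => ?_
    rw [Measure.map_apply (hm q) (measurableSet_singleton τ), uniformPerm_singleton]
    exact h.perm_uniform q.1 q.2 τ
  simp only [h2] at h1
  have h3 := Measure.infinitePi_map_curry (ι := ℕ) (κ := Fin k) (fun _ _ => uniformPerm k)
  have h4 := congrArg (Measure.map (MeasurableEquiv.curry ℕ (Fin k) (Equiv.Perm (Fin k)))) h1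
  rw [Measure.map_map (MeasurableEquiv.measurable _) (measurable_pi_lambda _ hm)] at h4
  have h5 : (fun _ : ℕ => Measure.infinitePi fun _ : Fin k => uniformPerm k) =
      fun _ => Measure.pi fun _ : Fin k => uniformPerm k := by
    funext _
    exact Measure.infinitePi_eq_pi _
  rw [← h5]
  exact h4.trans h3

/-- The initial state, the times, and the marks with their permutations are independent. -/
theorem IsRankedMassInput.map_input (h : IsRankedMassInput P lam ν p₀ T M σ) :
    P.map (fun ω => ((p₀ ω, fun m => T m ω), fun m i => (M m ω i, σ m ω i))) =
      ((P.map p₀).prod (P.map fun ω m => T m ω)).prod (Measure.infinitePi fun _ : ℕ => markLaw ν) := by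
  have hT : Measurable fun ω m => T m ω := measurable_pi_lambda _ h.measurable_time
  have hM : Measurable fun ω m => M m ω := measurable_pi_lambda _ h.measurable_mark
  have hσ : Measurable fun ω m => σ m ω := measurable_pi_lambda _ h.measurable_perm
  have i1 := Measure.isProbabilityMeasure_map (μ := P) h.measurable_init.aemeasurable
  have i2 := Measure.isProbabilityMeasure_map (μ := P) hT.aemeasurable
  set μM := Measure.infinitePi fun _ : ℕ => Measure.pi fun _ : Fin k => ν
  set μσ := Measure.infinitePi fun _ : ℕ => Measure.pi fun _ : Fin k => uniformPerm k
  have hun : Measurable fun q : ℕ → ℝ≥0 × (Fin k → RankedSimplex k) =>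
      ((fun m => (q m).1), fun m => (q m).2) :=
    (measurable_pi_lambda _ fun m => measurable_fst.comp (measurable_pi_apply m)).prodMk
      (measurable_pi_lambda _ fun m => measurable_snd.comp (measurable_pi_apply m))
  have h1 : P.map (fun ω => (p₀ ω, ((fun m => T m ω), fun m => M m ω))) =
      (P.map p₀).prod ((P.map fun ω m => T m ω).prod μM) := by
    rw [← h.map_times_marks]
    exact (indepFun_iff_map_prod_eq_prod_map_map h.measurable_init.aemeasurable
      (hT.prodMk hM).aemeasurable).1 (h.indep_init.comp measurable_id hun)
  have h2 : P.map (fun ω => ((p₀ ω, ((fun m => T m ω), fun m => M m ω)), fun m => σ m ω)) =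
      ((P.map p₀).prod ((P.map fun ω m => T m ω).prod μM)).prod μσ := by
    have h3 : P.map (fun ω m => σ m ω) = μσ := h.map_perm
    rw [← h1, ← h3]
    exact (indepFun_iff_map_prod_eq_prod_map_map
      (h.measurable_init.prodMk (hT.prodMk hM)).aemeasurable hσ.aemeasurable).1
      (h.indep_perm.comp (measurable_id.prodMap hun) measurable_id)
  have hz1 : MeasurePreserving (fun (q : (ℕ → Fin k → RankedSimplex k) ×
      (ℕ → Fin k → Equiv.Perm (Fin k))) m => (q.1 m, q.2 m)) (μM.prod μσ)
      (Measure.infinitePi fun _ => (Measure.pi fun _ : Fin k => ν).prod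
        (Measure.pi fun _ : Fin k => uniformPerm k)) :=
    ⟨measurable_pi_lambda _ fun i => ((measurable_pi_apply i).comp measurable_fst).prodMk
      ((measurable_pi_apply i).comp measurable_snd), infinitePi_prod_infinitePi_map_zip _ _⟩
  have hz2 : MeasurePreserving (fun (q : (Fin k → RankedSimplex k) ×
      (Fin k → Equiv.Perm (Fin k))) i => (q.1 i, q.2 i)) ((Measure.pi fun _ : Fin k => ν).prod
        (Measure.pi fun _ : Fin k => uniformPerm k)) (markLaw ν) :=
    (measurePreserving_arrowProdEquivProdArrow _ _ (Fin k) (fun _ => ν)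
      (fun _ => uniformPerm k)).symm
  have hz3 : MeasurePreserving (fun (q : ℕ → (Fin k → RankedSimplex k) ×
      (Fin k → Equiv.Perm (Fin k))) m i => ((q m).1 i, (q m).2 i))
      (Measure.infinitePi fun _ => (Measure.pi fun _ : Fin k => ν).prod
        (Measure.pi fun _ : Fin k => uniformPerm k)) (Measure.infinitePi fun _ => markLaw ν) := by
    refine ⟨measurable_pi_lambda _ fun m => hz2.measurable.comp (measurable_pi_apply m), ?_⟩
    have := Measure.infinitePi_map_pi (μ := fun _ : ℕ => (Measure.pi fun _ : Fin k => ν).prod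
      (Measure.pi fun _ : Fin k => uniformPerm k)) (fun _ : ℕ => hz2.measurable)
    simp only [hz2.map_eq] at this
    exact this
  have hmp := ((MeasurePreserving.id ((P.map p₀).prod (P.map fun ω m => T m ω))).prod
    (hz3.comp hz1)).comp ((measurePreserving_prodAssoc _ μM μσ).comp
    ((measurePreserving_prodAssoc (P.map p₀) (P.map fun ω m => T m ω) μM).symm.prod
      (MeasurePreserving.id μσ)))
  rw [← hmp.map_eq, ← h2, Measure.map_map hmp.measurable
    ((h.measurable_init.prodMk (hT.prodMk hM)).prodMk hσ)]
  rfl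

/-! ### The number of atoms up to a given time -/

omit [IsProbabilityMeasure P] in
theorem IsRankedMassInput.measure_count (h : IsRankedMassInput P lam ν p₀ T M σ) {S : Set ℝ≥0}
    (hS : MeasurableSet S) {w : ℝ≥0} (hw : lebesgueNonneg S = w) (j : ℕ) :
    P {ω | {m | T m ω ∈ S}.encard = j} = poissonMeasure (lam * w) {j} := by
  have e : (lebesgueNonneg.prod (lam • Measure.pi fun _ : Fin k => ν)) (S ×ˢ Set.univ) =
      (lam * w : ℝ≥0) := by
    rw [intensity_prod, hw, measure_univ, mul_one, ENNReal.coe_mul, mul_comm]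
  have h1 := h.poisson.poisson (S ×ˢ Set.univ) (hS.prod MeasurableSet.univ)
    (by rw [e]; exact ENNReal.coe_ne_top) j
  rw [e, ENNReal.toNNReal_coe] at h1
  rw [← h1]
  refine measure_congr ?_
  filter_upwards [h.strictMono] with ω hω
  refine propext ?_
  change _ ↔ (Set.range (fun m => (T m ω, M m ω)) ∩ S ×ˢ Set.univ).encard = j
  rw [encard_range_inter hω]
  simp only [Set.mem_univ, and_true]
  rfl

theorem measurable_encard_time {S : Set ℝ≥0} (hS : MeasurableSet S) :
    Measurable fun τ : ℕ → ℝ≥0 => {m | τ m ∈ S}.encard := by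
  refine measurable_encard.comp (measurable_set_iff.2 fun m => ?_)
  exact measurableSet_setOfPred.1 (measurable_pi_apply m hS)

/-- Poisson weights sum to 1, leaving no mass for infinitely many atoms. This matters because
`ncard` is 0 on infinite sets. -/
theorem IsRankedMassInput.ae_finite_count (h : IsRankedMassInput P lam ν p₀ T M σ) {S : Set ℝ≥0}
    (hS : MeasurableSet S) {w : ℝ≥0} (hw : lebesgueNonneg S = w) :
    ∀ᵐ ω ∂P, {m | T m ω ∈ S}.Finite := by
  have hT : Measurable fun ω m => T m ω := measurable_pi_lambda _ h.measurable_time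
  have hm : Measurable fun ω => {m | T m ω ∈ S}.encard := (measurable_encard_time hS).comp hT
  have h1 : P (⋃ j : ℕ, {ω | {m | T m ω ∈ S}.encard = j}) = 1 := by
    have h2 := measure_iUnion (μ := P) (f := fun j : ℕ => {ω | {m | T m ω ∈ S}.encard = j})
      (fun i j hij => Set.disjoint_left.2 fun ω h1 h2 => hij
        (Nat.cast_injective (R := ℕ∞) ((show _ = _ from h1).symm.trans h2)))
      fun j => hm (measurableSet_singleton _)
    rw [h2]
    simp only [h.measure_count hS hw, tsum_poissonMeasure_singleton]
  have h2 := (prob_compl_eq_zero_iff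
    (MeasurableSet.iUnion fun j : ℕ => hm (measurableSet_singleton (j : ℕ∞)))).2 h1
  have h3 : ∀ᵐ ω ∂P, ω ∈ ⋃ j : ℕ, {ω | {m | T m ω ∈ S}.encard = j} := h2
  filter_upwards [h3] with ω hω
  obtain ⟨j, hj⟩ := Set.mem_iUnion.1 hω
  exact Set.finite_of_encard_eq_coe hj

theorem IsRankedMassInput.map_count (h : IsRankedMassInput P lam ν p₀ T M σ) {S : Set ℝ≥0}
    (hS : MeasurableSet S) {w : ℝ≥0} (hw : lebesgueNonneg S = w) :
    P.map (fun ω => {m | T m ω ∈ S}.ncard) = poissonMeasure (lam * w) := by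
  have hT : Measurable fun ω m => T m ω := measurable_pi_lambda _ h.measurable_time
  have hm : Measurable fun ω => {m | T m ω ∈ S}.ncard := (measurable_ncard_time hS).comp hT
  refine Measure.ext_of_singleton fun j => ?_
  rw [Measure.map_apply hm (measurableSet_singleton j), ← h.measure_count hS hw]
  refine measure_congr ?_
  filter_upwards [h.ae_finite_count hS hw] with ω hω
  refine propext ?_
  change {m | T m ω ∈ S}.ncard = j ↔ {m | T m ω ∈ S}.encard = j
  rw [← hω.cast_ncard_eq, Nat.cast_inj]

omit [IsProbabilityMeasure P] [IsProbabilityMeasure ν] in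
theorem IsRankedMassInput.iIndepFun_count (h : IsRankedMassInput P lam ν p₀ T M σ) {ι : Type*}
    [Fintype ι] {S : ι → Set ℝ≥0} (hS : ∀ i, MeasurableSet (S i))
    (hd : Pairwise fun i j => Disjoint (S i) (S j)) :
    iIndepFun (fun i ω => {m | T m ω ∈ S i}.ncard) P := by
  have h1 := h.poisson.iIndepFun_encard (A := fun i => S i ×ˢ Set.univ)
    (fun i => (hS i).prod MeasurableSet.univ)
    fun i j hij => Set.disjoint_prod.2 (Or.inl (hd hij))
  have h2 := h1.comp (fun _ => ENat.toNat) fun _ => measurable_of_countable _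
  refine h2.congr fun i => ?_
  filter_upwards [h.strictMono] with ω hω
  simp only [Function.comp_apply]
  rw [encard_range_inter hω]
  simp only [Set.mem_univ, and_true]
  rfl

end Input

/-! ### Independent increments of the counting process -/

/-- The cells into which the times `s 0 ≤ s 1 ≤ ⋯` cut the time axis. -/
def timeCell (s : ℕ → ℝ≥0) : ℕ → Set ℝ≥0
  | 0 => Set.Iic (s 0)
  | j + 1 => Set.Ioc (s j) (s (j + 1))

theorem measurableSet_timeCell (s : ℕ → ℝ≥0) (j : ℕ) : MeasurableSet (timeCell s j) := by
  cases j with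
  | zero => exact measurableSet_Iic
  | succ j => exact measurableSet_Ioc

theorem disjoint_timeCell {s : ℕ → ℝ≥0} (hs : Monotone s) {i j : ℕ} (hij : i < j) :
    Disjoint (timeCell s i) (timeCell s j) := by
  obtain ⟨j, rfl⟩ : ∃ l, j = l + 1 := ⟨j - 1, by omega⟩
  refine Set.disjoint_left.2 fun x hx hx' => not_lt.2 ?_ hx'.1
  have : x ≤ s i := by
    cases i with
    | zero => exact hx
    | succ i => exact hx.2
  exact this.trans (hs (by omega))

theorem ncard_time_eq_sum {τ : ℕ → ℝ≥0} {s : ℕ → ℝ≥0} (hs : Monotone s)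
    (hfin : ∀ j, {m | τ m ≤ s j}.Finite) (n : ℕ) :
    {m | τ m ≤ s n}.ncard = ∑ j ∈ Finset.range (n + 1), {m | τ m ∈ timeCell s j}.ncard := by
  induction n with
  | zero => rw [zero_add, Finset.sum_range_one]; rfl
  | succ n ih =>
    rw [Finset.sum_range_succ, ← ih, ← Set.ncard_union_eq
      (s := {m | τ m ≤ s n}) (t := {m | τ m ∈ timeCell s (n + 1)})
      (Set.disjoint_left.2 fun m h1 h2 => not_lt.2 h1 h2.1) (hfin n)
      ((hfin (n + 1)).subset fun m hm => hm.2)]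
    · congr 1
      ext m
      simp only [timeCell, Set.mem_union, Set.mem_ofPred_eq, Set.mem_Ioc]
      have := hs (Nat.le_succ n)
      constructor
      · intro h
        rcases le_or_gt (τ m) (s n) with h1 | h1
        exacts [Or.inl h1, Or.inr ⟨h1, h⟩]
      · rintro (h | h)
        exacts [h.trans this, h.2]

section Input

variable {k : ℕ} {Ω : Type*} [MeasurableSpace Ω] {P : Measure Ω} [IsProbabilityMeasure P]
  {lam : ℝ≥0} {ν : Measure (RankedSimplex k)} [IsProbabilityMeasure ν] {p₀ : Ω → RankedSimplex k}
  {T : ℕ → Ω → ℝ≥0} {M : ℕ → Ω → Fin k → RankedSimplex k}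
  {σ : ℕ → Ω → Fin k → Equiv.Perm (Fin k)}

theorem IsRankedMassInput.ae_finite_time (h : IsRankedMassInput P lam ν p₀ T M σ) (t : ℝ≥0) :
    ∀ᵐ ω ∂P, {m | T m ω ≤ t}.Finite :=
  h.ae_finite_count measurableSet_Iic (lebesgueNonneg_Iic t)

/-- Counts up to the first `n + 1` times are sums over cells disjoint from the next cell. -/
theorem IsRankedMassInput.indepFun_count (h : IsRankedMassInput P lam ν p₀ T M σ) {s : ℕ → ℝ≥0}
    (hs : Monotone s) (n : ℕ) :
    IndepFun (fun ω (i : Fin (n + 1)) => {m | T m ω ≤ s i}.ncard)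
      (fun ω => {m | T m ω ∈ timeCell s (n + 1)}.ncard) P := by
  have hT : Measurable fun ω m => T m ω := measurable_pi_lambda _ h.measurable_time
  have h1 := h.iIndepFun_count (S := fun j : Fin (n + 2) => timeCell s j)
    (fun j => measurableSet_timeCell s j) fun i j hij => by
      rcases lt_or_gt_of_ne hij with hlt | hlt
      exacts [disjoint_timeCell hs hlt, (disjoint_timeCell hs hlt).symm]
  have h2 := h1.indepFun_finset
    (Finset.univ.filter fun j : Fin (n + 2) => (j : ℕ) ≤ n) {Fin.last (n + 1)}
    (Finset.disjoint_left.2 fun j hj hj' => by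
      rw [Finset.mem_singleton] at hj'
      subst hj'
      simp at hj)
    fun j => (measurable_ncard_time (measurableSet_timeCell s j)).comp hT
  have hφ : Measurable fun (x : (Finset.univ.filter fun j : Fin (n + 2) => (j : ℕ) ≤ n) → ℕ) (i : Fin (n + 1)) =>
      ∑ j : Fin (i + 1), x ⟨⟨j, by omega⟩, by simp; omega⟩ :=
    measurable_pi_lambda _ fun i => Finset.measurable_sum _ fun j _ => measurable_pi_apply _
  have h3 := h2.comp hφ (measurable_pi_apply ⟨Fin.last (n + 1), Finset.mem_singleton_self _⟩)
  refine h3.congr ?_ (Eventually.of_forall fun ω => rfl)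
  filter_upwards [ae_all_iff.2 fun j => h.ae_finite_time (s j)] with ω hω
  funext i
  rw [ncard_time_eq_sum hs hω]
  exact Fin.sum_univ_eq_sum_range (fun j => {m | T m ω ∈ timeCell s j}.ncard) (i + 1)

/-! ### The transition mechanism of the process of ranked masses -/

omit [IsProbabilityMeasure P] [IsProbabilityMeasure ν] in
theorem rankedStates_coe (x : RankedSimplex k) (p : ℕ → Fin k → RankedSimplex k)
    (τ : ℕ → Fin k → Equiv.Perm (Fin k)) (n : ℕ) :
    (rankedStates x p τ n).1 = drivenChain massStep x.1 (fun m i => (p m i, τ m i)) n := by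
  induction n with
  | zero => rfl
  | succ n ih =>
    rw [drivenChain, ← ih]
    rfl

omit [IsProbabilityMeasure P] [IsProbabilityMeasure ν] in
theorem IsRankedMassInput.measurable_rankedPath (h : IsRankedMassInput P lam ν p₀ T M σ) (t : ℝ≥0) :
    Measurable fun ω => (rankedPath (p₀ ω) (fun m => T m ω) (fun m => M m ω) (fun m => σ m ω) t).1 := by
  have hT : Measurable fun ω m => T m ω := measurable_pi_lambda _ h.measurable_time
  have hZ : Measurable fun ω m i => (M m ω i, σ m ω i) :=
    measurable_pi_lambda _ fun m => measurable_pi_lambda _ fun i =>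
      ((measurable_pi_apply i).comp (h.measurable_mark m)).prodMk
        ((measurable_pi_apply i).comp (h.measurable_perm m))
  have hN : Measurable fun ω => {m | T m ω ≤ t}.ncard :=
    (measurable_ncard_time (measurableSet_Iic (a := t))).comp hT
  simp only [rankedPath, rankedStates_coe]
  exact (measurable_drivenChain_uncurry measurable_massStep).comp
    (((measurable_subtype_coe.comp h.measurable_init).prodMk hZ).prodMk hN)

/-- At each time the state is the driven chain after as many steps as there are atoms so far. The
next increment of the count is Poisson and independent of the initial state and the earlier counts,
and the marks with their permutations are independent of all of these. -/
theorem IsRankedMassInput.hasTransition (h : IsRankedMassInput P lam ν p₀ T M σ) :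
    HasTransition P
      (fun t ω => (rankedPath (p₀ ω) (fun m => T m ω) (fun m => M m ω) (fun m => σ m ω) t).1)
      fun u => poissonizedKernel (massKernel ν) (lam * u) := by
  intro n t ht
  have hT : Measurable fun ω m => T m ω := measurable_pi_lambda _ h.measurable_time
  have hp : Measurable fun ω => (p₀ ω).1 := measurable_subtype_coe.comp h.measurable_init
  have hZ : Measurable fun ω m i => (M m ω i, σ m ω i) :=
    measurable_pi_lambda _ fun m => measurable_pi_lambda _ fun i =>
      ((measurable_pi_apply i).comp (h.measurable_mark m)).prodMk
        ((measurable_pi_apply i).comp (h.measurable_perm m))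
  -- The finitely many times are continued as a constant sequence, to fit the cells of `timeCell`.
  let s : ℕ → ℝ≥0 := fun j => t ⟨min j (n + 1), by omega⟩
  have hs : Monotone s := fun i j hij => ht (by
    rw [Fin.le_def]
    exact min_le_min_right _ hij)
  have hst : ∀ i : Fin (n + 1), s i = t i.castSucc := fun i =>
    congrArg t (Fin.ext (min_eq_left (by omega)))
  have hsl : s (n + 1) = t (Fin.last _) := congrArg t (Fin.ext (min_self _))
  have hNm : Measurable fun (τ : ℕ → ℝ≥0) (i : Fin (n + 1)) => {m | τ m ≤ s i}.ncard :=
    measurable_pi_lambda _ fun i => measurable_ncard_time (measurableSet_Iic (a := s i))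
  have hDm : Measurable fun τ : ℕ → ℝ≥0 => {m | τ m ∈ timeCell s (n + 1)}.ncard :=
    measurable_ncard_time (measurableSet_timeCell s (n + 1))
  set N : Ω → Fin (n + 1) → ℕ := fun ω i => {m | T m ω ≤ s i}.ncard with hNdef
  set D : Ω → ℕ := fun ω => {m | T m ω ∈ timeCell s (n + 1)}.ncard with hDdef
  set Z : Ω → ℕ → Fin k → RankedSimplex k × Equiv.Perm (Fin k) := fun ω m i => (M m ω i, σ m ω i)
  have hN : Measurable N := hNm.comp hT
  have hD : Measurable D := hDm.comp hT
  have i1 := Measure.isProbabilityMeasure_map (μ := P) h.measurable_init.aemeasurable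
  have i2 := Measure.isProbabilityMeasure_map (μ := P) hT.aemeasurable
  have hfin := ae_all_iff.2 fun j => h.ae_finite_time (s j)
  have hin := h.map_input
  have hpT : P.map (fun ω => (p₀ ω, fun m => T m ω)) =
      (P.map p₀).prod (P.map fun ω m => T m ω) := by
    have := congrArg (Measure.map Prod.fst) hin
    rw [Measure.map_map measurable_fst ((h.measurable_init.prodMk hT).prodMk hZ),
      Measure.map_fst_prod, measure_univ, one_smul] at this
    exact this
  have hZl : P.map Z = Measure.infinitePi fun _ : ℕ => markLaw ν := by
    have := congrArg (Measure.map Prod.snd) hin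
    rw [Measure.map_map measurable_snd ((h.measurable_init.prodMk hT).prodMk hZ),
      Measure.map_snd_prod, measure_univ, one_smul] at this
    exact this
  have ind1 : IndepFun (fun ω => (p₀ ω, fun m => T m ω)) Z P := by
    rw [indepFun_iff_map_prod_eq_prod_map_map (h.measurable_init.prodMk hT).aemeasurable
      hZ.aemeasurable, hpT, hZl]
    exact hin
  have ind2 : IndepFun p₀ (fun ω m => T m ω) P := by
    rw [indepFun_iff_map_prod_eq_prod_map_map h.measurable_init.aemeasurable hT.aemeasurable]
    exact hpT
  have ind3 : IndepFun (fun ω => ((p₀ ω).1, N ω)) D P :=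
    indepFun_prodMk_left hp hN hD (ind2.comp measurable_subtype_coe (hNm.prodMk hDm))
      (h.indepFun_count hs n)
  have ind4 : IndepFun (fun ω => (((p₀ ω).1, N ω), D ω)) Z P :=
    ind1.comp (((measurable_subtype_coe.comp measurable_fst).prodMk
      (hNm.comp measurable_snd)).prodMk (hDm.comp measurable_snd)) measurable_id
  have hDl : P.map D = poissonMeasure (lam * (t (Fin.last _) - t (Fin.last n).castSucc)) := by
    refine h.map_count (measurableSet_timeCell s (n + 1)) ?_
    rw [timeCell, lebesgueNonneg_Ioc, hsl, ← hst]
    rfl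
  have hlaw : P.map (fun ω => ((((p₀ ω).1, N ω), D ω), Z ω)) =
      ((P.map fun ω => ((p₀ ω).1, N ω)).prod (poissonMeasure
        (lam * (t (Fin.last _) - t (Fin.last n).castSucc)))).prod
        (Measure.infinitePi fun _ => markLaw ν) := by
    rw [(indepFun_iff_map_prod_eq_prod_map_map ((hp.prodMk hN).prodMk hD).aemeasurable
      hZ.aemeasurable).1 ind4, (indepFun_iff_map_prod_eq_prod_map_map (hp.prodMk hN).aemeasurable
      hD.aemeasurable).1 ind3, hDl, hZl]
  have hmono : ∀ᵐ ω ∂P, ∀ i, N ω i ≤ N ω (Fin.last n) := by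
    filter_upwards [hfin] with ω hω i
    exact Set.ncard_le_ncard (fun m hm => (show T m ω ≤ s i from hm).trans (hs (Fin.le_last i)))
      (hω n)
  have key := map_drivenChain_poisson (markLaw ν) measurable_massStep hp hN hD hZ hmono hlaw
  have hX : ∀ u ω, (rankedPath (p₀ ω) (fun m => T m ω) (fun m => M m ω) (fun m => σ m ω) u).1 =
      drivenChain massStep (p₀ ω).1 (Z ω) {m | T m ω ≤ u}.ncard := fun u ω =>
    rankedStates_coe _ _ _ _
  have e1 : (fun ω (i : Fin (n + 1)) => (rankedPath (p₀ ω) (fun m => T m ω) (fun m => M m ω)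
      (fun m => σ m ω) (t i.castSucc)).1) =
      fun ω i => drivenChain massStep (p₀ ω).1 (Z ω) (N ω i) := by
    funext ω i
    rw [hX, ← hst]
  have hch := measurable_drivenChain_uncurry (measurable_massStep (k := k))
  have hpair : Measurable fun ω => ((fun i => drivenChain massStep (p₀ ω).1 (Z ω) (N ω i)),
      drivenChain massStep (p₀ ω).1 (Z ω) (N ω (Fin.last n) + D ω)) := by
    refine Measurable.prodMk (measurable_pi_lambda _ fun i => ?_) ?_
    · exact hch.comp ((hp.prodMk hZ).prodMk ((measurable_pi_apply i).comp hN))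
    · exact hch.comp ((hp.prodMk hZ).prodMk
        (((measurable_pi_apply (Fin.last n)).comp hN).add hD))
  rw [e1]
  refine Eq.trans ?_ (congrArg (Measure.map fun q : (Fin (n + 1) → Fin k → ℝ) × (Fin k → ℝ) =>
    (Fin.snoc q.1 q.2 : Fin (n + 2) → Fin k → ℝ)) key)
  rw [Measure.map_map measurable_finSnoc hpair]
  refine Measure.map_congr ?_
  filter_upwards [hfin] with ω hω
  funext i
  induction i using Fin.lastCases with
  | last =>
    simp only [Function.comp_apply, Fin.snoc_last]
    rw [hX, ← hsl, ncard_time_eq_sum hs hω, Finset.sum_range_succ, ← ncard_time_eq_sum hs hω]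
    rfl
  | cast i =>
    simp only [Function.comp_apply, Fin.snoc_castSucc]
    rw [hX, ← hst]

/-- An atom at time 0 would already have moved the path; the count on {0} is Poisson with mean 0, so
there is almost surely none. -/
theorem IsRankedMassInput.ae_rankedPath_zero (h : IsRankedMassInput P lam ν p₀ T M σ) :
    ∀ᵐ ω ∂P, (rankedPath (p₀ ω) (fun m => T m ω) (fun m => M m ω) (fun m => σ m ω) 0).1 =
      (p₀ ω).1 := by
  have h1 := h.measure_count measurableSet_Iic (lebesgueNonneg_Iic 0) 0
  have hT : Measurable fun ω m => T m ω := measurable_pi_lambda _ h.measurable_time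
  have hm : MeasurableSet {ω | {m | T m ω ∈ Set.Iic (0 : ℝ≥0)}.encard = (0 : ℕ)} :=
    (measurable_encard_time (measurableSet_Iic (a := (0 : ℝ≥0)))).comp hT
      (measurableSet_singleton _)
  rw [mul_zero, poissonMeasure_singleton] at h1
  simp only [NNReal.coe_zero, neg_zero, Real.exp_zero, pow_zero, Nat.factorial_zero, Nat.cast_one,
    mul_one, div_one, ENNReal.ofReal_one] at h1
  have h2 : ∀ᵐ ω ∂P, ω ∈ {ω | {m | T m ω ∈ Set.Iic (0 : ℝ≥0)}.encard = (0 : ℕ)} :=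
    (prob_compl_eq_zero_iff hm).2 h1
  filter_upwards [h2] with ω hω
  have h3 : {m | T m ω ≤ 0} = ∅ := Set.encard_eq_zero.1 hω
  rw [rankedPath, h3, Set.ncard_empty]
  rfl

end Input

theorem mainTheorem11 {Ω Ω' : Type*} [MeasurableSpace Ω] [MeasurableSpace Ω']
    (P : Measure Ω) [IsProbabilityMeasure P] (P' : Measure Ω') [IsProbabilityMeasure P']
    (k : ℕ) (lam : ℝ≥0) (hlam : 0 < lam) (ν : Measure (RankedSimplex k)) [IsProbabilityMeasure ν]
    (B : ℝ≥0 → Ω → BoundedPartition ℕ k)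
    (hB : IsPaintboxMarkovProcess P lam ν B) (hB0 : IsExchangeablePartition P (B 0)) :
    (∀ᵐ ω ∂P, ∀ t, (B t ω).HasFrequencies) ∧
    ∀ (p₀ : Ω' → RankedSimplex k) (T : ℕ → Ω' → ℝ≥0) (M : ℕ → Ω' → Fin k → RankedSimplex k)
      (σ : ℕ → Ω' → Fin k → Equiv.Perm (Fin k)),
      IsRankedMassInput P' lam ν p₀ T M σ →
      IdentDistrib (fun ω => (p₀ ω).1) (fun ω => (B 0 ω).rankedFreq) P' P →
      IdentDistrib
        (fun ω (t : ℝ≥0) =>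
          (rankedPath (p₀ ω) (fun m => T m ω) (fun m => M m ω) (fun m => σ m ω) t).1)
        (fun ω (t : ℝ≥0) => (B t ω).rankedFreq) P' P := by
  refine ⟨hB.ae_forall_hasFrequencies hB0, fun p₀ T M σ h h0 => ?_⟩
  refine HasTransition.identDistrib (P := P')
    (Y := fun t ω => (rankedPath (p₀ ω) (fun m => T m ω) (fun m => M m ω) (fun m => σ m ω) t).1)
    (Y' := fun t ω => (B t ω).rankedFreq) h.measurable_rankedPath
    (fun t => BoundedPartition.measurable_rankedFreq.comp (hB.measurable t)) h.hasTransition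
    (hB.hasTransition_rankedFreq hB0) ?_
  rw [Measure.map_congr h.ae_rankedPath_zero]
  exact h0.map_eq
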